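/- Let $d\ge 1$, $s\ge 0$ and $M\in\mathbb R$. For an integrable $f:\mathbb R^d\to\mathbb R$ put $\mathcal F(f)(\omega)=(2\pi)^{-d/2}\int_{\mathbb R^d} f(x)e^{-ix^\top\omega}\,dx$ and $\|f\|_{\mathcal W^{s,2}}^2=\int_{\mathbb R^d}(1+\|\omega\|^2)^s|\mathcal F(f)(\omega)|^2\,d\omega$, and let $\mathcal W^{s,2}(M)$ be the set of integrable, almost everywhere continuous $f:\mathbb R^d\to\mathbb R$ with $\|f\|_{\mathcal W^{s,2}}<\infty$ and $\|f\|_{\mathcal W^{s,2}}\le M$. For $\nu>0$ let $G_\nu(x,y)=\exp(-\nu\|x-y\|^2)$, $x,y\in\mathbb R^d$. For each $n$ let $X_1,\dots,X_n$ be i.i.d. with Lebesgue density $p$ on $\mathbb R^d$ and, independently of them, let $Y_1,\dots,Y_m$ be i.i.d. with Lebesgue density $q$ on $\mathbb R^d$, where $m=m_n$ satisfies $c\le m/n\le C$ for all $n\ge1$ with constants $0<c\le C<\infty$ (the densities $p,q$ do not depend on $n$). Put $$\widehat{\gamma_\nu^2}=\frac1{n(n-1)}\sum_{1\le i\ne j\le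 n}G_\nu(X_i,X_j)+\frac1{m(m-1)}\sum_{1\le i\ne j\le m}G_\nu(Y_i,Y_j)-\frac2{mn}\sum_{i=1}^n\sum_{j=1}^mG_\nu(X_i,Y_j).$$ With $N=n+m$, $Z_i=X_i$ for $i\le n$ and $Z_i=Y_{i-n}$ for $i>n$, put $$\tilde s_{n,m,\nu}^2=\frac1{N(N-1)}\sum_{1\le i\ne j\le N}G_{2\nu}(Z_i,Z_j)-\frac{2(N-3)!}{N!}\sum_{|\{i,j_1,j_2\}|=3}G_\nu(Z_i,Z_{j_1})G_\nu(Z_i,Z_{j_2})+\frac{(N-4)!}{N!}\sum_{|\{i_1,i_2,j_1,j_2\}|=4}G_\nu(Z_{i_1},Z_{j_1})G_\nu(Z_{i_2},Z_{j_2}),$$ where all indices range over $1,\dots,N$, and put $$\widehat s_{n,m,\nu}^{\,2}=\max\{\tilde s_{n,m,\nu}^2,\,1/n^2\},\qquad T^{\rm HOM}_{n,\nu}=\frac{nm}{\sqrt2\,(n+m)}\,\widehat s_{n,m,\nu}^{\,-1}\,\widehat{\gamma_\nu^2}.$$ Let $\nu_n>0$ with $\nu_n\to\infty$ and $\nu_n=o(n^{4/d})$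 as $n\to\infty$. Then, under the null hypothesis $H_0^{\rm HOM}:\ p=q\in\mathcal W^{s,2}(M)$, $$T^{\rm HOM}_{n,\nu_n}\ \to_d\ N(0,1)\qquad\text{as }n\to\infty.$$ -/

import Mathlib

open MeasureTheory ProbabilityTheory Filter Asymptotics
open scoped Topology

noncomputable section

namespace GaussianMMD

/-- The Fourier transform `𝓕 f (ω) = (2π)^(-d/2) ∫ f(x) exp(-i xᵀω) dx` of a real function on
`ℝ^d`. -/
def fourierTransform {d : ℕ} (f : EuclideanSpace ℝ (Fin d) → ℝ)
    (ω : EuclideanSpace ℝ (Fin d)) : ℂ :=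
  (((2 * Real.pi) ^ (-(d : ℝ) / 2) : ℝ) : ℂ) *
    ∫ x, (f x : ℂ) * Complex.exp (-(Complex.I * ((inner ℝ x ω : ℝ) : ℂ)))

/-- The integrand `(1 + ‖ω‖²)^s ‖𝓕 f (ω)‖²` of the squared Sobolev norm of order `s`. -/
def sobolevIntegrand {d : ℕ} (s : ℝ) (f : EuclideanSpace ℝ (Fin d) → ℝ)
    (ω : EuclideanSpace ℝ (Fin d)) : ℝ :=
  (1 + ‖ω‖ ^ 2) ^ s * ‖fourierTransform f ω‖ ^ 2

/-- The Sobolev norm of order `s` (meaningful when `sobolevIntegrand s f` is integrable). -/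
def sobolevNorm {d : ℕ} (s : ℝ) (f : EuclideanSpace ℝ (Fin d) → ℝ) : ℝ :=
  √(∫ ω, sobolevIntegrand s f ω)

/-- The Sobolev class `W^{s,2}` on `ℝ^d`: almost everywhere continuous functions whose Fourier
transform is square integrable against the weight `(1 + ‖ω‖²)^s`.  The Fourier transform is given by
an integral, so integrability of `f` is required for it to be meaningful. -/
def sobolevSpace (d : ℕ) (s : ℝ) : Set (EuclideanSpace ℝ (Fin d) → ℝ) :=
  {f | Integrable f volume ∧ (∀ᵐ x, ContinuousAt f x) ∧ Integrable (sobolevIntegrand s f) volume}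

/-- The Sobolev ball `W^{s,2}(M) = {f ∈ W^{s,2} : ‖f‖_{W^{s,2}} ≤ M}`. -/
def sobolevBall (d : ℕ) (s M : ℝ) : Set (EuclideanSpace ℝ (Fin d) → ℝ) :=
  {f | f ∈ sobolevSpace d s ∧ sobolevNorm s f ≤ M}

/-- `p` is a probability density on `ℝ^d` with respect to Lebesgue measure. -/
structure IsProbDensity {d : ℕ} (p : EuclideanSpace ℝ (Fin d) → ℝ) : Prop where
  integrable : Integrable p volume
  nonneg : ∀ᵐ x, 0 ≤ p x
  integral_eq_one : ∫ x, p x = 1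

/-- The measure with Lebesgue density `p`. -/
def densityMeasure {d : ℕ} (p : EuclideanSpace ℝ (Fin d) → ℝ) :
    Measure (EuclideanSpace ℝ (Fin d)) :=
  volume.withDensity fun x => ENNReal.ofReal (p x)

/-- The Gaussian kernel `G_ν(x, y) = exp(-ν ‖x - y‖²)`. -/
def gaussKernel {d : ℕ} (ν : ℝ) (x y : EuclideanSpace ℝ (Fin d)) : ℝ :=
  Real.exp (-ν * ‖x - y‖ ^ 2)

/-- The unbiased estimate of the squared Gaussian maximum mean discrepancy from the samples
`x₁, …, xₙ` and `y₁, …, yₘ`. -/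
def mmdSqHat {d n m : ℕ} (ν : ℝ) (x : Fin n → EuclideanSpace ℝ (Fin d))
    (y : Fin m → EuclideanSpace ℝ (Fin d)) : ℝ :=
  1 / ((n : ℝ) * ((n : ℝ) - 1)) *
      (∑ i, ∑ j, if i ≠ j then gaussKernel ν (x i) (x j) else 0)
    + 1 / ((m : ℝ) * ((m : ℝ) - 1)) *
      (∑ i, ∑ j, if i ≠ j then gaussKernel ν (y i) (y j) else 0)
    - 2 / ((m : ℝ) * (n : ℝ)) * ∑ i, ∑ j, gaussKernel ν (x i) (y j)

/-- The variance estimate `s̃²` computed from a (pooled) sample `z₁, …, z_N`. -/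
def varTilde {d N : ℕ} (ν : ℝ) (z : Fin N → EuclideanSpace ℝ (Fin d)) : ℝ :=
  1 / ((N : ℝ) * ((N : ℝ) - 1)) *
      (∑ i, ∑ j, if i ≠ j then gaussKernel (2 * ν) (z i) (z j) else 0)
    - 2 * ((N - 3).factorial : ℝ) / (N.factorial : ℝ) *
      (∑ i, ∑ j₁, ∑ j₂, if ({i, j₁, j₂} : Finset (Fin N)).card = 3 then
        gaussKernel ν (z i) (z j₁) * gaussKernel ν (z i) (z j₂) else 0)
    + ((N - 4).factorial : ℝ) / (N.factorial : ℝ) *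
      (∑ i₁, ∑ i₂, ∑ j₁, ∑ j₂, if ({i₁, i₂, j₁, j₂} : Finset (Fin N)).card = 4 then
        gaussKernel ν (z i₁) (z j₁) * gaussKernel ν (z i₂) (z j₂) else 0)

/-- The truncated variance estimate `ŝ² = max {s̃², 1/n²}`, where `s̃²` is computed from the pooled
sample `z = (x₁, …, xₙ, y₁, …, yₘ)`. -/
def varHat {d n m : ℕ} (ν : ℝ) (x : Fin n → EuclideanSpace ℝ (Fin d))
    (y : Fin m → EuclideanSpace ℝ (Fin d)) : ℝ :=
  max (varTilde ν (Fin.append x y)) (1 / (n : ℝ) ^ 2)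

/-- The studentized two-sample statistic `nm / (√2 (n + m)) · ŝ⁻¹ · mmdSqHat`. -/
def homStat {d n m : ℕ} (ν : ℝ) (x : Fin n → EuclideanSpace ℝ (Fin d))
    (y : Fin m → EuclideanSpace ℝ (Fin d)) : ℝ :=
  (n : ℝ) * (m : ℝ) / (√2 * ((n : ℝ) + (m : ℝ))) * (√(varHat ν x y))⁻¹ * mmdSqHat ν x y

end GaussianMMD

end

/-! Under the null hypothesis the pooled sample `Z` is i.i.d. with one law `μ`, and the squared
discrepancy is a quadratic form in it whose weights have zero row sums. The Gaussian kernel `G` may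
therefore be replaced by its doubly centred version `H` (`mmdSqHat_eq_sum_centered`), and the
statistic factors exactly as a normalised degenerate quadratic form `S` times `(ŝ²/σ)^(-1/2)`, where
`σ = E G(Z,Z')²` for independent `Z, Z'` (`pooledStat_eq`).

Asymptotic normality of `S` comes from Stein's method on the level of characteristic functions. Let
`D_a` collect the terms of `S` that involve the coordinate `a`. Then `∑ D_a = 2S`, the difference `S
- D_a` does not depend on the coordinate `a`, and `D_a` is centred given the other coordinates.
Taylor expansion around `S - D_a` yields `E[S f(S)] ≈ E[V f'(S)]`, where `V` is half the sum of the
conditional second moments of the `D_a`. If `V ≈ 1`, the test functions `sin (t ·)` and `cos (t ·)`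
turn this into `φ' = -tφ` up to a small error for the characteristic function `φ`, so `φ(t) ≈
exp(-t²/2)`. The errors are controlled by second and fourth moments of the rows of `H` and by the
trace of `H⁴` (`norm_charFun_quadForm_sub_le`).

Let `g` be the mean function of `G`, `θ` a uniform bound for `g`, and `Λ` a bound for the squared
norm of the integral operator of `G` on `L²(μ)`. Everything reduces to four limits: `1/(n²σ)`,
`θ/(nσ)`, `E g(Z)²/σ` and `Λ/σ` tend to zero. The first three also give `E|s̃² - σ| = o(σ)`, which
removes the studentisation.

The remaining work is analytic. A Gaussian Plancherel identity bounds the Gaussian energy of the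
density by a multiple of `ν^(-d/2)`; Fatou's lemma along the Gaussian approximate identity, which
converges where the density is continuous, then gives square integrability and a lower bound of
order `ν^(-d/2)` for `σ`. Cauchy–Schwarz gives `θ` of order `ν^(-d/4)`. Truncating the density at a
growing level, with Schur's test below it and the Hilbert–Schmidt norm above it, gives `Λ =
o(ν^(-d/2))`. The growth condition on `ν` says exactly that `n² ν^(-d/2)` tends to infinity. -/

namespace GaussianMMD

/-! ### Bounded measurable functions: a class with enough closure properties to make integrability
automatic. -/

/-- A measurable and bounded real function. -/
structure BddMeas {α : Type*} [MeasurableSpace α] (f : α → ℝ) : Prop where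
  measurable : Measurable f
  bounded : ∃ C, ∀ x, |f x| ≤ C

namespace BddMeas

variable {α β : Type*} [MeasurableSpace α] [MeasurableSpace β] {f g : α → ℝ}

theorem const (c : ℝ) : BddMeas (fun _ : α => c) := ⟨measurable_const, |c|, fun _ => le_rfl⟩

theorem add (hf : BddMeas f) (hg : BddMeas g) : BddMeas (fun x => f x + g x) := by
  obtain ⟨C, hC⟩ := hf.2
  obtain ⟨D, hD⟩ := hg.2
  exact ⟨hf.1.add hg.1, C + D, fun x => (abs_add_le _ _).trans (add_le_add (hC x) (hD x))⟩

theorem neg (hf : BddMeas f) : BddMeas (fun x => -f x) := by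
  obtain ⟨C, hC⟩ := hf.2
  exact ⟨hf.1.neg, C, fun x => by rw [abs_neg]; exact hC x⟩

theorem sub (hf : BddMeas f) (hg : BddMeas g) : BddMeas (fun x => f x - g x) := by
  simpa only [sub_eq_add_neg] using hf.add hg.neg

theorem mul (hf : BddMeas f) (hg : BddMeas g) : BddMeas (fun x => f x * g x) := by
  obtain ⟨C, hC⟩ := hf.2
  obtain ⟨D, hD⟩ := hg.2
  refine ⟨hf.1.mul hg.1, C * D, fun x => ?_⟩
  rw [abs_mul]
  exact mul_le_mul (hC x) (hD x) (abs_nonneg _) ((abs_nonneg _).trans (hC x))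

theorem const_mul (c : ℝ) (hf : BddMeas f) : BddMeas (fun x => c * f x) := (const c).mul hf

theorem abs (hf : BddMeas f) : BddMeas (fun x => |f x|) := by
  obtain ⟨C, hC⟩ := hf.2
  exact ⟨hf.1.abs, C, fun x => by rw [abs_abs]; exact hC x⟩

theorem pow (hf : BddMeas f) (k : ℕ) : BddMeas (fun x => f x ^ k) := by
  obtain ⟨C, hC⟩ := hf.2
  refine ⟨hf.1.pow_const k, C ^ k, fun x => ?_⟩
  rw [abs_pow]
  exact pow_le_pow_left₀ (abs_nonneg _) (hC x) k

theorem sum {κ : Type*} {s : Finset κ} {F : κ → α → ℝ} (h : ∀ k ∈ s, BddMeas (F k)) :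
    BddMeas (fun x => ∑ k ∈ s, F k x) := by
  classical
  induction s using Finset.induction_on with
  | empty => simpa using const 0
  | insert a s ha ih =>
    simp only [Finset.sum_insert ha]
    exact (h a (by simp)).add (ih fun k hk => h k (by simp [hk]))

theorem comp (hf : BddMeas f) {φ : β → α} (hφ : Measurable φ) : BddMeas (fun x => f (φ x)) := by
  obtain ⟨C, hC⟩ := hf.2
  exact ⟨hf.1.comp hφ, C, fun x => hC _⟩

theorem integrable (hf : BddMeas f) (μ : Measure α) [IsFiniteMeasure μ] : Integrable f μ := by
  obtain ⟨C, hC⟩ := hf.2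
  exact Integrable.of_bound hf.1.aestronglyMeasurable C (ae_of_all _ hC)

theorem integral_right {F : α → β → ℝ} (hF : BddMeas (Function.uncurry F)) (μ : Measure β)
    [IsProbabilityMeasure μ] : BddMeas (fun x => ∫ y, F x y ∂μ) := by
  obtain ⟨C, hC⟩ := hF.2
  refine ⟨(hF.1.stronglyMeasurable.integral_prod_right).measurable, C, fun x => ?_⟩
  have := norm_integral_le_of_norm_le_const (μ := μ) (f := fun y => F x y) (C := C)
    (ae_of_all _ fun y => hC (x, y))
  simpa using this

theorem continuous_comp (hf : BddMeas f) {φ : ℝ → ℝ} (hφ : Continuous φ) :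
    BddMeas (fun x => φ (f x)) := by
  obtain ⟨C, hC⟩ := hf.2
  obtain ⟨D, hD⟩ := (isCompact_Icc (a := -C) (b := C)).exists_bound_of_continuousOn
    hφ.continuousOn
  exact ⟨hφ.measurable.comp hf.1, D, fun x => hD _ (abs_le.1 (hC x))⟩

theorem curry {F : α → β → ℝ} (hF : BddMeas (Function.uncurry F)) (x : α) : BddMeas (F x) :=
  hF.comp measurable_prodMk_left

theorem curry_right {F : α → β → ℝ} (hF : BddMeas (Function.uncurry F)) (y : β) :
    BddMeas (fun x => F x y) :=
  hF.comp measurable_prodMk_right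

theorem swap {F : α → β → ℝ} (hF : BddMeas (Function.uncurry F)) :
    BddMeas (Function.uncurry fun y x => F x y) :=
  hF.comp measurable_swap

theorem comp₂ {F : α → β → ℝ} (hF : BddMeas (Function.uncurry F)) {γ : Type*} [MeasurableSpace γ]
    {u : γ → α} {v : γ → β} (hu : Measurable u) (hv : Measurable v) :
    BddMeas (fun c => F (u c) (v c)) :=
  hF.comp (hu.prodMk hv)

theorem integral_add (hf : BddMeas f) (hg : BddMeas g) {μ : Measure α} [IsFiniteMeasure μ] :
    ∫ x, (f x + g x) ∂μ = ∫ x, f x ∂μ + ∫ x, g x ∂μ :=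
  MeasureTheory.integral_add (hf.integrable μ) (hg.integrable μ)

theorem integral_sub (hf : BddMeas f) (hg : BddMeas g) {μ : Measure α} [IsFiniteMeasure μ] :
    ∫ x, (f x - g x) ∂μ = ∫ x, f x ∂μ - ∫ x, g x ∂μ :=
  MeasureTheory.integral_sub (hf.integrable μ) (hg.integrable μ)

theorem integral_sum {κ : Type*} {s : Finset κ} {F : κ → α → ℝ} (h : ∀ k ∈ s, BddMeas (F k))
    {μ : Measure α} [IsFiniteMeasure μ] :
    ∫ x, ∑ k ∈ s, F k x ∂μ = ∑ k ∈ s, ∫ x, F k x ∂μ :=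
  integral_finsetSum s fun k hk => (h k hk).integrable μ

theorem integral_mono (hf : BddMeas f) (hg : BddMeas g) {μ : Measure α} [IsFiniteMeasure μ]
    (h : ∀ x, f x ≤ g x) : ∫ x, f x ∂μ ≤ ∫ x, g x ∂μ :=
  MeasureTheory.integral_mono (hf.integrable μ) (hg.integrable μ) h

end BddMeas

/-! ### Second moments and variances of bounded functions. -/

section SquareIneq

variable {α : Type*} [MeasurableSpace α] (μ : Measure α) [IsProbabilityMeasure μ] {f : α → ℝ}

theorem integral_sub_mean_sq (hf : BddMeas f) :
    ∫ x, (f x - ∫ y, f y ∂μ) ^ 2 ∂μ = ∫ x, f x ^ 2 ∂μ - (∫ x, f x ∂μ) ^ 2 := by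
  have h : ∀ x, (f x - ∫ y, f y ∂μ) ^ 2
      = f x ^ 2 - 2 * (∫ y, f y ∂μ) * f x + (∫ y, f y ∂μ) ^ 2 := fun x => by ring
  simp_rw [h]
  have i2 := hf.const_mul (2 * ∫ y, f y ∂μ)
  rw [((hf.pow 2).sub i2).integral_add (.const _), (hf.pow 2).integral_sub i2, integral_const_mul]
  simp
  ring

theorem sq_integral_le (hf : BddMeas f) : (∫ x, f x ∂μ) ^ 2 ≤ ∫ x, f x ^ 2 ∂μ := by
  have h := integral_sub_mean_sq μ hf
  have : 0 ≤ ∫ x, (f x - ∫ y, f y ∂μ) ^ 2 ∂μ := integral_nonneg fun x => sq_nonneg _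
  linarith

theorem integral_sub_mean_sq_le (hf : BddMeas f) :
    ∫ x, (f x - ∫ y, f y ∂μ) ^ 2 ∂μ ≤ ∫ x, f x ^ 2 ∂μ := by
  rw [integral_sub_mean_sq μ hf]
  linarith [sq_nonneg (∫ x, f x ∂μ)]

/-- Cauchy–Schwarz for the first absolute moment, in additive form. -/
theorem integral_abs_le_add_div (hf : BddMeas f) {η : ℝ} (hη : 0 < η) :
    ∫ x, |f x| ∂μ ≤ (η + (∫ x, f x ^ 2 ∂μ) / η) / 2 := by
  have h : ∀ x, |f x| ≤ (1 / 2) * η + (1 / (2 * η)) * f x ^ 2 := fun x => by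
    have h1 := sq_nonneg (|f x| - η)
    have h2 := sq_abs (f x)
    have : (1 / 2) * η + (1 / (2 * η)) * f x ^ 2 - |f x| = (1 / (2 * η)) * (|f x| - η) ^ 2 := by
      rw [sub_sq, h2]
      field_simp
      ring
    have h3 : 0 ≤ (1 / (2 * η)) * (|f x| - η) ^ 2 := by positivity
    linarith
  calc ∫ x, |f x| ∂μ ≤ ∫ x, ((1 / 2) * η + (1 / (2 * η)) * f x ^ 2) ∂μ :=
        integral_mono (hf.abs.integrable μ)
          (((BddMeas.const _).add ((hf.pow 2).const_mul _)).integrable μ) h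
    _ = _ := by
      rw [(BddMeas.const _).integral_add ((hf.pow 2).const_mul _), integral_const_mul (1 / (2 * η))]
      simp only [integral_const, probReal_univ, one_smul]
      field_simp

end SquareIneq

/-! ### Resampling one coordinate of an i.i.d. vector. -/

section Pi

variable {ι : Type*} [DecidableEq ι] {E : Type*} [MeasurableSpace E]

theorem measurable_update_pair (a : ι) :
    Measurable (fun q : (ι → E) × E => Function.update q.1 a q.2) := by
  refine measurable_pi_lambda _ fun b => ?_
  by_cases h : b = a
  · subst h; simpa using measurable_snd
  · simpa only [Function.update_of_ne h] using! (measurable_pi_apply b).comp measurable_fst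

variable {F : (ι → E) → ℝ}

theorem BddMeas.update (hF : BddMeas F) (a : ι) :
    BddMeas (Function.uncurry fun (z : ι → E) (x : E) => F (Function.update z a x)) :=
  hF.comp (measurable_update_pair a)

variable [Fintype ι] (μ : Measure E) [IsProbabilityMeasure μ]

/-- Resampling one coordinate preserves the law of an i.i.d. vector. -/
theorem measurePreserving_update (a : ι) :
    MeasurePreserving (fun q : (ι → E) × E => Function.update q.1 a q.2)
      ((Measure.pi fun _ : ι => μ).prod μ) (Measure.pi fun _ : ι => μ) := by
  refine ⟨measurable_update_pair a, ?_⟩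
  symm
  refine Measure.pi_eq fun s hs => ?_
  rw [Measure.map_apply (measurable_update_pair a) (MeasurableSet.univ_pi hs)]
  -- The overwritten coordinate of `z` is unconstrained, and its condition passes to `x`.
  have : (fun q : (ι → E) × E => Function.update q.1 a q.2) ⁻¹' (Set.univ.pi s)
      = (Set.univ.pi (Function.update s a Set.univ)) ×ˢ s a := by
    ext ⟨z, x⟩
    simp only [Set.mem_preimage, Set.mem_univ_pi, Set.mem_prod]
    constructor
    · intro h
      refine ⟨fun b => ?_, by simpa using h a⟩
      by_cases hb : b = a
      · subst hb; simp
      · simpa [Function.update_of_ne hb] using h b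
    · rintro ⟨h1, h2⟩ b
      by_cases hb : b = a
      · subst hb; simpa using h2
      · simpa [Function.update_of_ne hb] using h1 b
  rw [this, Measure.prod_prod, Measure.pi_pi, ← Finset.prod_erase_mul _ _ (Finset.mem_univ a),
    ← Finset.prod_erase_mul (a := a) _ _ (Finset.mem_univ a)]
  simp only [Function.update_self, measure_univ, mul_one]
  congr 1
  refine Finset.prod_congr rfl fun b hb => ?_
  rw [Function.update_of_ne (Finset.ne_of_mem_erase hb)]

/-- Plays the role of conditioning on all coordinates but `a`: the inner integral is the conditional
expectation, kept as a function on the whole product space so that the product never has to be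
split. -/
theorem integral_pi_update (hF : BddMeas F) (a : ι) :
    ∫ z, F z ∂(Measure.pi fun _ : ι => μ)
      = ∫ z, ∫ x, F (Function.update z a x) ∂μ ∂(Measure.pi fun _ : ι => μ) := by
  rw [← (measurePreserving_update μ a).map_eq, integral_map (measurable_update_pair a).aemeasurable
    (by exact hF.1.aestronglyMeasurable), (measurePreserving_update μ a).map_eq]
  exact integral_prod _ ((hF.update a).integrable _)

theorem integral_pi_update_swap (hF : BddMeas F) (a : ι) :
    ∫ z, F z ∂(Measure.pi fun _ : ι => μ)
      = ∫ x, ∫ z, F (Function.update z a x) ∂(Measure.pi fun _ : ι => μ) ∂μ := by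
  rw [integral_pi_update μ hF a]
  exact integral_integral_swap ((hF.update a).integrable _)

theorem integral_pi_eq_zero (hF : BddMeas F) (a : ι)
    (h : ∀ z, ∫ x, F (Function.update z a x) ∂μ = 0) :
    ∫ z, F z ∂(Measure.pi fun _ : ι => μ) = 0 := by
  rw [integral_pi_update μ hF a]
  simp [h]

theorem integral_pi_eval {f : E → ℝ} (hf : BddMeas f) (i : ι) :
    ∫ z, f (z i) ∂(Measure.pi fun _ : ι => μ) = ∫ x, f x ∂μ := by
  rw [integral_pi_update_swap μ (hf.comp (measurable_pi_apply i)) i]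
  simp

theorem integral_pi_eval_pair {f : E → E → ℝ} (hf : BddMeas (Function.uncurry f)) {i j : ι}
    (hij : i ≠ j) :
    ∫ z, f (z i) (z j) ∂(Measure.pi fun _ : ι => μ) = ∫ x, ∫ y, f x y ∂μ ∂μ := by
  rw [integral_pi_update_swap μ (hf.comp₂ (measurable_pi_apply i) (measurable_pi_apply j)) i]
  refine integral_congr_ae (ae_of_all _ fun x => ?_)
  simp only [Function.update_self, Function.update_of_ne hij.symm]
  exact integral_pi_eval μ (hf.curry x) j

end Pi

/-! ### Moments of independent sums and of degenerate quadratic forms. -/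

section Moments

variable {ι E : Type*}

theorem BddMeas.eval [MeasurableSpace E] {f : E → ℝ} (hf : BddMeas f) (i : ι) : BddMeas (fun z : ι → E => f (z i)) :=
  hf.comp (measurable_pi_apply i)

theorem BddMeas.eval₂ [MeasurableSpace E] {f : E → E → ℝ} (hf : BddMeas (Function.uncurry f)) (i j : ι) :
    BddMeas (fun z : ι → E => f (z i) (z j)) :=
  hf.comp₂ (measurable_pi_apply i) (measurable_pi_apply j)

theorem sum_update_of_notMem [DecidableEq ι] {s : Finset ι} {a : ι} (ha : a ∉ s) (v : ι → E → ℝ) (z : ι → E)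
    (x : E) : ∑ b ∈ s, v b (Function.update z a x b) = ∑ b ∈ s, v b (z b) :=
  Finset.sum_congr rfl fun b hb => by
    rw [Function.update_of_ne (by rintro rfl; exact ha hb)]

variable [DecidableEq ι] [Fintype ι] [MeasurableSpace E] (μ : Measure E) [IsProbabilityMeasure μ]

/-- The second moment of a sum of independent centred variables. -/
theorem integral_sum_sq {v : ι → E → ℝ} (hv : ∀ b, BddMeas (v b)) (h0 : ∀ b, ∫ x, v b x ∂μ = 0)
    (s : Finset ι) :
    ∫ z, (∑ b ∈ s, v b (z b)) ^ 2 ∂(Measure.pi fun _ : ι => μ) = ∑ b ∈ s, ∫ x, v b x ^ 2 ∂μ := by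
  induction s using Finset.induction_on with
  | empty => simp
  | insert a s ha ih =>
    have hs : BddMeas (fun z : ι → E => ∑ b ∈ s, v b (z b)) := .sum fun b _ => (hv b).eval b
    have ha' : BddMeas (fun z : ι → E => v a (z a)) := (hv a).eval a
    have key : ∫ z, 2 * (v a (z a) * ∑ b ∈ s, v b (z b)) ∂(Measure.pi fun _ : ι => μ) = 0 := by
      refine integral_pi_eq_zero μ ((ha'.mul hs).const_mul 2) a fun z => ?_
      simp_rw [sum_update_of_notMem ha, Function.update_self]
      rw [integral_const_mul, integral_mul_const, h0]
      simp
    have e : ∀ z : ι → E, (∑ b ∈ insert a s, v b (z b)) ^ 2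
        = v a (z a) ^ 2 + 2 * (v a (z a) * ∑ b ∈ s, v b (z b)) + (∑ b ∈ s, v b (z b)) ^ 2 :=
      fun z => by rw [Finset.sum_insert ha]; ring
    simp_rw [e]
    rw [((ha'.pow 2).add ((ha'.mul hs).const_mul 2)).integral_add (hs.pow 2),
      (ha'.pow 2).integral_add ((ha'.mul hs).const_mul 2), key, ih, Finset.sum_insert ha,
      integral_pi_eval μ ((hv a).pow 2) a, add_zero]

/-- The fourth moment of a sum of independent centred variables. -/
theorem integral_sum_pow_four_le {v : ι → E → ℝ} (hv : ∀ b, BddMeas (v b))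
    (h0 : ∀ b, ∫ x, v b x ∂μ = 0) (s : Finset ι) :
    ∫ z, (∑ b ∈ s, v b (z b)) ^ 4 ∂(Measure.pi fun _ : ι => μ)
      ≤ ∑ b ∈ s, ∫ x, v b x ^ 4 ∂μ + 3 * (∑ b ∈ s, ∫ x, v b x ^ 2 ∂μ) ^ 2 := by
  induction s using Finset.induction_on with
  | empty => simp
  | insert a s ha ih =>
    have hs : BddMeas (fun z : ι → E => ∑ b ∈ s, v b (z b)) := .sum fun b _ => (hv b).eval b
    have ha' : BddMeas (fun z : ι → E => v a (z a)) := (hv a).eval a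
    have k1 : ∫ z, 4 * (v a (z a) * (∑ b ∈ s, v b (z b)) ^ 3) ∂(Measure.pi fun _ : ι => μ)
        = 0 := by
      refine integral_pi_eq_zero μ ((ha'.mul (hs.pow 3)).const_mul 4) a fun z => ?_
      simp_rw [sum_update_of_notMem ha, Function.update_self]
      rw [integral_const_mul, integral_mul_const, h0]
      simp
    have k2 : ∫ z, 6 * (v a (z a) ^ 2 * (∑ b ∈ s, v b (z b)) ^ 2) ∂(Measure.pi fun _ : ι => μ)
        = 6 * ((∫ x, v a x ^ 2 ∂μ) * ∑ b ∈ s, ∫ x, v b x ^ 2 ∂μ) := by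
      rw [integral_pi_update μ (((ha'.pow 2).mul (hs.pow 2)).const_mul 6) a]
      simp_rw [sum_update_of_notMem ha, Function.update_self, integral_const_mul,
        integral_mul_const, integral_const_mul]
      rw [integral_sum_sq μ hv h0]
    -- Here the sum over `s` supplies the centring; the third moment of `v a` need not vanish.
    have k3 : ∫ z, 4 * (v a (z a) ^ 3 * (∑ b ∈ s, v b (z b))) ∂(Measure.pi fun _ : ι => μ)
        = 0 := by
      rw [integral_pi_update μ (((ha'.pow 3).mul hs).const_mul 4) a]
      simp_rw [sum_update_of_notMem ha, Function.update_self, integral_const_mul,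
        integral_mul_const, integral_const_mul]
      rw [BddMeas.integral_sum fun b _ => (hv b).eval b,
        Finset.sum_eq_zero fun b _ => by rw [integral_pi_eval μ (hv b) b, h0]]
      simp
    have e : ∀ z : ι → E, (∑ b ∈ insert a s, v b (z b)) ^ 4
        = ((((∑ b ∈ s, v b (z b)) ^ 4 + 4 * (v a (z a) * (∑ b ∈ s, v b (z b)) ^ 3))
          + 6 * (v a (z a) ^ 2 * (∑ b ∈ s, v b (z b)) ^ 2))
          + 4 * (v a (z a) ^ 3 * (∑ b ∈ s, v b (z b)))) + v a (z a) ^ 4 :=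
      fun z => by rw [Finset.sum_insert ha]; ring
    simp_rw [e]
    have b1 := (hs.pow 4).add ((ha'.mul (hs.pow 3)).const_mul 4)
    have b2 := b1.add (((ha'.pow 2).mul (hs.pow 2)).const_mul 6)
    have b3 := b2.add (((ha'.pow 3).mul hs).const_mul 4)
    rw [b3.integral_add (ha'.pow 4), b2.integral_add (((ha'.pow 3).mul hs).const_mul 4),
      b1.integral_add (((ha'.pow 2).mul (hs.pow 2)).const_mul 6),
      (hs.pow 4).integral_add ((ha'.mul (hs.pow 3)).const_mul 4), k1, k2, k3,
      Finset.sum_insert ha, Finset.sum_insert ha, integral_pi_eval μ ((hv a).pow 4) a]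
    have h1 : 0 ≤ ∫ x, v a x ^ 2 ∂μ := integral_nonneg fun x => sq_nonneg _
    -- The coefficient 6 of the mixed term is the cross term of `3 (x + y)²`; the unused `3 x²` is
    -- the slack.
    nlinarith [sq_nonneg (∫ x, v a x ^ 2 ∂μ)]

variable {h : E → E → ℝ} (hh : BddMeas (Function.uncurry h)) (hsymm : ∀ x y, h x y = h y x)
  (hdeg : ∀ x, ∫ y, h x y ∂μ = 0)

include hh hsymm hdeg

/-- The index `i` occurs in the first factor only, so integrating out that single coordinate already
gives zero; coincidences among `j`, `k`, `l` are harmless. -/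
theorem integral_degenerate_mul_eq_zero {i j k l : ι} (hij : i ≠ j) (hk : k ≠ i) (hl : l ≠ i) :
    ∫ z, h (z i) (z j) * h (z k) (z l) ∂(Measure.pi fun _ : ι => μ) = 0 := by
  refine integral_pi_eq_zero μ ((hh.eval₂ i j).mul (hh.eval₂ k l)) i fun z => ?_
  simp_rw [Function.update_self, Function.update_of_ne hk, Function.update_of_ne hl,
    Function.update_of_ne hij.symm, integral_mul_const]
  simp_rw [hsymm _ (z j), hdeg, zero_mul]

/-- Unless the two pairs coincide as sets, some index of the first is missing from the second. The
two orders of a coinciding pair produce the factor 2 in `integral_quadratic_sq`; the nested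
conditionals are shaped for collapsing sums over `k` and `l`. -/
theorem integral_degenerate_mul {i j k l : ι} (hij : i ≠ j) (hkl : k ≠ l) :
    ∫ z, h (z i) (z j) * h (z k) (z l) ∂(Measure.pi fun _ : ι => μ)
      = (if k = i then if l = j then ∫ x, ∫ y, h x y ^ 2 ∂μ ∂μ else 0 else 0)
        + if k = j then if l = i then ∫ x, ∫ y, h x y ^ 2 ∂μ ∂μ else 0 else 0 := by
  have hsq : BddMeas (Function.uncurry fun x y => h x y ^ 2) := hh.pow 2
  by_cases h1 : k = i ∧ l = j
  · obtain ⟨rfl, rfl⟩ := h1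
    simp_rw [← pow_two]
    rw [integral_pi_eval_pair μ hsq hij]
    simp [hij]
  by_cases h2 : k = j ∧ l = i
  · obtain ⟨rfl, rfl⟩ := h2
    have e : ∀ z : ι → E, h (z l) (z k) * h (z k) (z l) = h (z k) (z l) ^ 2 := fun z => by
      rw [hsymm (z l) (z k), pow_two]
    simp_rw [e]
    rw [integral_pi_eval_pair μ hsq hkl]
    simp [hkl]
  have e : (if k = i then if l = j then ∫ x, ∫ y, h x y ^ 2 ∂μ ∂μ else 0 else 0)
        + (if k = j then if l = i then ∫ x, ∫ y, h x y ^ 2 ∂μ ∂μ else 0 else 0) = 0 := by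
    split_ifs <;> simp_all
  rw [e]
  by_cases h3 : k ≠ i ∧ l ≠ i
  · exact integral_degenerate_mul_eq_zero μ hh hsymm hdeg hij h3.1 h3.2
  -- Now `i` is one of `k`, `l`, and the excluded coincidences make `j` the index missing from the
  -- second pair.
  · have h4 : k ≠ j ∧ l ≠ j := by
      by_contra h5
      grind
    have e : ∀ z : ι → E, h (z i) (z j) = h (z j) (z i) := fun z => hsymm _ _
    simp_rw [e]
    exact integral_degenerate_mul_eq_zero μ hh hsymm hdeg (Ne.symm hij) h4.1 h4.2

/-- The second moment of a quadratic form in a degenerate kernel. -/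
theorem integral_quadratic_sq {β : ι → ι → ℝ} (hβ : ∀ i j, β i j = β j i) (hβ0 : ∀ i, β i i = 0) :
    ∫ z, (∑ i, ∑ j, β i j * h (z i) (z j)) ^ 2 ∂(Measure.pi fun _ : ι => μ)
      = 2 * (∑ i, ∑ j, β i j ^ 2) * ∫ x, ∫ y, h x y ^ 2 ∂μ ∂μ := by
  have e : ∀ z : ι → E, (∑ i, ∑ j, β i j * h (z i) (z j)) ^ 2
      = ∑ i, ∑ j, ∑ k, ∑ l, β i j * β k l * (h (z i) (z j) * h (z k) (z l)) := by
    intro z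
    rw [pow_two, Finset.sum_mul]
    refine Finset.sum_congr rfl fun i _ => ?_
    rw [Finset.sum_mul]
    refine Finset.sum_congr rfl fun j _ => ?_
    rw [Finset.mul_sum]
    refine Finset.sum_congr rfl fun k _ => ?_
    rw [Finset.mul_sum]
    refine Finset.sum_congr rfl fun l _ => ?_
    ring
  have hb : ∀ i j k l : ι, BddMeas fun z : ι → E =>
      β i j * β k l * (h (z i) (z j) * h (z k) (z l)) := fun i j k l =>
    ((hh.eval₂ i j).mul (hh.eval₂ k l)).const_mul _
  simp_rw [e]
  rw [BddMeas.integral_sum fun i _ => .sum fun j _ => .sum fun k _ => .sum fun l _ => hb i j k l,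
    Finset.mul_sum, Finset.sum_mul]
  refine Finset.sum_congr rfl fun i _ => ?_
  rw [BddMeas.integral_sum fun j _ => .sum fun k _ => .sum fun l _ => hb i j k l,
    Finset.mul_sum, Finset.sum_mul]
  refine Finset.sum_congr rfl fun j _ => ?_
  rw [BddMeas.integral_sum fun k _ => .sum fun l _ => hb i j k l]
  by_cases hij : i = j
  · subst hij
    simp [hβ0]
  have step : ∀ k l, ∫ z, β i j * β k l * (h (z i) (z j) * h (z k) (z l))
        ∂(Measure.pi fun _ : ι => μ)
      = (if k = i then if l = j then β i j ^ 2 * ∫ x, ∫ y, h x y ^ 2 ∂μ ∂μ else 0 else 0)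
        + if k = j then if l = i then β i j ^ 2 * ∫ x, ∫ y, h x y ^ 2 ∂μ ∂μ else 0 else 0 := by
    intro k l
    rw [integral_const_mul]
    by_cases hkl : k = l
    · subst hkl
      simp only [hβ0, mul_zero, zero_mul]
      split_ifs <;> simp_all
    · rw [integral_degenerate_mul μ hh hsymm hdeg hij hkl]
      split_ifs <;> subst_vars <;> first | ring1 | (rw [hβ]; ring1)
  have : ∀ k, ∫ z, ∑ l, β i j * β k l * (h (z i) (z j) * h (z k) (z l))
        ∂(Measure.pi fun _ : ι => μ)
      = (if k = i then β i j ^ 2 * ∫ x, ∫ y, h x y ^ 2 ∂μ ∂μ else 0)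
        + if k = j then β i j ^ 2 * ∫ x, ∫ y, h x y ^ 2 ∂μ ∂μ else 0 := by
    intro k
    rw [BddMeas.integral_sum fun l _ => hb i j k l]
    simp_rw [step, Finset.sum_add_distrib]
    congr 1 <;> split_ifs <;> simp
  simp_rw [this, Finset.sum_add_distrib]
  simp
  ring

end Moments

/-! ### Stein's method with leave-one-out increments. -/

section Stein

variable {ι E : Type*} [DecidableEq ι] [MeasurableSpace E] (μ : Measure E)
  [IsProbabilityMeasure μ]

/-- The conditional second moment of `D` given all coordinates but `a`. -/
noncomputable def condSq (D : (ι → E) → ℝ) (a : ι) (z : ι → E) : ℝ :=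
  ∫ x, D (Function.update z a x) ^ 2 ∂μ

theorem BddMeas.condSq {D : (ι → E) → ℝ} (hD : BddMeas D) (a : ι) :
    BddMeas (condSq μ D a) :=
  ((hD.pow 2).update a).integral_right μ

variable [Fintype ι]

/-- Conditional Jensen inequality for the square. -/
theorem integral_condSq_sq_le {D : (ι → E) → ℝ} (hD : BddMeas D) (a : ι) :
    ∫ z, condSq μ D a z ^ 2 ∂(Measure.pi fun _ : ι => μ)
      ≤ ∫ z, D z ^ 4 ∂(Measure.pi fun _ : ι => μ) := by
  rw [integral_pi_update μ (hD.pow 4) a]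
  refine ((hD.condSq μ a).pow 2).integral_mono (((hD.pow 4).update a).integral_right μ) fun z => ?_
  refine (sq_integral_le μ (((hD.pow 2).update a).curry z)).trans (le_of_eq ?_)
  exact integral_congr_ae (ae_of_all _ fun x => by dsimp only; ring)

/-- Comparison of `E[D f(S)]` with `E[D² f'(S)]` when `S - D` does not depend on the coordinate `a`
and `D` is centred conditionally on the other coordinates. -/
theorem abs_integral_mul_comp_sub_le {S D : (ι → E) → ℝ} (hS : BddMeas S) (hD : BddMeas D) (a : ι)
    (hind : ∀ z x, S (Function.update z a x) - D (Function.update z a x) = S z - D z)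
    (hcen : ∀ z, ∫ x, D (Function.update z a x) ∂μ = 0)
    {f f' : ℝ → ℝ} (hf : Continuous f) (hf' : Continuous f') {K : ℝ}
    (h1 : ∀ u v, |f (u + v) - f u - v * f' u| ≤ K / 2 * v ^ 2)
    (h2 : ∀ u v, |f' (u + v) - f' u| ≤ K * |v|) {η : ℝ} (hη : 0 < η) :
    |∫ z, D z * f (S z) ∂(Measure.pi fun _ : ι => μ)
        - ∫ z, condSq μ D a z * f' (S z) ∂(Measure.pi fun _ : ι => μ)|
      ≤ K * (η * ∫ z, D z ^ 2 ∂(Measure.pi fun _ : ι => μ)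
        + (∫ z, D z ^ 4 ∂(Measure.pi fun _ : ι => μ)) / η) := by
  set π := Measure.pi fun _ : ι => μ with hπ
  have hR : BddMeas fun z => S z - D z := hS.sub hD
  have hV := hD.condSq μ a
  have hK : 0 ≤ K := by
    have := (abs_nonneg _).trans (h2 0 1)
    simpa using this
  -- `S - D` is free of the coordinate `a`, over which `D` has mean zero.
  have e1 : ∫ z, D z * f (S z - D z) ∂π = 0 := by
    refine integral_pi_eq_zero μ (hD.mul (hR.continuous_comp hf)) a fun z => ?_
    simp_rw [hind]
    rw [integral_mul_const, hcen, zero_mul]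
  -- For the same reason `D ^ 2` may be replaced by its conditional expectation.
  have e2 : ∫ z, D z ^ 2 * f' (S z - D z) ∂π = ∫ z, condSq μ D a z * f' (S z - D z) ∂π := by
    rw [hπ, integral_pi_update μ ((hD.pow 2).mul (hR.continuous_comp hf')) a]
    simp_rw [hind, integral_mul_const]
    rfl
  have b1 := hD.mul (hS.continuous_comp hf)
  have b2 := hD.mul (hR.continuous_comp hf)
  have b3 := (hD.pow 2).mul (hR.continuous_comp hf')
  have b4 := hV.mul (hR.continuous_comp hf')
  have b5 := hV.mul (hS.continuous_comp hf')
  have e3 : ∫ z, D z * f (S z) ∂π - ∫ z, condSq μ D a z * f' (S z) ∂π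
      = ∫ z, (D z * f (S z) - D z * f (S z - D z) - D z ^ 2 * f' (S z - D z)
        + (condSq μ D a z * f' (S z - D z) - condSq μ D a z * f' (S z))) ∂π := by
    rw [((b1.sub b2).sub b3).integral_add (b4.sub b5), (b1.sub b2).integral_sub b3,
      b1.integral_sub b2, b4.integral_sub b5, e1, e2]
    ring
  -- The last summand on the right has nonpositive integral by `integral_condSq_sq_le`; including it
  -- makes the difference of the two sides of the final pointwise estimate a weighted sum of
  -- squares.
  have pt : ∀ z, |D z * f (S z) - D z * f (S z - D z) - D z ^ 2 * f' (S z - D z)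
        + (condSq μ D a z * f' (S z - D z) - condSq μ D a z * f' (S z))|
      ≤ K * ((η * D z ^ 2 + D z ^ 4 / η) + (condSq μ D a z ^ 2 - D z ^ 4) / (2 * η)) := by
    intro z
    set V := condSq μ D a z
    have hV0 : 0 ≤ V := integral_nonneg fun x => sq_nonneg _
    have t1 := h1 (S z - D z) (D z)
    have t2 := h2 (S z - D z) (D z)
    rw [sub_add_cancel] at t1 t2
    have s1 : |D z * (f (S z) - f (S z - D z) - D z * f' (S z - D z))|
        ≤ |D z| * (K / 2 * |D z| ^ 2) := by
      rw [abs_mul, sq_abs]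
      exact mul_le_mul_of_nonneg_left t1 (abs_nonneg _)
    have s2 : |V * (f' (S z) - f' (S z - D z))| ≤ V * (K * |D z|) := by
      rw [abs_mul, abs_of_nonneg hV0]
      exact mul_le_mul_of_nonneg_left t2 hV0
    have s3 : |D z * f (S z) - D z * f (S z - D z) - D z ^ 2 * f' (S z - D z)
        + (V * f' (S z - D z) - V * f' (S z))|
        ≤ |D z| * (K / 2 * |D z| ^ 2) + V * (K * |D z|) := by
      have : D z * f (S z) - D z * f (S z - D z) - D z ^ 2 * f' (S z - D z)
        + (V * f' (S z - D z) - V * f' (S z))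
        = D z * (f (S z) - f (S z - D z) - D z * f' (S z - D z))
          - V * (f' (S z) - f' (S z - D z)) := by ring
      rw [this]
      exact (abs_sub _ _).trans (add_le_add s1 s2)
    refine s3.trans ?_
    have p2 : D z ^ 2 = |D z| ^ 2 := (sq_abs _).symm
    have p4 : D z ^ 4 = |D z| ^ 4 := by rw [← abs_pow, abs_of_nonneg (by positivity)]
    rw [p2, p4]
    set w := |D z|
    have hw : 0 ≤ w := abs_nonneg _
    have q : K * ((η * w ^ 2 + w ^ 4 / η) + (V ^ 2 - w ^ 4) / (2 * η))
        - (w * (K / 2 * w ^ 2) + V * (K * w))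
        = K / (2 * η) * ((w ^ 2 - η * w / 2) ^ 2 + (V - η * w) ^ 2 + 3 / 4 * η ^ 2 * w ^ 2) := by
      field_simp
      ring
    have : 0 ≤ K / (2 * η) * ((w ^ 2 - η * w / 2) ^ 2 + (V - η * w) ^ 2 + 3 / 4 * η ^ 2 * w ^ 2) := by
      positivity
    linarith
  rw [e3]
  have c1 := (hD.pow 2).const_mul η
  have c2 : BddMeas fun z => D z ^ 4 / η := by
    simpa only [div_eq_inv_mul] using (hD.pow 4).const_mul η⁻¹
  have c3 : BddMeas fun z => (condSq μ D a z ^ 2 - D z ^ 4) / (2 * η) := by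
    simpa only [div_eq_inv_mul] using ((hV.pow 2).sub (hD.pow 4)).const_mul (2 * η)⁻¹
  refine (abs_integral_le_integral_abs).trans ?_
  refine (((((b1.sub b2).sub b3).add (b4.sub b5)).abs).integral_mono
    (((c1.add c2).add c3).const_mul K) pt).trans ?_
  rw [integral_const_mul, (c1.add c2).integral_add c3, c1.integral_add c2, integral_const_mul,
    integral_div, integral_div, (hV.pow 2).integral_sub (hD.pow 4)]
  refine mul_le_mul_of_nonneg_left ?_ hK
  have := integral_condSq_sq_le μ hD a
  have : (∫ z, condSq μ D a z ^ 2 ∂π - ∫ z, D z ^ 4 ∂π) / (2 * η) ≤ 0 :=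
    div_nonpos_of_nonpos_of_nonneg (by linarith) (by positivity)
  linarith

/-- Stein-type bound for a statistic `S` with leave-one-out increments `D a`. -/
theorem abs_integral_mul_comp_sub_integral_deriv_le {S : (ι → E) → ℝ} {D : ι → (ι → E) → ℝ}
    (hS : BddMeas S) (hD : ∀ a, BddMeas (D a)) (hsum : ∀ z, ∑ a, D a z = 2 * S z)
    (hind : ∀ a z x, S (Function.update z a x) - D a (Function.update z a x) = S z - D a z)
    (hcen : ∀ a z, ∫ x, D a (Function.update z a x) ∂μ = 0)
    {f f' : ℝ → ℝ} (hf : Continuous f) (hf' : Continuous f') {K L : ℝ}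
    (h1 : ∀ u v, |f (u + v) - f u - v * f' u| ≤ K / 2 * v ^ 2)
    (h2 : ∀ u v, |f' (u + v) - f' u| ≤ K * |v|) (h3 : ∀ u, |f' u| ≤ L) {η : ℝ} (hη : 0 < η) :
    |∫ z, S z * f (S z) ∂(Measure.pi fun _ : ι => μ)
        - ∫ z, f' (S z) ∂(Measure.pi fun _ : ι => μ)|
      ≤ L * ∫ z, |(1 / 2) * ∑ a, condSq μ (D a) a z - 1| ∂(Measure.pi fun _ : ι => μ)
        + K * (η * ∑ a, ∫ z, D a z ^ 2 ∂(Measure.pi fun _ : ι => μ)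
        + (∑ a, ∫ z, D a z ^ 4 ∂(Measure.pi fun _ : ι => μ)) / η) / 2 := by
  set π := Measure.pi fun _ : ι => μ with hπ
  have hV := fun a => (hD a).condSq μ a
  have bf := hS.continuous_comp hf
  have bf' := hS.continuous_comp hf'
  have e1 : ∫ z, S z * f (S z) ∂π = (1 / 2) * ∑ a, ∫ z, D a z * f (S z) ∂π := by
    rw [← BddMeas.integral_sum fun a _ => (hD a).mul bf, ← integral_const_mul]
    refine integral_congr_ae (ae_of_all _ fun z => ?_)
    dsimp only
    rw [← Finset.sum_mul, hsum]
    ring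
  have hW : BddMeas fun z => (1 / 2) * ∑ a, condSq μ (D a) a z - 1 :=
    ((BddMeas.sum fun a _ => hV a).const_mul _).sub (.const 1)
  have e2 : ∫ z, f' (S z) ∂π = (1 / 2) * ∑ a, ∫ z, condSq μ (D a) a z * f' (S z) ∂π
      - ∫ z, ((1 / 2) * ∑ a, condSq μ (D a) a z - 1) * f' (S z) ∂π := by
    rw [← BddMeas.integral_sum fun a _ => (hV a).mul bf', ← integral_const_mul,
      ← ((BddMeas.sum fun a _ => (hV a).mul bf').const_mul _).integral_sub (hW.mul bf')]
    refine integral_congr_ae (ae_of_all _ fun z => ?_)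
    dsimp only
    rw [← Finset.sum_mul]
    ring
  have e3 : ∫ z, S z * f (S z) ∂π - ∫ z, f' (S z) ∂π
      = (1 / 2) * ∑ a, (∫ z, D a z * f (S z) ∂π - ∫ z, condSq μ (D a) a z * f' (S z) ∂π)
        + ∫ z, ((1 / 2) * ∑ a, condSq μ (D a) a z - 1) * f' (S z) ∂π := by
    rw [e1, e2, Finset.sum_sub_distrib]
    ring
  have b1 : |∫ z, ((1 / 2) * ∑ a, condSq μ (D a) a z - 1) * f' (S z) ∂π|
      ≤ L * ∫ z, |(1 / 2) * ∑ a, condSq μ (D a) a z - 1| ∂π := by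
    refine abs_integral_le_integral_abs.trans ?_
    rw [← integral_const_mul]
    refine (hW.mul bf').abs.integral_mono (hW.abs.const_mul L) fun z => ?_
    rw [abs_mul, mul_comm]
    exact mul_le_mul_of_nonneg_right (h3 _) (abs_nonneg _)
  have b2 : |∑ a, (∫ z, D a z * f (S z) ∂π - ∫ z, condSq μ (D a) a z * f' (S z) ∂π)|
      ≤ K * (η * ∑ a, ∫ z, D a z ^ 2 ∂π + (∑ a, ∫ z, D a z ^ 4 ∂π) / η) := by
    refine (Finset.abs_sum_le_sum_abs _ _).trans ?_
    rw [Finset.mul_sum, Finset.sum_div, ← Finset.sum_add_distrib, Finset.mul_sum]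
    exact Finset.sum_le_sum fun a _ => abs_integral_mul_comp_sub_le μ hS (hD a) a (hind a) (hcen a)
      hf hf' h1 h2 hη
  rw [e3]
  refine (abs_add_le _ _).trans ?_
  rw [abs_mul, abs_of_pos (by norm_num : (0 : ℝ) < 1 / 2)]
  linarith

end Stein

/-! ### From approximate Stein identities to characteristic functions. -/

/-- Second order Taylor bound from a Lipschitz derivative. -/
theorem abs_taylor_le {f f' : ℝ → ℝ} (hf : ∀ u, HasDerivAt f (f' u) u) {K : ℝ}
    (h2 : ∀ u v, |f' (u + v) - f' u| ≤ K * |v|) (u v : ℝ) :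
    |f (u + v) - f u - v * f' u| ≤ K * v ^ 2 := by
  have hK : 0 ≤ K := by
    have := (abs_nonneg _).trans (h2 0 1)
    simpa using this
  have hg : ∀ w ∈ Set.uIcc u (u + v), HasDerivWithinAt (fun w => f w - w * f' u) (f' w - f' u)
      (Set.uIcc u (u + v)) w := fun w _ => by
    simpa using! ((hf w).sub ((hasDerivAt_id w).mul_const (f' u))).hasDerivWithinAt
  have hb : ∀ w ∈ Set.uIcc u (u + v), ‖f' w - f' u‖ ≤ K * |v| := fun w hw => by
    have h := h2 u (w - u)
    rw [add_sub_cancel] at h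
    refine h.trans (mul_le_mul_of_nonneg_left ?_ hK)
    have := Set.abs_sub_left_of_mem_uIcc hw
    simpa using this
  have := (convex_uIcc u (u + v)).norm_image_sub_le_of_norm_hasDerivWithin_le hg hb
    Set.left_mem_uIcc Set.right_mem_uIcc
  simp only [Real.norm_eq_abs, add_sub_cancel_left] at this
  have e : f (u + v) - (u + v) * f' u - (f u - u * f' u) = f (u + v) - f u - v * f' u := by ring
  rw [e, mul_assoc, abs_mul_abs_self] at this
  rwa [pow_two]

/-- A perturbed solution of `y' = -t y` is close to a multiple of `exp (-t²/2)`. -/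
theorem abs_sub_exp_le {y y' : ℝ → ℝ} (hy : ∀ t, HasDerivAt y (y' t) t) {a b : ℝ} (ha : 0 ≤ a)
    (hb : 0 ≤ b) (h : ∀ t, |y' t + t * y t| ≤ |t| * a + t ^ 2 * b) (t : ℝ) :
    |y t - y 0 * Real.exp (-t ^ 2 / 2)| ≤ |t| * (|t| * a + t ^ 2 * b) := by
  -- The integrating factor `exp (s²/2)` turns the perturbed equation into a bound for a derivative.
  -- On the segment between `0` and `t` the factor is largest at `t`, where it is divided out at the
  -- end.
  have hg : ∀ s ∈ Set.uIcc 0 t, HasDerivWithinAt (fun s => y s * Real.exp (s ^ 2 / 2))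
      ((y' s + s * y s) * Real.exp (s ^ 2 / 2)) (Set.uIcc 0 t) s := fun s _ => by
    have h1 : HasDerivAt (fun s : ℝ => s ^ 2 / 2) s s := by
      have := ((hasDerivAt_id s).pow 2).div_const 2
      simpa using this
    have := ((hy s).mul h1.exp).hasDerivWithinAt (s := Set.uIcc 0 t)
    refine this.congr_deriv ?_
    ring
  have hbd : ∀ s ∈ Set.uIcc 0 t, ‖(y' s + s * y s) * Real.exp (s ^ 2 / 2)‖
      ≤ (|t| * a + t ^ 2 * b) * Real.exp (t ^ 2 / 2) := fun s hs => by
    have hst : |s| ≤ |t| := by simpa using Set.abs_sub_left_of_mem_uIcc hs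
    have hst2 : s ^ 2 ≤ t ^ 2 := sq_le_sq.2 hst
    rw [norm_mul, Real.norm_eq_abs, Real.norm_eq_abs, Real.abs_exp]
    refine mul_le_mul ((h s).trans ?_) (Real.exp_le_exp.2 (by linarith)) (Real.exp_nonneg _)
      (by positivity)
    gcongr
  have := (convex_uIcc 0 t).norm_image_sub_le_of_norm_hasDerivWithin_le hg hbd
    Set.left_mem_uIcc Set.right_mem_uIcc
  simp only [Real.norm_eq_abs, sub_zero] at this
  have e : y t - y 0 * Real.exp (-t ^ 2 / 2)
      = (y t * Real.exp (t ^ 2 / 2) - y 0 * Real.exp (0 ^ 2 / 2)) * Real.exp (-t ^ 2 / 2) := by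
    have : Real.exp (t ^ 2 / 2) * Real.exp (-t ^ 2 / 2) = 1 := by
      rw [← Real.exp_add]
      simp [neg_div]
    rw [sub_mul, mul_assoc, this]
    simp
  rw [e, abs_mul, Real.abs_exp]
  have e2 : Real.exp (t ^ 2 / 2) * Real.exp (-t ^ 2 / 2) = 1 := by
    rw [← Real.exp_add]
    simp [neg_div]
  calc _ ≤ (|t| * a + t ^ 2 * b) * Real.exp (t ^ 2 / 2) * |t| * Real.exp (-t ^ 2 / 2) :=
        mul_le_mul_of_nonneg_right this (Real.exp_nonneg _)
    _ = |t| * (|t| * a + t ^ 2 * b) * (Real.exp (t ^ 2 / 2) * Real.exp (-t ^ 2 / 2)) := by ring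
    _ = _ := by rw [e2, mul_one]

section CharFun

variable {α : Type*} [MeasurableSpace α] (π : Measure α) [IsProbabilityMeasure π] {S : α → ℝ}

theorem hasDerivAt_integral_comp_mul (hS : BddMeas S) {f f' : ℝ → ℝ}
    (hf : ∀ u, HasDerivAt f (f' u) u) (hc : Continuous f') (hb : ∀ u, |f' u| ≤ 1) (t : ℝ) :
    HasDerivAt (fun t => ∫ z, f (t * S z) ∂π) (∫ z, S z * f' (t * S z) ∂π) t := by
  have hfc : Continuous f := continuous_iff_continuousAt.2 fun u => (hf u).continuousAt
  have hB : ∀ t, BddMeas fun z => f (t * S z) := fun t => (hS.const_mul t).continuous_comp hfc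
  have hB' : ∀ t, BddMeas fun z => S z * f' (t * S z) := fun t =>
    hS.mul ((hS.const_mul t).continuous_comp hc)
  refine (hasDerivAt_integral_of_dominated_loc_of_deriv_le (μ := π)
    (bound := fun z => |S z|) (s := Set.univ) (F := fun t z => f (t * S z))
    (F' := fun t z => S z * f' (t * S z)) Filter.univ_mem
    (Eventually.of_forall fun s => (hB s).1.aestronglyMeasurable) ((hB t).integrable π)
    (hB' t).1.aestronglyMeasurable (ae_of_all _ fun z s _ => ?_) (hS.abs.integrable π)
    (ae_of_all _ fun z s _ => ?_)).2
  · rw [norm_mul, Real.norm_eq_abs, Real.norm_eq_abs]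
    exact mul_le_of_le_one_right (abs_nonneg _) (hb _)
  · have := (hf (s * S z)).comp s ((hasDerivAt_id s).mul_const (S z))
    simpa [mul_comm] using! this

/-- An approximate Stein identity for trigonometric test functions controls the characteristic
function. -/
theorem norm_integral_cexp_sub_le (hS : BddMeas S) {a b : ℝ} (ha : 0 ≤ a) (hb : 0 ≤ b)
    (hsin : ∀ t, |∫ z, S z * Real.sin (t * S z) ∂π - t * ∫ z, Real.cos (t * S z) ∂π|
      ≤ |t| * a + t ^ 2 * b)
    (hcos : ∀ t, |∫ z, S z * Real.cos (t * S z) ∂π + t * ∫ z, Real.sin (t * S z) ∂π|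
      ≤ |t| * a + t ^ 2 * b) (t : ℝ) :
    ‖∫ z, Complex.exp (t * S z * Complex.I) ∂π - Complex.exp (-(t : ℂ) ^ 2 / 2)‖
      ≤ 2 * (|t| * (|t| * a + t ^ 2 * b)) := by
  -- The means of cosine and sine both solve `y' = -t y` up to the error, with initial values 1 and
  -- 0. The sine test function yields the equation for the cosine mean, and conversely.
  have hC := abs_sub_exp_le (y := fun t => ∫ z, Real.cos (t * S z) ∂π)
    (y' := fun t => ∫ z, S z * -Real.sin (t * S z) ∂π)
    (hasDerivAt_integral_comp_mul π hS Real.hasDerivAt_cos (by fun_prop)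
      fun u => by rw [abs_neg]; exact Real.abs_sin_le_one u) ha hb
    (fun t => by
      have := hsin t
      rw [← abs_neg] at this
      convert! this using 2
      simp only [mul_neg, integral_neg]
      ring) t
  have hD := abs_sub_exp_le (y := fun t => ∫ z, Real.sin (t * S z) ∂π)
    (y' := fun t => ∫ z, S z * Real.cos (t * S z) ∂π)
    (hasDerivAt_integral_comp_mul π hS Real.hasDerivAt_sin (by fun_prop)
      fun u => Real.abs_cos_le_one u) ha hb hcos t
  simp only [zero_mul, Real.cos_zero, Real.sin_zero, integral_const, probReal_univ, smul_eq_mul,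
    one_mul, sub_zero] at hC hD
  have i1 := ((hS.const_mul t).continuous_comp Real.continuous_cos).integrable π
  have i2 := ((hS.const_mul t).continuous_comp Real.continuous_sin).integrable π
  have e : ∫ z, Complex.exp (t * S z * Complex.I) ∂π
      = ((∫ z, Real.cos (t * S z) ∂π : ℝ) : ℂ) + ((∫ z, Real.sin (t * S z) ∂π : ℝ) : ℂ)
        * Complex.I := by
    rw [← integral_complex_ofReal, ← integral_complex_ofReal, ← integral_mul_const,
      ← integral_add i1.ofReal (i2.ofReal.mul_const _)]
    refine integral_congr_ae (ae_of_all _ fun z => ?_)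
    simp only [Complex.exp_mul_I, Complex.ofReal_cos, Complex.ofReal_sin, Complex.ofReal_mul]
  have e2 : Complex.exp (-(t : ℂ) ^ 2 / 2) = ((Real.exp (-t ^ 2 / 2) : ℝ) : ℂ) := by
    push_cast
    rfl
  rw [e, e2, add_sub_right_comm, ← Complex.ofReal_sub]
  refine (norm_add_le _ _).trans ?_
  rw [norm_mul, Complex.norm_I, mul_one, Complex.norm_real, Complex.norm_real]
  simp only [Real.norm_eq_abs]
  linarith

end CharFun

section SteinCharFun

variable {ι E : Type*} [DecidableEq ι] [Fintype ι] [MeasurableSpace E] (μ : Measure E)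
  [IsProbabilityMeasure μ]

/-- Testing only with `sin (t ·)` and `cos (t ·)` gives a differential equation in `t`, so Stein's
equation never has to be solved. The parameter `η` is left free and is chosen in the limit to
balance the two error terms. -/
theorem norm_charFun_sub_le_of_increments {S : (ι → E) → ℝ} {D : ι → (ι → E) → ℝ}
    (hS : BddMeas S) (hD : ∀ a, BddMeas (D a)) (hsum : ∀ z, ∑ a, D a z = 2 * S z)
    (hind : ∀ a z x, S (Function.update z a x) - D a (Function.update z a x) = S z - D a z)
    (hcen : ∀ a z, ∫ x, D a (Function.update z a x) ∂μ = 0) {η : ℝ} (hη : 0 < η) (t : ℝ) :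
    ‖∫ z, Complex.exp (t * S z * Complex.I) ∂(Measure.pi fun _ : ι => μ)
        - Complex.exp (-(t : ℂ) ^ 2 / 2)‖
      ≤ 2 * (|t| * (|t| * ∫ z, |(1 / 2) * ∑ a, condSq μ (D a) a z - 1|
            ∂(Measure.pi fun _ : ι => μ)
          + t ^ 2 * (η * ∑ a, ∫ z, D a z ^ 2 ∂(Measure.pi fun _ : ι => μ)
            + (∑ a, ∫ z, D a z ^ 4 ∂(Measure.pi fun _ : ι => μ)) / η))) := by
  have hcosd : ∀ t u : ℝ, HasDerivAt (fun u => Real.cos (t * u)) (-(t * Real.sin (t * u))) u :=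
    fun t u => by
      have := ((hasDerivAt_id u).const_mul t).cos
      simpa [mul_comm] using this
  have hsind : ∀ t u : ℝ, HasDerivAt (fun u => Real.sin (t * u)) (t * Real.cos (t * u)) u :=
    fun t u => by
      have := ((hasDerivAt_id u).const_mul t).sin
      simpa [mul_comm] using this
  have lc : ∀ x y : ℝ, |Real.cos x - Real.cos y| ≤ |x - y| := fun x y => by
    simpa [Real.dist_eq] using Real.lipschitzWith_cos.dist_le_mul x y
  have ls : ∀ x y : ℝ, |Real.sin x - Real.sin y| ≤ |x - y| := fun x y => by
    simpa [Real.dist_eq] using Real.lipschitzWith_sin.dist_le_mul x y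
  have l1 : ∀ t u v : ℝ, |t * Real.cos (t * (u + v)) - t * Real.cos (t * u)| ≤ t ^ 2 * |v| :=
    fun t u v => by
      rw [← mul_sub, abs_mul, ← sq_abs, pow_two, mul_assoc]
      refine mul_le_mul_of_nonneg_left ((lc _ _).trans (le_of_eq ?_)) (abs_nonneg _)
      rw [← abs_mul]
      congr 1
      ring
  have l2 : ∀ t u v : ℝ, |-(t * Real.sin (t * (u + v))) - -(t * Real.sin (t * u))|
      ≤ t ^ 2 * |v| :=
    fun t u v => by
      rw [neg_sub_neg, ← mul_sub, abs_mul, ← sq_abs, pow_two, mul_assoc]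
      refine mul_le_mul_of_nonneg_left ((ls _ _).trans (le_of_eq ?_)) (abs_nonneg _)
      rw [← abs_mul, abs_sub_comm]
      congr 1
      ring
  -- The constant `K` is taken as `2 t²`, twice the Lipschitz constant, because `abs_taylor_le` has
  -- `t² v²` where the Stein bound asks for `K / 2 * v²`.
  have w : ∀ t v : ℝ, t ^ 2 * |v| ≤ 2 * t ^ 2 * |v| := fun t v => by
    nlinarith [mul_nonneg (sq_nonneg t) (abs_nonneg v)]
  refine norm_integral_cexp_sub_le _ hS (integral_nonneg fun _ => abs_nonneg _) ?_
    (fun t => ?_) (fun t => ?_) t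
  · have h1 : 0 ≤ ∑ a, ∫ z, D a z ^ 2 ∂(Measure.pi fun _ : ι => μ) :=
      Finset.sum_nonneg fun a _ => integral_nonneg fun z => sq_nonneg _
    have h2 : 0 ≤ ∑ a, ∫ z, D a z ^ 4 ∂(Measure.pi fun _ : ι => μ) :=
      Finset.sum_nonneg fun a _ => integral_nonneg fun z => by positivity
    positivity
  · have := abs_integral_mul_comp_sub_integral_deriv_le μ hS hD hsum hind hcen
      (f := fun u => Real.sin (t * u)) (f' := fun u => t * Real.cos (t * u)) (by fun_prop)
      (by fun_prop) (K := 2 * t ^ 2) (L := |t|)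
      (fun u v => (abs_taylor_le (hsind t) (l1 t) u v).trans (by linarith))
      (fun u v => (l1 t u v).trans (w t v))
      (fun u => by
        rw [abs_mul]; exact mul_le_of_le_one_right (abs_nonneg _) (Real.abs_cos_le_one _)) hη
    rw [integral_const_mul] at this
    refine this.trans (le_of_eq ?_)
    ring
  · have := abs_integral_mul_comp_sub_integral_deriv_le μ hS hD hsum hind hcen
      (f := fun u => Real.cos (t * u)) (f' := fun u => -(t * Real.sin (t * u))) (by fun_prop)
      (by fun_prop) (K := 2 * t ^ 2) (L := |t|)
      (fun u v => (abs_taylor_le (hcosd t) (l2 t) u v).trans (by linarith))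
      (fun u v => (l2 t u v).trans (w t v))
      (fun u => by
        rw [abs_neg, abs_mul]
        exact mul_le_of_le_one_right (abs_nonneg _) (Real.abs_sin_le_one _)) hη
    rw [integral_neg, integral_const_mul, sub_neg_eq_add] at this
    refine this.trans (le_of_eq ?_)
    ring

end SteinCharFun

/-! ### Quantitative central limit theorem for degenerate quadratic forms. -/

/-- A bounded symmetric kernel whose partial integrals vanish. -/
structure IsDegenerate {E : Type*} [MeasurableSpace E] (μ : Measure E) (H : E → E → ℝ) : Prop where
  bddMeas : BddMeas (Function.uncurry H)
  symm : ∀ x y, H x y = H y x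
  integral_eq_zero : ∀ x, ∫ y, H x y ∂μ = 0

/-- The composition of a kernel with itself. -/
noncomputable def kernelComp {E : Type*} [MeasurableSpace E] (μ : Measure E) (H : E → E → ℝ)
    (x y : E) : ℝ :=
  ∫ u, H u x * H u y ∂μ

section Quadratic

variable {E : Type*} [MeasurableSpace E] (μ : Measure E) [IsProbabilityMeasure μ] {H : E → E → ℝ}

theorem BddMeas.kernelComp (hH : BddMeas (Function.uncurry H)) :
    BddMeas (Function.uncurry (kernelComp μ H)) := by
  have h : BddMeas (Function.uncurry fun (p : E × E) (u : E) => H u p.1 * H u p.2) :=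
    (hH.comp (measurable_snd.prodMk (measurable_fst.comp measurable_fst))).mul
      (hH.comp (measurable_snd.prodMk (measurable_snd.comp measurable_fst)))
  exact h.integral_right μ

theorem IsDegenerate.kernelComp (hH : IsDegenerate μ H) : IsDegenerate μ (kernelComp μ H) where
  bddMeas := hH.bddMeas.kernelComp μ
  symm x y := by simp only [GaussianMMD.kernelComp, mul_comm]
  integral_eq_zero x := by
    have h : BddMeas (Function.uncurry fun (y u : E) => H u x * H u y) :=
      ((hH.bddMeas.curry_right x).comp measurable_snd).mul (hH.bddMeas.comp measurable_swap)
    simp only [GaussianMMD.kernelComp]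
    rw [integral_integral_swap (h.integrable _)]
    simp_rw [integral_const_mul, hH.integral_eq_zero]
    simp

variable {ι : Type*} [Fintype ι]

/-- The quadratic form `½ ∑ᵢⱼ cᵢⱼ H(zᵢ, zⱼ)`. -/
noncomputable def quadForm (c : ι → ι → ℝ) (H : E → E → ℝ) (z : ι → E) : ℝ :=
  (1 / 2) * ∑ i, ∑ j, c i j * H (z i) (z j)

/-- The part of the quadratic form that involves the coordinate `a`. -/
noncomputable def quadRow (c : ι → ι → ℝ) (H : E → E → ℝ) (a : ι) (z : ι → E) : ℝ :=
  ∑ b, c a b * H (z a) (z b)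

variable {c : ι → ι → ℝ}

theorem BddMeas.quadRow (hH : BddMeas (Function.uncurry H)) (a : ι) : BddMeas (quadRow c H a) :=
  .sum fun b _ => (hH.eval₂ a b).const_mul _

theorem BddMeas.quadForm (hH : BddMeas (Function.uncurry H)) : BddMeas (quadForm c H) :=
  (BddMeas.sum fun a _ => hH.quadRow a).const_mul _

omit [MeasurableSpace E] in
theorem sum_quadRow (z : ι → E) : ∑ a, quadRow c H a z = 2 * quadForm c H z := by
  simp only [quadRow, quadForm]
  ring

variable [DecidableEq ι] (hc : ∀ i j, c i j = c j i) (hc0 : ∀ i, c i i = 0)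

include hc0 in
omit [MeasurableSpace E] in
theorem quadRow_update (a : ι) (z : ι → E) (x : E) :
    quadRow c H a (Function.update z a x) = ∑ b, c a b * H x (z b) := by
  refine Finset.sum_congr rfl fun b _ => ?_
  by_cases hb : b = a
  · subst hb; simp [hc0]
  · rw [Function.update_self, Function.update_of_ne hb]

include hc hc0 in
omit [MeasurableSpace E] in
-- The factor `1 / 2` cancels the double count of pairs containing `a`. The right side visibly
-- ignores the coordinate `a`, as the Stein bound requires.
theorem quadForm_sub_quadRow (hs : ∀ x y, H x y = H y x) (a : ι) (z : ι → E) :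
    quadForm c H z - quadRow c H a z
      = (1 / 2) * ∑ i, ∑ j, if i = a ∨ j = a then 0 else c i j * H (z i) (z j) := by
  have e : ∀ i j, c i j * H (z i) (z j) = (if i = a ∨ j = a then 0 else c i j * H (z i) (z j))
      + (if i = a then c i j * H (z i) (z j) else 0)
      + (if j = a then c i j * H (z i) (z j) else 0) := fun i j => by
    by_cases hi : i = a <;> by_cases hj : j = a <;> simp [hi, hj, hc0]
  have e1 : ∑ i, ∑ j, (if i = a then c i j * H (z i) (z j) else 0) = quadRow c H a z := by
    rw [Finset.sum_comm]
    simp [quadRow]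
  have e2 : ∑ i, ∑ j, (if j = a then c i j * H (z i) (z j) else 0) = quadRow c H a z := by
    simp only [Finset.sum_ite_eq', Finset.mem_univ, if_true, quadRow]
    exact Finset.sum_congr rfl fun i _ => by rw [hc, hs]
  have e3 : ∑ i, ∑ j, c i j * H (z i) (z j)
      = (∑ i, ∑ j, if i = a ∨ j = a then 0 else c i j * H (z i) (z j))
        + quadRow c H a z + quadRow c H a z := by
    nth_rw 1 [← e1]
    rw [← e2]
    simp_rw [← Finset.sum_add_distrib]
    exact Finset.sum_congr rfl fun i _ => Finset.sum_congr rfl fun j _ => e i j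
  rw [quadForm, e3]
  ring

include hc hc0 in
omit [MeasurableSpace E] in
theorem quadForm_sub_quadRow_update (hs : ∀ x y, H x y = H y x) (a : ι) (z : ι → E) (x : E) :
    quadForm c H (Function.update z a x) - quadRow c H a (Function.update z a x)
      = quadForm c H z - quadRow c H a z := by
  rw [quadForm_sub_quadRow hc hc0 hs, quadForm_sub_quadRow hc hc0 hs]
  congr 1
  refine Finset.sum_congr rfl fun i _ => Finset.sum_congr rfl fun j _ => ?_
  by_cases h : i = a ∨ j = a
  · simp [h]
  · push Not at h
    simp only [h.1, h.2, or_self, if_false, Function.update_of_ne h.1, Function.update_of_ne h.2]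

variable (hH : IsDegenerate μ H)

include hc0 hH in
theorem integral_quadRow_update (a : ι) (z : ι → E) :
    ∫ x, quadRow c H a (Function.update z a x) ∂μ = 0 := by
  simp_rw [quadRow_update hc0]
  rw [BddMeas.integral_sum fun b _ => (hH.bddMeas.curry_right (z b)).const_mul _]
  refine Finset.sum_eq_zero fun b _ => ?_
  simp_rw [integral_const_mul, hH.symm _ (z b), hH.integral_eq_zero, mul_zero]

include hc0 hH in
-- With `z a = x` fixed, the row is a sum of independent centred variables `c a b * H x (z b)`; the
-- same conditioning gives the fourth moment bound.
theorem integral_quadRow_sq (a : ι) :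
    ∫ z, quadRow c H a z ^ 2 ∂(Measure.pi fun _ : ι => μ)
      = (∑ b, c a b ^ 2) * ∫ x, ∫ y, H x y ^ 2 ∂μ ∂μ := by
  rw [integral_pi_update_swap μ ((hH.bddMeas.quadRow a).pow 2) a, ← integral_const_mul]
  refine integral_congr_ae (ae_of_all _ fun x => ?_)
  simp_rw [quadRow_update hc0]
  rw [integral_sum_sq μ (v := fun b y => c a b * H x y)
    (fun b => (hH.bddMeas.curry x).const_mul _)
    (fun b => by rw [integral_const_mul, hH.integral_eq_zero, mul_zero]), Finset.sum_mul]
  simp_rw [mul_pow, integral_const_mul]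

include hc0 hH in
theorem integral_quadRow_pow_four_le (a : ι) :
    ∫ z, quadRow c H a z ^ 4 ∂(Measure.pi fun _ : ι => μ)
      ≤ (∑ b, c a b ^ 4) * ∫ x, ∫ y, H x y ^ 4 ∂μ ∂μ
        + 3 * (∑ b, c a b ^ 2) ^ 2 * ∫ x, (∫ y, H x y ^ 2 ∂μ) ^ 2 ∂μ := by
  have b4 : BddMeas fun x => ∫ y, H x y ^ 4 ∂μ :=
    BddMeas.integral_right (F := fun x y => H x y ^ 4) (hH.bddMeas.pow 4) μ
  have b2 : BddMeas fun x => ∫ y, H x y ^ 2 ∂μ :=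
    BddMeas.integral_right (F := fun x y => H x y ^ 2) (hH.bddMeas.pow 2) μ
  rw [integral_pi_update_swap μ ((hH.bddMeas.quadRow a).pow 4) a, ← integral_const_mul,
    ← integral_const_mul, ← (b4.const_mul _).integral_add ((b2.pow 2).const_mul _)]
  refine (((((hH.bddMeas.quadRow a).pow 4).update a).swap).integral_right _).integral_mono
    ((b4.const_mul _).add ((b2.pow 2).const_mul _)) fun x => ?_
  simp_rw [quadRow_update hc0]
  refine (integral_sum_pow_four_le μ (v := fun b y => c a b * H x y)
    (fun b => (hH.bddMeas.curry x).const_mul _)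
    (fun b => by rw [integral_const_mul, hH.integral_eq_zero, mul_zero])
    Finset.univ).trans (le_of_eq ?_)
  simp_rw [mul_pow, integral_const_mul, ← Finset.sum_mul]
  ring

include hc0 hH in
-- The random variance in Stein's bound is thus a quadratic form in the composed kernel, which is
-- again degenerate, so its fluctuations can be computed by the same moment formulas.
theorem condSq_quadRow (a : ι) (z : ι → E) :
    condSq μ (quadRow c H a) a z = ∑ i, ∑ j, c a i * c a j * kernelComp μ H (z i) (z j) := by
  have hb : ∀ i j, BddMeas fun x => c a i * c a j * (H x (z i) * H x (z j)) := fun i j =>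
    ((hH.bddMeas.curry_right (z i)).mul (hH.bddMeas.curry_right (z j))).const_mul _
  have e : ∀ x, (∑ b, c a b * H x (z b)) ^ 2
      = ∑ i, ∑ j, c a i * c a j * (H x (z i) * H x (z j)) := fun x => by
    rw [pow_two, Finset.sum_mul]
    refine Finset.sum_congr rfl fun i _ => ?_
    rw [Finset.mul_sum]
    exact Finset.sum_congr rfl fun j _ => by ring
  simp only [condSq, quadRow_update hc0, kernelComp, e]
  rw [BddMeas.integral_sum fun i _ => .sum fun j _ => hb i j]
  refine Finset.sum_congr rfl fun i _ => ?_
  rw [BddMeas.integral_sum fun j _ => hb i j]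
  simp_rw [integral_const_mul]

include hH in
omit [IsProbabilityMeasure μ] in
theorem integral_kernelComp_diag :
    ∫ x, kernelComp μ H x x ∂μ = ∫ x, ∫ y, H x y ^ 2 ∂μ ∂μ := by
  simp only [kernelComp, ← pow_two]
  exact integral_congr_ae (ae_of_all _ fun x => by simp only [hH.symm _ x])

include hc0 hH in
-- The variance is a quadratic form in the composed kernel `Γ` with matrix `γ = ½ cᵀc`, whose
-- entries are at most `½ N κ²`. Its centred diagonal is a sum of independent centred variables,
-- bounded through `Γ(x,x) = ∫ H(x,y)²`; its off-diagonal part is degenerate and brings in the trace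
-- of `H⁴`.
theorem integral_half_sum_condSq_sub_sq_le {κ : ℝ} (hκ : ∀ i j, |c i j| ≤ κ) :
    ∫ z, ((1 / 2) * ∑ a, condSq μ (quadRow c H a) a z
        - (1 / 2) * (∑ i, ∑ j, c i j ^ 2) * ∫ x, ∫ y, H x y ^ 2 ∂μ ∂μ) ^ 2
        ∂(Measure.pi fun _ : ι => μ)
      ≤ (1 / 2) * (Fintype.card ι) ^ 3 * κ ^ 4 * ∫ x, (∫ y, H x y ^ 2 ∂μ) ^ 2 ∂μ
        + (Fintype.card ι) ^ 4 * κ ^ 4 * ∫ x, ∫ y, kernelComp μ H x y ^ 2 ∂μ ∂μ := by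
  set N : ℝ := (Fintype.card ι : ℝ) with hN
  set h2 := ∫ x, ∫ y, H x y ^ 2 ∂μ ∂μ with hh2
  have hΓ := hH.kernelComp
  set Γ := kernelComp μ H with hΓdef
  set γ : ι → ι → ℝ := fun i j => (1 / 2) * ∑ a, c a i * c a j with hγ
  have hγb : ∀ i j, γ i j ^ 2 ≤ ((1 / 2) * (N * κ ^ 2)) ^ 2 := fun i j => by
    refine sq_le_sq.2 ((abs_mul _ _).trans_le (le_trans ?_ (le_abs_self _)))
    rw [abs_of_pos (by norm_num : (0 : ℝ) < 1 / 2)]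
    refine mul_le_mul_of_nonneg_left ((Finset.abs_sum_le_sum_abs _ _).trans ?_) (by norm_num)
    refine (Finset.sum_le_card_nsmul _ _ (κ ^ 2) fun a _ => ?_).trans (le_of_eq ?_)
    · rw [abs_mul, pow_two]
      exact mul_le_mul (hκ _ _) (hκ _ _) (abs_nonneg _) ((abs_nonneg _).trans (hκ a i))
    · simp [hN]
  set γ' : ι → ι → ℝ := fun i j => if i = j then 0 else γ i j with hγ'
  have hdiag : BddMeas fun x => Γ x x := hΓ.bddMeas.comp (measurable_id.prodMk measurable_id)
  have hu : BddMeas fun x => Γ x x - h2 := hdiag.sub (.const _)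
  have hdi : ∫ x, Γ x x ∂μ = h2 := integral_kernelComp_diag μ hH
  have e : ∀ z : ι → E, (1 / 2) * ∑ a, condSq μ (quadRow c H a) a z
        - (1 / 2) * (∑ i, ∑ j, c i j ^ 2) * h2
      = ∑ i, γ i i * (Γ (z i) (z i) - h2) + ∑ i, ∑ j, γ' i j * Γ (z i) (z j) := by
    intro z
    have e1 : (1 / 2) * ∑ a, condSq μ (quadRow c H a) a z = ∑ i, ∑ j, γ i j * Γ (z i) (z j) := by
      simp_rw [condSq_quadRow μ hc0 hH]
      rw [Finset.sum_comm, Finset.mul_sum]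
      refine Finset.sum_congr rfl fun i _ => ?_
      rw [Finset.sum_comm, Finset.mul_sum]
      refine Finset.sum_congr rfl fun j _ => ?_
      rw [hγ, ← Finset.sum_mul, mul_assoc]
    have e2 : (1 / 2) * (∑ i, ∑ j, c i j ^ 2) * h2 = ∑ i, γ i i * h2 := by
      rw [Finset.sum_comm, ← Finset.sum_mul, Finset.mul_sum]
      simp only [hγ, pow_two]
    have e3 : ∑ i, ∑ j, γ i j * Γ (z i) (z j)
        = ∑ i, γ i i * Γ (z i) (z i) + ∑ i, ∑ j, γ' i j * Γ (z i) (z j) := by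
      rw [← Finset.sum_add_distrib]
      refine Finset.sum_congr rfl fun i _ => ?_
      have : ∀ j, γ i j * Γ (z i) (z j)
          = (if i = j then γ i j * Γ (z i) (z j) else 0) + γ' i j * Γ (z i) (z j) := fun j => by
        by_cases h : i = j <;> simp [hγ', h]
      rw [Finset.sum_congr rfl fun j _ => this j, Finset.sum_add_distrib]
      simp
    rw [e1, e2, e3]
    simp_rw [mul_sub, Finset.sum_sub_distrib]
    ring
  have b1 : BddMeas fun z : ι → E => ∑ i, γ i i * (Γ (z i) (z i) - h2) :=
    .sum fun i _ => (hu.eval i).const_mul _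
  have b2 : BddMeas fun z : ι → E => ∑ i, ∑ j, γ' i j * Γ (z i) (z j) :=
    .sum fun i _ => .sum fun j _ => (hΓ.bddMeas.eval₂ i j).const_mul _
  have m1 : ∫ z, (∑ i, γ i i * (Γ (z i) (z i) - h2)) ^ 2 ∂(Measure.pi fun _ : ι => μ)
      ≤ N * (((1 / 2) * (N * κ ^ 2)) ^ 2 * ∫ x, (∫ y, H x y ^ 2 ∂μ) ^ 2 ∂μ) := by
    rw [integral_sum_sq μ (v := fun i x => γ i i * (Γ x x - h2)) (fun i => hu.const_mul _)
      (fun i => by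
        rw [integral_const_mul, hdiag.integral_sub (.const _), hdi]
        simp)]
    refine (Finset.sum_le_card_nsmul _ _
      (((1 / 2) * (N * κ ^ 2)) ^ 2 * ∫ x, (∫ y, H x y ^ 2 ∂μ) ^ 2 ∂μ) fun i _ => ?_).trans
      (le_of_eq (by simp [hN]))
    simp_rw [mul_pow (γ i i)]
    rw [integral_const_mul]
    refine mul_le_mul (hγb i i) ?_ (integral_nonneg fun _ => sq_nonneg _) (sq_nonneg _)
    rw [← hdi]
    refine (integral_sub_mean_sq_le μ hdiag).trans (le_of_eq ?_)
    refine integral_congr_ae (ae_of_all _ fun x => ?_)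
    simp only [hΓdef, kernelComp, ← pow_two, hH.symm _ x]
  have m2 : ∫ z, (∑ i, ∑ j, γ' i j * Γ (z i) (z j)) ^ 2 ∂(Measure.pi fun _ : ι => μ)
      ≤ 2 * (N * (N * ((1 / 2) * (N * κ ^ 2)) ^ 2)) * ∫ x, ∫ y, Γ x y ^ 2 ∂μ ∂μ := by
    rw [integral_quadratic_sq μ hΓ.bddMeas hΓ.symm hΓ.integral_eq_zero
      (fun i j => by simp only [hγ', hγ, eq_comm (a := i), mul_comm]) (fun i => by simp [hγ'])]
    refine mul_le_mul_of_nonneg_right (mul_le_mul_of_nonneg_left ?_ (by norm_num))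
      (integral_nonneg fun x => integral_nonneg fun y => sq_nonneg _)
    refine (Finset.sum_le_card_nsmul _ _ (N * ((1 / 2) * (N * κ ^ 2)) ^ 2) fun i _ => ?_).trans
      (le_of_eq (by simp [hN]))
    refine (Finset.sum_le_card_nsmul _ _ (((1 / 2) * (N * κ ^ 2)) ^ 2) fun j _ => ?_).trans
      (le_of_eq (by simp [hN]))
    by_cases h : i = j
    · simp only [hγ', h, if_true]
      rw [zero_pow two_ne_zero]
      positivity
    · simp only [hγ', h, if_false]
      exact hγb i j
  simp_rw [e]
  refine (((b1.add b2).pow 2).integral_mono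
    (((b1.pow 2).const_mul 2).add ((b2.pow 2).const_mul 2)) fun z => ?_).trans ?_
  · nlinarith [sq_nonneg (∑ i, γ i i * (Γ (z i) (z i) - h2)
      - ∑ i, ∑ j, γ' i j * Γ (z i) (z j))]
  rw [((b1.pow 2).const_mul 2).integral_add ((b2.pow 2).const_mul 2), integral_const_mul,
    integral_const_mul]
  refine (add_le_add (mul_le_mul_of_nonneg_left m1 (by norm_num))
    (mul_le_mul_of_nonneg_left m2 (by norm_num))).trans (le_of_eq ?_)
  ring

include hc hc0 hH in
/-- Quantitative central limit theorem for degenerate quadratic forms, on the level of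
characteristic functions. -/
theorem norm_charFun_quadForm_sub_le {κ : ℝ} (hκ : ∀ i j, |c i j| ≤ κ) {τ A B : ℝ}
    (hτ : τ = (1 / 2) * (∑ i, ∑ j, c i j ^ 2) * ∫ x, ∫ y, H x y ^ 2 ∂μ ∂μ)
    (hA : (1 / 2) * (Fintype.card ι) ^ 3 * κ ^ 4 * ∫ x, (∫ y, H x y ^ 2 ∂μ) ^ 2 ∂μ
        + (Fintype.card ι) ^ 4 * κ ^ 4 * ∫ x, ∫ y, kernelComp μ H x y ^ 2 ∂μ ∂μ ≤ A)
    (hB : (Fintype.card ι) ^ 2 * κ ^ 4 * ∫ x, ∫ y, H x y ^ 4 ∂μ ∂μ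
        + 3 * (Fintype.card ι) ^ 3 * κ ^ 4 * ∫ x, (∫ y, H x y ^ 2 ∂μ) ^ 2 ∂μ ≤ B)
    {η : ℝ} (hη : 0 < η) (t : ℝ) :
    ‖∫ z, Complex.exp (t * quadForm c H z * Complex.I) ∂(Measure.pi fun _ : ι => μ)
        - Complex.exp (-(t : ℂ) ^ 2 / 2)‖
      ≤ 2 * (|t| * (|t| * (|τ - 1| + (η + A / η) / 2) + t ^ 2 * (2 * τ * η + B / η))) := by
  set N : ℝ := (Fintype.card ι : ℝ) with hN
  refine (norm_charFun_sub_le_of_increments μ hH.bddMeas.quadForm (hH.bddMeas.quadRow)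
    sum_quadRow (quadForm_sub_quadRow_update hc hc0 hH.symm)
    (integral_quadRow_update μ hc0 hH) hη t).trans ?_
  set V : (ι → E) → ℝ := fun z => (1 / 2) * ∑ a, condSq μ (quadRow c H a) a z with hV
  have bV : BddMeas V := (BddMeas.sum fun a _ => (hH.bddMeas.quadRow a).condSq μ a).const_mul _
  have h1 : ∫ z, |V z - 1| ∂(Measure.pi fun _ : ι => μ) ≤ |τ - 1| + (η + A / η) / 2 := by
    calc ∫ z, |V z - 1| ∂(Measure.pi fun _ : ι => μ)
        ≤ ∫ z, (|τ - 1| + |V z - τ|) ∂(Measure.pi fun _ : ι => μ) := by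
          refine (bV.sub (.const _)).abs.integral_mono
            ((BddMeas.const _).add (bV.sub (.const _)).abs) fun z => ?_
          rw [add_comm]
          exact abs_sub_le _ _ _
      _ = |τ - 1| + ∫ z, |V z - τ| ∂(Measure.pi fun _ : ι => μ) := by
          rw [(BddMeas.const _).integral_add (bV.sub (.const _)).abs]
          simp
      _ ≤ _ := by
          refine add_le_add le_rfl ((integral_abs_le_add_div _ (bV.sub (.const _)) hη).trans ?_)
          gcongr
          rw [hτ]
          exact (integral_half_sum_condSq_sub_sq_le μ hc0 hH hκ).trans hA
  have h2 : ∑ a, ∫ z, quadRow c H a z ^ 2 ∂(Measure.pi fun _ : ι => μ) = 2 * τ := by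
    simp_rw [integral_quadRow_sq μ hc0 hH]
    rw [← Finset.sum_mul, hτ]
    ring
  have hc2 : ∀ a, ∑ b, c a b ^ 2 ≤ N * κ ^ 2 := fun a => by
    refine (Finset.sum_le_card_nsmul _ _ (κ ^ 2) fun b _ => ?_).trans (le_of_eq (by simp [hN]))
    exact sq_le_sq.2 ((hκ a b).trans (le_abs_self _))
  have hc4 : ∀ a, ∑ b, c a b ^ 4 ≤ N * κ ^ 4 := fun a => by
    refine (Finset.sum_le_card_nsmul _ _ (κ ^ 4) fun b _ => ?_).trans (le_of_eq (by simp [hN]))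
    have : c a b ^ 2 ≤ κ ^ 2 := sq_le_sq.2 ((hκ a b).trans (le_abs_self _))
    nlinarith [sq_nonneg (c a b)]
  have h4 : ∑ a, ∫ z, quadRow c H a z ^ 4 ∂(Measure.pi fun _ : ι => μ) ≤ B := by
    refine le_trans ?_ hB
    refine (Finset.sum_le_card_nsmul _ _ (N * κ ^ 4 * ∫ x, ∫ y, H x y ^ 4 ∂μ ∂μ
      + 3 * (N * κ ^ 2) ^ 2 * ∫ x, (∫ y, H x y ^ 2 ∂μ) ^ 2 ∂μ) fun a _ => ?_).trans
      (le_of_eq ?_)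
    · refine (integral_quadRow_pow_four_le μ hc0 hH a).trans (add_le_add ?_ ?_)
      · exact mul_le_mul_of_nonneg_right (hc4 a)
          (integral_nonneg fun x => integral_nonneg fun y => by positivity)
      · refine mul_le_mul_of_nonneg_right ?_ (integral_nonneg fun x => sq_nonneg _)
        refine mul_le_mul_of_nonneg_left ?_ (by norm_num)
        exact pow_le_pow_left₀ (Finset.sum_nonneg fun b _ => sq_nonneg _) (hc2 a) 2
    · rw [nsmul_eq_mul, Finset.card_univ, ← hN]
      ring
  rw [h2]
  have h5 : η * (2 * τ) = 2 * τ * η := by ring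
  rw [h5]
  gcongr

end Quadratic

/-! ### Moments of doubly centred kernels. -/

/-- A measurable symmetric kernel with values in `[0, 1]`. -/
structure IsUnitKernel {E : Type*} [MeasurableSpace E] (G : E → E → ℝ) : Prop where
  measurable : Measurable (Function.uncurry G)
  symm : ∀ x y, G x y = G y x
  nonneg : ∀ x y, 0 ≤ G x y
  le_one : ∀ x y, G x y ≤ 1

section Centered

variable {E : Type*} [MeasurableSpace E] {G : E → E → ℝ}

theorem IsUnitKernel.bddMeas (hG : IsUnitKernel G) : BddMeas (Function.uncurry G) :=
  ⟨hG.measurable, 1, fun p => (abs_of_nonneg (hG.nonneg p.1 p.2)).trans_le (hG.le_one p.1 p.2)⟩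

theorem IsUnitKernel.sq_le (hG : IsUnitKernel G) (x y : E) : G x y ^ 2 ≤ G x y := by
  rw [pow_two]
  exact mul_le_of_le_one_left (hG.nonneg x y) (hG.le_one x y)

variable (μ : Measure E) [IsProbabilityMeasure μ]

/-- The mean of a kernel in its second argument. -/
noncomputable def kernelMean (μ : Measure E) (G : E → E → ℝ) (x : E) : ℝ := ∫ y, G x y ∂μ

/-- The doubly centred kernel. -/
noncomputable def centered (μ : Measure E) (G : E → E → ℝ) (x y : E) : ℝ :=
  G x y - kernelMean μ G y - (kernelMean μ G x - ∫ u, kernelMean μ G u ∂μ)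

theorem BddMeas.kernelMean (hG : BddMeas (Function.uncurry G)) : BddMeas (kernelMean μ G) :=
  hG.integral_right μ

variable (hG : IsUnitKernel G)

include hG

omit [IsProbabilityMeasure μ] in
theorem IsUnitKernel.kernelMean_nonneg (x : E) : 0 ≤ kernelMean μ G x :=
  integral_nonneg fun y => hG.nonneg x y

theorem IsUnitKernel.kernelMean_le_one (x : E) : kernelMean μ G x ≤ 1 := by
  refine ((hG.bddMeas.curry x).integral_mono (μ := μ) (.const 1) (hG.le_one x)).trans ?_
  simp

theorem IsUnitKernel.bddMeas_section (x : E) : BddMeas fun y => G x y - kernelMean μ G y :=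
  (hG.bddMeas.curry x).sub (hG.bddMeas.kernelMean μ)

theorem IsUnitKernel.integral_section (x : E) :
    ∫ y, (G x y - kernelMean μ G y) ∂μ = kernelMean μ G x - ∫ u, kernelMean μ G u ∂μ :=
  (hG.bddMeas.curry x).integral_sub (hG.bddMeas.kernelMean μ)

theorem IsUnitKernel.isDegenerate_centered : IsDegenerate μ (centered μ G) where
  bddMeas := (hG.bddMeas.sub ((hG.bddMeas.kernelMean μ).comp measurable_snd)).sub
    (((hG.bddMeas.kernelMean μ).comp measurable_fst).sub (.const _))
  symm x y := by
    simp only [centered, hG.symm x y]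
    ring
  integral_eq_zero x := by
    simp only [centered]
    rw [(hG.bddMeas_section μ x).integral_sub (.const _), hG.integral_section μ]
    simp

theorem IsUnitKernel.abs_centered_le (x y : E) : |centered μ G x y| ≤ 2 := by
  have h1 := hG.nonneg x y
  have h2 := hG.le_one x y
  have h3 := hG.kernelMean_nonneg μ x
  have h4 := hG.kernelMean_le_one μ x
  have h5 := hG.kernelMean_nonneg μ y
  have h6 := hG.kernelMean_le_one μ y
  have h7 : 0 ≤ ∫ u, kernelMean μ G u ∂μ := integral_nonneg fun u => hG.kernelMean_nonneg μ u
  have h8 : ∫ u, kernelMean μ G u ∂μ ≤ 1 := by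
    refine ((hG.bddMeas.kernelMean μ).integral_mono (μ := μ) (.const 1)
      (hG.kernelMean_le_one μ)).trans ?_
    simp
  rw [centered, abs_le]
  constructor <;> linarith

/-- The bracketing in `centered` makes each row the function `G x · - kernelMean μ G` minus its
mean, so the left side is a variance. -/
theorem IsUnitKernel.integral_centered_sq (x : E) :
    ∫ y, centered μ G x y ^ 2 ∂μ = ∫ y, G x y ^ 2 ∂μ - 2 * ∫ y, G x y * kernelMean μ G y ∂μ
      + ∫ y, kernelMean μ G y ^ 2 ∂μ - (kernelMean μ G x - ∫ u, kernelMean μ G u ∂μ) ^ 2 := by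
  have h := integral_sub_mean_sq μ (hG.bddMeas_section μ x)
  rw [hG.integral_section μ] at h
  simp only [centered]
  rw [h]
  have b1 := (hG.bddMeas.curry x).pow 2
  have b2 := ((hG.bddMeas.curry x).mul (hG.bddMeas.kernelMean μ)).const_mul 2
  have b3 := (hG.bddMeas.kernelMean μ).pow 2
  have e : ∀ y, (G x y - kernelMean μ G y) ^ 2
      = G x y ^ 2 - 2 * (G x y * kernelMean μ G y) + kernelMean μ G y ^ 2 := fun y => by ring
  simp_rw [e]
  rw [(b1.sub b2).integral_add b3, b1.integral_sub b2, integral_const_mul]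

theorem IsUnitKernel.integral_mul_kernelMean :
    ∫ x, ∫ y, G x y * kernelMean μ G y ∂μ ∂μ = ∫ y, kernelMean μ G y ^ 2 ∂μ := by
  have b : BddMeas (Function.uncurry fun x y => G x y * kernelMean μ G y) :=
    hG.bddMeas.mul ((hG.bddMeas.kernelMean μ).comp measurable_snd)
  rw [integral_integral_swap (b.integrable _)]
  refine integral_congr_ae (ae_of_all _ fun y => ?_)
  dsimp only
  rw [integral_mul_const, pow_two]
  simp_rw [hG.symm _ y]
  rfl

theorem IsUnitKernel.integral_integral_centered_sq :
    ∫ x, ∫ y, centered μ G x y ^ 2 ∂μ ∂μ = ∫ x, ∫ y, G x y ^ 2 ∂μ ∂μ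
      - 2 * ∫ x, kernelMean μ G x ^ 2 ∂μ + (∫ x, kernelMean μ G x ∂μ) ^ 2 := by
  simp_rw [hG.integral_centered_sq μ]
  have b1 : BddMeas fun x => ∫ y, G x y ^ 2 ∂μ :=
    BddMeas.integral_right (F := fun x y => G x y ^ 2) (hG.bddMeas.pow 2) μ
  have b2 : BddMeas fun x => 2 * ∫ y, G x y * kernelMean μ G y ∂μ :=
    (BddMeas.integral_right (F := fun x y => G x y * kernelMean μ G y)
      (hG.bddMeas.mul ((hG.bddMeas.kernelMean μ).comp measurable_snd)) μ).const_mul 2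
  have b3 : BddMeas fun _ : E => ∫ y, kernelMean μ G y ^ 2 ∂μ := .const _
  have b4 : BddMeas fun x => (kernelMean μ G x - ∫ u, kernelMean μ G u ∂μ) ^ 2 :=
    ((hG.bddMeas.kernelMean μ).sub (.const _)).pow 2
  rw [((b1.sub b2).add b3).integral_sub b4, (b1.sub b2).integral_add b3, b1.integral_sub b2,
    integral_const_mul, hG.integral_mul_kernelMean μ,
    integral_sub_mean_sq μ (hG.bddMeas.kernelMean μ)]
  simp only [integral_const, probReal_univ, one_smul]
  ring

theorem IsUnitKernel.integral_centered_sq_le_integral_sq :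
    ∫ x, ∫ y, centered μ G x y ^ 2 ∂μ ∂μ ≤ ∫ x, ∫ y, G x y ^ 2 ∂μ ∂μ := by
  rw [hG.integral_integral_centered_sq μ]
  have h1 := sq_integral_le μ (hG.bddMeas.kernelMean μ)
  have h2 : 0 ≤ ∫ x, kernelMean μ G x ^ 2 ∂μ := integral_nonneg fun x => sq_nonneg _
  linarith

/-- Together with the upper bound by `∫∫ G²`, this shows that centring changes the second moment by
a relative error of at most twice `E g(Z)²/σ`. -/
theorem IsUnitKernel.le_integral_centered_sq :
    ∫ x, ∫ y, G x y ^ 2 ∂μ ∂μ - 2 * ∫ x, kernelMean μ G x ^ 2 ∂μ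
      ≤ ∫ x, ∫ y, centered μ G x y ^ 2 ∂μ ∂μ := by
  rw [hG.integral_integral_centered_sq μ]
  linarith [sq_nonneg (∫ x, kernelMean μ G x ∂μ)]

theorem IsUnitKernel.integral_centered_pow_four_le :
    ∫ x, ∫ y, centered μ G x y ^ 4 ∂μ ∂μ ≤ 4 * ∫ x, ∫ y, G x y ^ 2 ∂μ ∂μ := by
  have hH := (hG.isDegenerate_centered μ).bddMeas
  have b4 : BddMeas fun x => ∫ y, centered μ G x y ^ 4 ∂μ :=
    BddMeas.integral_right (F := fun x y => centered μ G x y ^ 4) (hH.pow 4) μ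
  have b2 : BddMeas fun x => ∫ y, centered μ G x y ^ 2 ∂μ :=
    BddMeas.integral_right (F := fun x y => centered μ G x y ^ 2) (hH.pow 2) μ
  refine le_trans ?_ (mul_le_mul_of_nonneg_left (hG.integral_centered_sq_le_integral_sq μ)
    (by norm_num))
  rw [← integral_const_mul]
  refine b4.integral_mono (b2.const_mul 4) fun x => ?_
  rw [← integral_const_mul]
  refine ((hH.curry x).pow 4).integral_mono (((hH.curry x).pow 2).const_mul 4) fun y => ?_
  have h1 := hG.abs_centered_le μ x y
  have h2 : centered μ G x y ^ 2 ≤ 4 := by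
    rw [← sq_abs]
    nlinarith [abs_nonneg (centered μ G x y)]
  nlinarith [sq_nonneg (centered μ G x y)]

variable {θ : ℝ} (hθ : ∀ x, kernelMean μ G x ≤ θ)

include hθ

theorem IsUnitKernel.integral_kernelMean_sq_le :
    ∫ x, kernelMean μ G x ^ 2 ∂μ ≤ θ * ∫ x, kernelMean μ G x ∂μ := by
  rw [← integral_const_mul]
  refine ((hG.bddMeas.kernelMean μ).pow 2).integral_mono ((hG.bddMeas.kernelMean μ).const_mul θ)
    fun x => ?_
  rw [pow_two]
  exact mul_le_mul_of_nonneg_right (hθ x) (hG.kernelMean_nonneg μ x)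

/-- Since `G² ≤ G`, the inner integral is at most `2θ` uniformly in `x`; one of its two factors is
bounded this way and the other is integrated. -/
theorem IsUnitKernel.integral_integral_centered_sq_sq_le :
    ∫ x, (∫ y, centered μ G x y ^ 2 ∂μ) ^ 2 ∂μ ≤ 2 * θ * ∫ x, ∫ y, G x y ^ 2 ∂μ ∂μ := by
  have hH := (hG.isDegenerate_centered μ).bddMeas
  have b2 : BddMeas fun x => ∫ y, centered μ G x y ^ 2 ∂μ :=
    BddMeas.integral_right (F := fun x y => centered μ G x y ^ 2) (hH.pow 2) μ
  have hE : Nonempty E := nonempty_of_isProbabilityMeasure μ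
  have hθ0 : 0 ≤ θ := (hG.kernelMean_nonneg μ hE.some).trans (hθ _)
  have key : ∀ x, ∫ y, centered μ G x y ^ 2 ∂μ ≤ 2 * θ := fun x => by
    rw [hG.integral_centered_sq μ]
    have h1 : ∫ y, G x y ^ 2 ∂μ ≤ θ :=
      (((hG.bddMeas.curry x).pow 2).integral_mono (hG.bddMeas.curry x) (hG.sq_le x)).trans (hθ x)
    have h2 : 0 ≤ ∫ y, G x y * kernelMean μ G y ∂μ :=
      integral_nonneg fun y => mul_nonneg (hG.nonneg x y) (hG.kernelMean_nonneg μ y)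
    have h3 : ∫ x, kernelMean μ G x ^ 2 ∂μ ≤ θ := by
      refine (((hG.bddMeas.kernelMean μ).pow 2).integral_mono (.const θ) fun y => ?_).trans
        (le_of_eq (by simp))
      nlinarith [hG.kernelMean_nonneg μ y, hG.kernelMean_le_one μ y, hθ y]
    nlinarith [sq_nonneg (kernelMean μ G x - ∫ u, kernelMean μ G u ∂μ)]
  refine le_trans ?_ (mul_le_mul_of_nonneg_left (hG.integral_centered_sq_le_integral_sq μ)
    (by positivity))
  rw [← integral_const_mul]
  refine (b2.pow 2).integral_mono (b2.const_mul _) fun x => ?_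
  rw [pow_two]
  exact mul_le_mul_of_nonneg_right (key x) (integral_nonneg fun y => sq_nonneg _)

omit hθ in
/-- Bound for the trace of the fourth power of a centred kernel by a bound `Λ` for the squared
operator norm. -/
theorem IsUnitKernel.integral_kernelComp_centered_sq_le {Λ : ℝ} (hΛ0 : 0 ≤ Λ)
    (hΛ : ∀ f : E → ℝ, BddMeas f → ∫ x, (∫ y, G x y * f y ∂μ) ^ 2 ∂μ ≤ Λ * ∫ y, f y ^ 2 ∂μ) :
    ∫ x, ∫ y, kernelComp μ (centered μ G) x y ^ 2 ∂μ ∂μ ≤ Λ * ∫ x, ∫ y, G x y ^ 2 ∂μ ∂μ := by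
  have hD := hG.isDegenerate_centered μ
  have hH := hD.bddMeas
  set H := centered μ G with hHdef
  have bK := hH.kernelComp μ
  have b2 : BddMeas fun x => ∫ y, H x y ^ 2 ∂μ :=
    BddMeas.integral_right (F := fun x y => H x y ^ 2) (hH.pow 2) μ
  have key : ∀ x, ∫ y, kernelComp μ H x y ^ 2 ∂μ ≤ Λ * ∫ u, H x u ^ 2 ∂μ := fun x => by
    have bx := hH.curry x
    have bG : ∀ y, BddMeas fun u => G y u * H x u := fun y => (hG.bddMeas.curry y).mul bx
    have bm : BddMeas fun u => kernelMean μ G u * H x u := (hG.bddMeas.kernelMean μ).mul bx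
    have bF : BddMeas (Function.uncurry fun y u => G y u * H x u) :=
      hG.bddMeas.mul (bx.comp measurable_snd)
    have bFi : BddMeas fun y => ∫ u, G y u * H x u ∂μ := bF.integral_right μ
    have e1 : ∫ u, kernelMean μ G u * H x u ∂μ = ∫ y, ∫ u, G y u * H x u ∂μ ∂μ := by
      rw [integral_integral_swap (bF.integrable _)]
      refine integral_congr_ae (ae_of_all _ fun u => ?_)
      dsimp only
      rw [integral_mul_const]
      simp_rw [hG.symm _ u]
      rfl
    -- Composing with `H` amounts to applying the operator of `G` to the row `H x ·` and subtracting
    -- the mean: the other centring terms vanish because the row integrates to zero. A variance is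
    -- then bounded by a second moment, to which `hΛ` applies.
    have e2 : ∀ y, kernelComp μ H x y
        = ∫ u, G y u * H x u ∂μ - ∫ y, ∫ u, G y u * H x u ∂μ ∂μ := fun y => by
      have e3 : ∀ u, H u x * H u y = G y u * H x u - kernelMean μ G u * H x u
          - (kernelMean μ G y - ∫ u, kernelMean μ G u ∂μ) * H x u := fun u => by
        rw [hD.symm u x, hD.symm u y]
        simp only [hHdef, centered]
        ring
      simp only [kernelComp, e3]
      rw [((bG y).sub bm).integral_sub (bx.const_mul _), (bG y).integral_sub bm, e1,
        integral_const_mul, hD.integral_eq_zero]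
      ring
    simp_rw [e2]
    exact (integral_sub_mean_sq_le μ bFi).trans (hΛ _ bx)
  refine le_trans ?_ (mul_le_mul_of_nonneg_left (hG.integral_centered_sq_le_integral_sq μ) hΛ0)
  rw [← integral_const_mul]
  exact (BddMeas.integral_right (F := fun x y => kernelComp μ H x y ^ 2) (bK.pow 2) μ).integral_mono
    (b2.const_mul _) key

end Centered

/-! ### U-statistics of order two and the correction sums of the variance estimate. -/

section UStatistic

variable {E : Type*} [MeasurableSpace E] (μ : Measure E) [IsProbabilityMeasure μ] {G : E → E → ℝ}
  {ι : Type*} [Fintype ι] [DecidableEq ι]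

/-- Mean squared error of the U-statistic of order two with kernel `G`. -/
theorem IsUnitKernel.integral_uStat_sub_sq_le (hG : IsUnitKernel G) {θ : ℝ}
    (hθ : ∀ x, kernelMean μ G x ≤ θ) {N : ℝ} (hN : N = Fintype.card ι) (hN1 : 1 < N) :
    ∫ z : ι → E, (1 / (N * (N - 1)) * (∑ i, ∑ j, if i ≠ j then G (z i) (z j) else 0)
        - ∫ x, kernelMean μ G x ∂μ) ^ 2 ∂(Measure.pi fun _ : ι => μ)
      ≤ 4 / (N * (N - 1)) * ∫ x, ∫ y, G x y ^ 2 ∂μ ∂μ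
        + 8 / N * (θ * ∫ x, kernelMean μ G x ∂μ) := by
  have hD := hG.isDegenerate_centered μ
  have bg := hG.bddMeas.kernelMean μ
  set σ := ∫ x, kernelMean μ G x ∂μ with hσ
  set H := centered μ G with hH
  set β : ι → ι → ℝ := fun i j => if i = j then 0 else 1 with hβ
  have hβs : ∑ i, ∑ j, β i j ^ 2 = N * (N - 1) := by
    have : ∀ i j, β i j ^ 2 = 1 - if i = j then 1 else 0 := fun i j => by
      by_cases h : i = j <;> simp [hβ, h]
    simp_rw [this, Finset.sum_sub_distrib]
    simp [hN]
    ring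
  have hN0 : 0 < N := by linarith
  have hN1' : 0 < N - 1 := by linarith
  -- Hoeffding decomposition into a degenerate quadratic part and a linear part.
  have e : ∀ z : ι → E, 1 / (N * (N - 1)) * (∑ i, ∑ j, if i ≠ j then G (z i) (z j) else 0) - σ
      = 1 / (N * (N - 1)) * (∑ i, ∑ j, β i j * H (z i) (z j))
        + 2 / N * ∑ i, (kernelMean μ G (z i) - σ) := by
    intro z
    have e1 : ∀ i j, (if i ≠ j then G (z i) (z j) else 0)
        = β i j * H (z i) (z j) + ((kernelMean μ G (z i) - σ) + (kernelMean μ G (z j) - σ) + σ)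
          - if i = j then (kernelMean μ G (z i) - σ) + (kernelMean μ G (z j) - σ) + σ else 0 :=
      fun i j => by
        by_cases h : i = j
        · simp [hβ, h]
        · simp only [hβ, h, hH, centered, ne_eq, not_false_eq_true, if_true, if_false]
          ring
    simp_rw [e1, Finset.sum_sub_distrib, Finset.sum_add_distrib]
    simp only [Finset.sum_ite_eq, Finset.mem_univ, if_true, Finset.sum_const, nsmul_eq_mul,
      Finset.card_univ, ← hN, ← Finset.mul_sum, Finset.sum_add_distrib, Finset.sum_sub_distrib]
    field_simp
    ring
  have b1 : BddMeas fun z : ι → E => 1 / (N * (N - 1)) * (∑ i, ∑ j, β i j * H (z i) (z j)) :=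
    (BddMeas.sum fun i _ => .sum fun j _ => (hD.bddMeas.eval₂ i j).const_mul _).const_mul _
  have bu : BddMeas fun x => kernelMean μ G x - σ := bg.sub (.const _)
  have b2 : BddMeas fun z : ι → E => 2 / N * ∑ i, (kernelMean μ G (z i) - σ) :=
    (BddMeas.sum fun i _ => bu.eval i).const_mul _
  simp_rw [e]
  refine (((b1.add b2).pow 2).integral_mono
    (((b1.pow 2).const_mul 2).add ((b2.pow 2).const_mul 2))
    fun z => add_sq_le.trans_eq (mul_add _ _ _)).trans ?_
  rw [((b1.pow 2).const_mul 2).integral_add ((b2.pow 2).const_mul 2), integral_const_mul,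
    integral_const_mul]
  simp_rw [mul_pow]
  rw [integral_const_mul, integral_const_mul,
    integral_quadratic_sq μ hD.bddMeas hD.symm hD.integral_eq_zero
      (fun i j => by simp only [hβ, eq_comm (a := i)]) (fun i => by simp [hβ]), hβs,
    integral_sum_sq μ (v := fun _ x => kernelMean μ G x - σ) (fun _ => bu)
      (fun _ => by rw [bg.integral_sub (.const _)]; simp [hσ])]
  have h1 := hG.integral_centered_sq_le_integral_sq μ
  have h2 := (integral_sub_mean_sq_le μ bg).trans (hG.integral_kernelMean_sq_le μ hθ)
  rw [Finset.sum_const, nsmul_eq_mul, Finset.card_univ, ← hN]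
  refine add_le_add (le_of_eq_of_le ?_ (mul_le_mul_of_nonneg_left h1
      (by positivity : 0 ≤ 4 / (N * (N - 1)))))
    (le_of_eq_of_le ?_ (mul_le_mul_of_nonneg_left h2 (by positivity : 0 ≤ 8 / N)))
  · field_simp
    ring
  · field_simp
    ring

/-- The sum is nonnegative, so its mean is all that is needed for `L¹` control. Every admissible
term has mean `∫ kernelMean²`, and there are at most `N ^ 3` of them. -/
theorem IsUnitKernel.integral_sum_pairs_sharing_le (hG : IsUnitKernel G) {N : ℝ}
    (hN : N = Fintype.card ι) :
    ∫ z : ι → E, (∑ i, ∑ j₁, ∑ j₂, if ({i, j₁, j₂} : Finset ι).card = 3 then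
        G (z i) (z j₁) * G (z i) (z j₂) else 0) ∂(Measure.pi fun _ : ι => μ)
      ≤ N ^ 3 * ∫ x, kernelMean μ G x ^ 2 ∂μ := by
  have hb : ∀ i j₁ j₂ : ι, BddMeas fun z : ι → E =>
      if ({i, j₁, j₂} : Finset ι).card = 3 then G (z i) (z j₁) * G (z i) (z j₂) else 0 :=
    fun i j₁ j₂ => by
      split_ifs
      · exact (hG.bddMeas.eval₂ i j₁).mul (hG.bddMeas.eval₂ i j₂)
      · exact .const 0
  have h0 : 0 ≤ ∫ x, kernelMean μ G x ^ 2 ∂μ := integral_nonneg fun x => sq_nonneg _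
  have bg := hG.bddMeas.kernelMean μ
  rw [BddMeas.integral_sum fun i _ => .sum fun j _ => .sum fun k _ => hb i j k]
  refine (Finset.sum_le_card_nsmul _ _ (N ^ 2 * ∫ x, kernelMean μ G x ^ 2 ∂μ)
    fun i _ => ?_).trans (le_of_eq (by simp [hN]; ring))
  rw [BddMeas.integral_sum fun j _ => .sum fun k _ => hb i j k]
  refine (Finset.sum_le_card_nsmul _ _ (N * ∫ x, kernelMean μ G x ^ 2 ∂μ)
    fun j _ => ?_).trans (le_of_eq (by simp [hN]; ring))
  rw [BddMeas.integral_sum fun k _ => hb i j k]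
  refine (Finset.sum_le_card_nsmul _ _ (∫ x, kernelMean μ G x ^ 2 ∂μ)
    fun k _ => ?_).trans (le_of_eq (by simp [hN]))
  split_ifs with h
  · have hij : i ≠ j := by
      rintro rfl
      simp only [Finset.insert_idem] at h
      exact absurd (Finset.card_le_two (a := i) (b := k)) (by omega)
    have hik : i ≠ k := by
      rintro rfl
      rw [Finset.insert_eq_self.2 (by simp)] at h
      exact absurd (Finset.card_le_two (a := j) (b := i)) (by omega)
    have hjk : j ≠ k := by
      rintro rfl
      simp only [Finset.pair_eq_singleton] at h
      exact absurd (Finset.card_le_two (a := i) (b := j)) (by omega)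
    rw [integral_pi_update μ ((hG.bddMeas.eval₂ i j).mul (hG.bddMeas.eval₂ i k)) j]
    simp_rw [Function.update_self, Function.update_of_ne hij, Function.update_of_ne hjk.symm,
      integral_mul_const]
    change ∫ z : ι → E, kernelMean μ G (z i) * G (z i) (z k) ∂_ ≤ _
    rw [integral_pi_eval_pair μ (f := fun x y => kernelMean μ G x * G x y)
      ((bg.comp measurable_fst).mul hG.bddMeas) hik]
    simp_rw [integral_const_mul, pow_two]
    rfl
  · simpa using h0

/-- Each term has mean `(∫ kernelMean)²`; Jensen's inequality bounds it by the quantity that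
controls the sharing pairs, so a single limit handles both corrections. -/
theorem IsUnitKernel.integral_sum_disjoint_pairs_le (hG : IsUnitKernel G) {N : ℝ}
    (hN : N = Fintype.card ι) :
    ∫ z : ι → E, (∑ i₁, ∑ i₂, ∑ j₁, ∑ j₂, if ({i₁, i₂, j₁, j₂} : Finset ι).card = 4 then
        G (z i₁) (z j₁) * G (z i₂) (z j₂) else 0) ∂(Measure.pi fun _ : ι => μ)
      ≤ N ^ 4 * ∫ x, kernelMean μ G x ^ 2 ∂μ := by
  have hb : ∀ i₁ i₂ j₁ j₂ : ι, BddMeas fun z : ι → E =>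
      if ({i₁, i₂, j₁, j₂} : Finset ι).card = 4 then G (z i₁) (z j₁) * G (z i₂) (z j₂) else 0 :=
    fun i₁ i₂ j₁ j₂ => by
      split_ifs
      · exact (hG.bddMeas.eval₂ i₁ j₁).mul (hG.bddMeas.eval₂ i₂ j₂)
      · exact .const 0
  have h0 : 0 ≤ ∫ x, kernelMean μ G x ^ 2 ∂μ := integral_nonneg fun x => sq_nonneg _
  have bg := hG.bddMeas.kernelMean μ
  rw [BddMeas.integral_sum fun i _ => .sum fun j _ => .sum fun k _ => .sum fun l _ => hb i j k l]
  refine (Finset.sum_le_card_nsmul _ _ (N ^ 3 * ∫ x, kernelMean μ G x ^ 2 ∂μ)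
    fun i _ => ?_).trans (le_of_eq (by simp [hN]; ring))
  rw [BddMeas.integral_sum fun j _ => .sum fun k _ => .sum fun l _ => hb i j k l]
  refine (Finset.sum_le_card_nsmul _ _ (N ^ 2 * ∫ x, kernelMean μ G x ^ 2 ∂μ)
    fun j _ => ?_).trans (le_of_eq (by simp [hN]; ring))
  rw [BddMeas.integral_sum fun k _ => .sum fun l _ => hb i j k l]
  refine (Finset.sum_le_card_nsmul _ _ (N * ∫ x, kernelMean μ G x ^ 2 ∂μ)
    fun k _ => ?_).trans (le_of_eq (by simp [hN]; ring))
  rw [BddMeas.integral_sum fun l _ => hb i j k l]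
  refine (Finset.sum_le_card_nsmul _ _ (∫ x, kernelMean μ G x ^ 2 ∂μ)
    fun l _ => ?_).trans (le_of_eq (by simp [hN]))
  split_ifs with h
  · have c3 : ∀ a b c : ι, ({a, b, c} : Finset ι).card ≠ 4 := fun a b c hh =>
      absurd (Finset.card_le_three (a := a) (b := b) (c := c)) (by omega)
    have hik : i ≠ k := by
      rintro rfl
      rw [Finset.insert_eq_self.2 (by simp)] at h
      exact c3 _ _ _ h
    have hjk : j ≠ k := by
      rintro rfl
      simp only [Finset.insert_idem] at h
      exact c3 _ _ _ h
    have hkl : k ≠ l := by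
      rintro rfl
      simp only [Finset.pair_eq_singleton] at h
      exact c3 _ _ _ h
    have hjl : j ≠ l := by
      rintro rfl
      rw [Finset.insert_eq_self.2 (by simp : j ∈ ({k, j} : Finset ι))] at h
      exact c3 _ _ _ h
    have hij : i ≠ j := by
      rintro rfl
      simp only [Finset.insert_idem] at h
      exact c3 _ _ _ h
    have hil : i ≠ l := by
      rintro rfl
      rw [Finset.insert_eq_self.2 (by simp)] at h
      exact c3 _ _ _ h
    rw [integral_pi_update μ ((hG.bddMeas.eval₂ i k).mul (hG.bddMeas.eval₂ j l)) k]
    simp_rw [Function.update_self, Function.update_of_ne hik, Function.update_of_ne hjk,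
      Function.update_of_ne hkl.symm, integral_mul_const]
    change ∫ z : ι → E, kernelMean μ G (z i) * G (z j) (z l) ∂_ ≤ _
    rw [integral_pi_update μ ((bg.eval i).mul (hG.bddMeas.eval₂ j l)) l]
    simp_rw [Function.update_self, Function.update_of_ne hil, Function.update_of_ne hjl,
      integral_const_mul]
    change ∫ z : ι → E, kernelMean μ G (z i) * kernelMean μ G (z j) ∂_ ≤ _
    rw [integral_pi_eval_pair μ (f := fun x y => kernelMean μ G x * kernelMean μ G y)
      ((bg.comp measurable_fst).mul (bg.comp measurable_snd)) hij]
    simp_rw [integral_const_mul, integral_mul_const, ← pow_two]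
    exact sq_integral_le μ bg
  · simpa using h0

end UStatistic

/-! ### The Gaussian kernel and the mean error of the variance estimate. -/

section GaussKernel

variable {d : ℕ}

theorem measurable_gaussKernel (ν : ℝ) :
    Measurable (Function.uncurry (gaussKernel (d := d) ν)) := by
  unfold gaussKernel Function.uncurry
  fun_prop

theorem isUnitKernel_gaussKernel {ν : ℝ} (hν : 0 ≤ ν) : IsUnitKernel (gaussKernel (d := d) ν) where
  measurable := measurable_gaussKernel ν
  symm x y := by rw [gaussKernel, gaussKernel, norm_sub_rev]
  nonneg x y := Real.exp_nonneg _
  le_one x y := Real.exp_le_one_iff.2 (by nlinarith [mul_nonneg hν (sq_nonneg ‖x - y‖)])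

theorem gaussKernel_two_mul (ν : ℝ) (x y : EuclideanSpace ℝ (Fin d)) :
    gaussKernel (2 * ν) x y = gaussKernel ν x y ^ 2 := by
  rw [gaussKernel, gaussKernel, ← Real.exp_nat_mul]
  congr 1
  push_cast
  ring

/-- Compares the count `N ^ 3` used for the triples with their exact number; 16 is a convenient
bound, also valid for the quadruples below. -/
theorem two_mul_factorial_div_mul_le {N : ℕ} (hN : 4 ≤ N) :
    2 * ((N - 3).factorial : ℝ) / (N.factorial : ℝ) * (N : ℝ) ^ 3 ≤ 16 := by
  obtain ⟨k, rfl⟩ := Nat.exists_eq_add_of_le hN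
  have h : (4 + k).factorial = (4 + k) * ((3 + k) * ((2 + k) * (1 + k).factorial)) := by
    rw [show 4 + k = (1 + k) + 1 + 1 + 1 by ring, Nat.factorial_succ, Nat.factorial_succ,
      Nat.factorial_succ]
    ring
  have h3 : 4 + k - 3 = 1 + k := by omega
  have hf : (0 : ℝ) < ((1 + k).factorial : ℝ) := by exact_mod_cast Nat.factorial_pos _
  rw [h, h3]
  push_cast
  have hk : (0 : ℝ) ≤ (k : ℝ) := Nat.cast_nonneg k
  rw [div_mul_eq_mul_div, div_le_iff₀ (by positivity)]
  have : (4 + (k : ℝ)) ^ 2 ≤ 8 * ((3 + k) * (2 + k)) := by nlinarith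
  have := mul_le_mul_of_nonneg_left this
    (by positivity : 0 ≤ 2 * ((1 + k).factorial : ℝ) * (4 + (k : ℝ)))
  nlinarith

theorem factorial_div_mul_le {N : ℕ} (hN : 4 ≤ N) :
    ((N - 4).factorial : ℝ) / (N.factorial : ℝ) * (N : ℝ) ^ 4 ≤ 16 := by
  obtain ⟨k, rfl⟩ := Nat.exists_eq_add_of_le hN
  have h : (4 + k).factorial = (4 + k) * ((3 + k) * ((2 + k) * ((1 + k) * k.factorial))) := by
    rw [show 4 + k = k + 1 + 1 + 1 + 1 by ring, Nat.factorial_succ, Nat.factorial_succ,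
      Nat.factorial_succ, Nat.factorial_succ]
    ring
  have h3 : 4 + k - 4 = k := by omega
  have hf : (0 : ℝ) < (k.factorial : ℝ) := by exact_mod_cast Nat.factorial_pos _
  rw [h, h3]
  push_cast
  have hk : (0 : ℝ) ≤ (k : ℝ) := Nat.cast_nonneg k
  rw [div_mul_eq_mul_div, div_le_iff₀ (by positivity)]
  have h1 : (4 + (k : ℝ)) ^ 3 ≤ 16 * ((3 + k) * ((2 + k) * (1 + k))) := by
    nlinarith [mul_nonneg hk hk, mul_nonneg (mul_nonneg hk hk) hk]
  have := mul_le_mul_of_nonneg_left h1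
    (by positivity : 0 ≤ (k.factorial : ℝ) * (4 + (k : ℝ)))
  nlinarith

variable (μ : Measure (EuclideanSpace ℝ (Fin d))) [IsProbabilityMeasure μ]

theorem bddMeas_varTilde {ν : ℝ} (hν : 0 ≤ ν) (N : ℕ) :
    BddMeas (fun z : Fin N → EuclideanSpace ℝ (Fin d) => varTilde ν z) := by
  have hG := (isUnitKernel_gaussKernel (d := d) hν).bddMeas
  have hG2 := (isUnitKernel_gaussKernel (d := d) (by positivity : 0 ≤ 2 * ν)).bddMeas
  have b : ∀ (p : Prop) [Decidable p] {f : (Fin N → EuclideanSpace ℝ (Fin d)) → ℝ}, BddMeas f →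
      BddMeas fun z => if p then f z else 0 := fun p _ f hf => by
    split_ifs
    · exact hf
    · exact .const 0
  unfold varTilde
  refine (BddMeas.sub (.const_mul _ (.sum fun i _ => .sum fun j _ => b _ (hG2.eval₂ i j)))
    (.const_mul _ (.sum fun i _ => .sum fun j _ => .sum fun k _ => b _
      ((hG.eval₂ i j).mul (hG.eval₂ i k))))).add
    (.const_mul _ (.sum fun i _ => .sum fun j _ => .sum fun k _ => .sum fun l _ => b _
      ((hG.eval₂ i k).mul (hG.eval₂ j l))))

/-- The variance estimate is close in mean to `E[G_ν(Z, Z')²]`. -/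
theorem integral_abs_varTilde_sub_le {ν : ℝ} (hν : 0 ≤ ν) {N : ℕ} (hN : 4 ≤ N) {θ σ : ℝ}
    (hθ : ∀ x, kernelMean μ (gaussKernel ν) x ≤ θ)
    (hσ : σ = ∫ x, ∫ y, gaussKernel ν x y ^ 2 ∂μ ∂μ) {η : ℝ} (hη : 0 < η) :
    ∫ z : Fin N → EuclideanSpace ℝ (Fin d), |varTilde ν z - σ| ∂(Measure.pi fun _ => μ)
      ≤ (η + (4 / (N * (N - 1)) * σ + 8 / N * (θ * σ)) / η) / 2
        + 32 * ∫ x, kernelMean μ (gaussKernel ν) x ^ 2 ∂μ := by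
  have hG := isUnitKernel_gaussKernel (d := d) hν
  have hG2 := isUnitKernel_gaussKernel (d := d) (by positivity : 0 ≤ 2 * ν)
  have hN1 : (1 : ℝ) < N := by exact_mod_cast (by omega : 1 < N)
  have hN0 : (0 : ℝ) < (N : ℝ) - 1 := by linarith
  have hg0 : 0 ≤ ∫ x, kernelMean μ (gaussKernel ν) x ^ 2 ∂μ :=
    integral_nonneg fun x => sq_nonneg _
  have hσ2 : ∫ x, kernelMean μ (gaussKernel (2 * ν)) x ∂μ = σ := by
    simp only [kernelMean, gaussKernel_two_mul, hσ]
  have hθ2 : ∀ x, kernelMean μ (gaussKernel (2 * ν)) x ≤ θ := fun x => by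
    refine le_trans ?_ (hθ x)
    refine (hG2.bddMeas.curry x).integral_mono (hG.bddMeas.curry x) fun y => ?_
    rw [gaussKernel_two_mul]
    exact hG.sq_le x y
  have b : ∀ (p : Prop) [Decidable p] {f : (Fin N → EuclideanSpace ℝ (Fin d)) → ℝ}, BddMeas f →
      BddMeas fun z => if p then f z else 0 := fun p _ f hf => by
    split_ifs
    · exact hf
    · exact .const 0
  set U₁ : (Fin N → EuclideanSpace ℝ (Fin d)) → ℝ := fun z => 1 / ((N : ℝ) * ((N : ℝ) - 1)) *
      (∑ i, ∑ j, if i ≠ j then gaussKernel (2 * ν) (z i) (z j) else 0) with hU₁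
  set U₂ : (Fin N → EuclideanSpace ℝ (Fin d)) → ℝ := fun z =>
      ∑ i, ∑ j₁, ∑ j₂, if ({i, j₁, j₂} : Finset (Fin N)).card = 3 then
        gaussKernel ν (z i) (z j₁) * gaussKernel ν (z i) (z j₂) else 0 with hU₂
  set U₃ : (Fin N → EuclideanSpace ℝ (Fin d)) → ℝ := fun z =>
      ∑ i₁, ∑ i₂, ∑ j₁, ∑ j₂, if ({i₁, i₂, j₁, j₂} : Finset (Fin N)).card = 4 then
        gaussKernel ν (z i₁) (z j₁) * gaussKernel ν (z i₂) (z j₂) else 0 with hU₃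
  have b1 : BddMeas U₁ := .const_mul _ (.sum fun i _ => .sum fun j _ => b _ (hG2.bddMeas.eval₂ i j))
  have b2 : BddMeas U₂ := .sum fun i _ => .sum fun j _ => .sum fun k _ => b _
      ((hG.bddMeas.eval₂ i j).mul (hG.bddMeas.eval₂ i k))
  have b3 : BddMeas U₃ := .sum fun i _ => .sum fun j _ => .sum fun k _ => .sum fun l _ => b _
      ((hG.bddMeas.eval₂ i k).mul (hG.bddMeas.eval₂ j l))
  have n2 : ∀ z, 0 ≤ U₂ z := fun z => Finset.sum_nonneg fun i _ => Finset.sum_nonneg fun j _ =>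
    Finset.sum_nonneg fun k _ => by
      split_ifs
      · exact mul_nonneg (hG.nonneg _ _) (hG.nonneg _ _)
      · exact le_rfl
  have n3 : ∀ z, 0 ≤ U₃ z := fun z => Finset.sum_nonneg fun i _ => Finset.sum_nonneg fun j _ =>
    Finset.sum_nonneg fun k _ => Finset.sum_nonneg fun l _ => by
      split_ifs
      · exact mul_nonneg (hG.nonneg _ _) (hG.nonneg _ _)
      · exact le_rfl
  set k₂ : ℝ := 2 * ((N - 3).factorial : ℝ) / (N.factorial : ℝ)
  set k₃ : ℝ := ((N - 4).factorial : ℝ) / (N.factorial : ℝ)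
  have hk2 : 0 ≤ k₂ := by positivity
  have hk3 : 0 ≤ k₃ := by positivity
  -- The two corrections are nonnegative and negligible in mean, so no cancellation between them is
  -- needed.
  have pt : ∀ z : Fin N → EuclideanSpace ℝ (Fin d),
      |varTilde ν z - σ| ≤ |U₁ z - σ| + k₂ * U₂ z + k₃ * U₃ z := fun z => by
    have e : varTilde ν z - σ = (U₁ z - σ) - k₂ * U₂ z + k₃ * U₃ z := by
      simp only [varTilde, hU₁, hU₂, hU₃]
      ring
    rw [e]
    have h2 := mul_nonneg hk2 (n2 z)
    have h3 := mul_nonneg hk3 (n3 z)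
    have := abs_le.1 (le_refl |U₁ z - σ|)
    rw [abs_le]
    constructor <;> linarith [this.1, this.2]
  have m1 : ∫ z, |U₁ z - σ| ∂(Measure.pi fun _ => μ)
      ≤ (η + (4 / (N * (N - 1)) * σ + 8 / N * (θ * σ)) / η) / 2 := by
    refine (integral_abs_le_add_div _ (b1.sub (.const σ)) hη).trans ?_
    have h := hG2.integral_uStat_sub_sq_le μ (ι := Fin N) hθ2 (N := N) (by simp) hN1
    rw [hσ2] at h
    have h' : ∫ x, ∫ y, gaussKernel (2 * ν) x y ^ 2 ∂μ ∂μ ≤ σ := by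
      rw [← hσ2]
      refine (BddMeas.integral_right (F := fun x y => gaussKernel (2 * ν) x y ^ 2)
        (hG2.bddMeas.pow 2) μ).integral_mono (hG2.bddMeas.kernelMean μ) fun x => ?_
      exact ((hG2.bddMeas.curry x).pow 2).integral_mono (hG2.bddMeas.curry x) (hG2.sq_le x)
    gcongr
    refine h.trans ?_
    gcongr
  have m2 : k₂ * ∫ z, U₂ z ∂(Measure.pi fun _ => μ)
      ≤ 16 * ∫ x, kernelMean μ (gaussKernel ν) x ^ 2 ∂μ := by
    refine (mul_le_mul_of_nonneg_left (hG.integral_sum_pairs_sharing_le μ (ι := Fin N) (N := N)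
      (by simp)) hk2).trans ?_
    rw [← mul_assoc]
    exact mul_le_mul_of_nonneg_right (two_mul_factorial_div_mul_le hN) hg0
  have m3 : k₃ * ∫ z, U₃ z ∂(Measure.pi fun _ => μ)
      ≤ 16 * ∫ x, kernelMean μ (gaussKernel ν) x ^ 2 ∂μ := by
    refine (mul_le_mul_of_nonneg_left (hG.integral_sum_disjoint_pairs_le μ (ι := Fin N) (N := N)
      (by simp)) hk3).trans ?_
    rw [← mul_assoc]
    exact mul_le_mul_of_nonneg_right (factorial_div_mul_le hN) hg0
  have c1 := (b1.sub (.const σ)).abs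
  refine (((bddMeas_varTilde hν N).sub (.const σ)).abs.integral_mono
    ((c1.add (b2.const_mul k₂)).add (b3.const_mul k₃)) pt).trans ?_
  rw [(c1.add (b2.const_mul k₂)).integral_add (b3.const_mul k₃), c1.integral_add (b2.const_mul k₂),
    integral_const_mul, integral_const_mul]
  linarith

end GaussKernel

/-! ### The two-sample statistic as a weighted quadratic form of the pooled sample. -/

section Weights

/-- The weights of the pooled sample in the two-sample statistic. -/
noncomputable def mmdWeight (n m : ℕ) (a b : Fin (n + m)) : ℝ :=
  if a = b then 0
  else if (a : ℕ) < n then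
    if (b : ℕ) < n then 1 / ((n : ℝ) * ((n : ℝ) - 1)) else -(1 / ((m : ℝ) * (n : ℝ)))
  else if (b : ℕ) < n then -(1 / ((m : ℝ) * (n : ℝ))) else 1 / ((m : ℝ) * ((m : ℝ) - 1))

variable {n m : ℕ}

theorem mmdWeight_comm (a b : Fin (n + m)) : mmdWeight n m a b = mmdWeight n m b a := by
  unfold mmdWeight
  by_cases h : a = b
  · simp [h]
  · simp only [h, Ne.symm h, if_false]
    split_ifs <;> rfl

theorem mmdWeight_self (a : Fin (n + m)) : mmdWeight n m a a = 0 := by simp [mmdWeight]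

theorem mmdWeight_castAdd_castAdd (i j : Fin n) :
    mmdWeight n m (Fin.castAdd m i) (Fin.castAdd m j)
      = if i ≠ j then 1 / ((n : ℝ) * ((n : ℝ) - 1)) else 0 := by
  by_cases h : i = j <;> simp [mmdWeight, h]

theorem mmdWeight_natAdd_natAdd (i j : Fin m) :
    mmdWeight n m (Fin.natAdd n i) (Fin.natAdd n j)
      = if i ≠ j then 1 / ((m : ℝ) * ((m : ℝ) - 1)) else 0 := by
  by_cases h : i = j <;> simp [mmdWeight, h]

theorem mmdWeight_castAdd_natAdd (i : Fin n) (j : Fin m) :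
    mmdWeight n m (Fin.castAdd m i) (Fin.natAdd n j) = -(1 / ((m : ℝ) * (n : ℝ))) := by
  have : Fin.castAdd m i ≠ Fin.natAdd n j := fun h => by
    have := congrArg Fin.val h
    simp at this
    omega
  simp [mmdWeight, this]

theorem mmdWeight_natAdd_castAdd (i : Fin m) (j : Fin n) :
    mmdWeight n m (Fin.natAdd n i) (Fin.castAdd m j) = -(1 / ((m : ℝ) * (n : ℝ))) := by
  rw [mmdWeight_comm, mmdWeight_castAdd_natAdd]

theorem sum_if_ne_const {k : ℕ} (i : Fin k) (r : ℝ) :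
    (∑ j : Fin k, if i ≠ j then r else 0) = ((k : ℝ) - 1) * r := by
  have : ∀ j : Fin k, (if i ≠ j then r else 0) = r - if i = j then r else 0 := fun j => by
    by_cases h : i = j <;> simp [h]
  simp_rw [this, Finset.sum_sub_distrib]
  simp
  ring

/-- The weight within the own sample balances that of the other one; this is what permits centring
the kernel. -/
theorem sum_mmdWeight (hn : 2 ≤ n) (hm : 2 ≤ m) (a : Fin (n + m)) :
    ∑ b, mmdWeight n m a b = 0 := by
  have hn' : (2 : ℝ) ≤ n := by exact_mod_cast hn
  have hm' : (2 : ℝ) ≤ m := by exact_mod_cast hm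
  have hn1 : (n : ℝ) - 1 ≠ 0 := by linarith
  have hm1 : (m : ℝ) - 1 ≠ 0 := by linarith
  rw [Fin.sum_univ_add]
  induction a using Fin.addCases with
  | left i =>
    simp_rw [mmdWeight_castAdd_castAdd, mmdWeight_castAdd_natAdd, sum_if_ne_const]
    simp
    field_simp
    ring
  | right i =>
    simp_rw [mmdWeight_natAdd_castAdd, mmdWeight_natAdd_natAdd, sum_if_ne_const]
    simp
    field_simp
    ring

theorem sum_mmdWeight_sq (hn : 2 ≤ n) (hm : 2 ≤ m) :
    ∑ a, ∑ b, mmdWeight n m a b ^ 2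
      = 1 / ((n : ℝ) * (n - 1)) + 1 / ((m : ℝ) * (m - 1)) + 2 / ((m : ℝ) * n) := by
  have hn' : (2 : ℝ) ≤ n := by exact_mod_cast hn
  have hm' : (2 : ℝ) ≤ m := by exact_mod_cast hm
  have hn1 : (n : ℝ) - 1 ≠ 0 := by linarith
  have hm1 : (m : ℝ) - 1 ≠ 0 := by linarith
  simp_rw [Fin.sum_univ_add, mmdWeight_castAdd_castAdd, mmdWeight_castAdd_natAdd,
    mmdWeight_natAdd_castAdd, mmdWeight_natAdd_natAdd, ite_pow, zero_pow two_ne_zero,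
    sum_if_ne_const]
  simp
  field_simp
  ring

theorem abs_mmdWeight_le (hn : 2 ≤ n) (hm : 2 ≤ m) {c : ℝ} (hc : 0 < c) (hmn : c * n ≤ m)
    (a b : Fin (n + m)) : |mmdWeight n m a b| ≤ (2 + 2 / c ^ 2 + 1 / c) / (n : ℝ) ^ 2 := by
  have hn' : (2 : ℝ) ≤ n := by exact_mod_cast hn
  have hm' : (2 : ℝ) ≤ m := by exact_mod_cast hm
  have e : (2 + 2 / c ^ 2 + 1 / c) / (n : ℝ) ^ 2
      = 2 / (n : ℝ) ^ 2 + 2 / (c * n) ^ 2 + 1 / (c * n * n) := by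
    field_simp
  have h1 : 1 / ((n : ℝ) * ((n : ℝ) - 1)) ≤ 2 / (n : ℝ) ^ 2 := by
    rw [div_le_div_iff₀ (by nlinarith) (by positivity)]
    nlinarith
  have h2 : 1 / ((m : ℝ) * ((m : ℝ) - 1)) ≤ 2 / (c * n) ^ 2 := by
    calc 1 / ((m : ℝ) * ((m : ℝ) - 1)) ≤ 2 / (m : ℝ) ^ 2 := by
          rw [div_le_div_iff₀ (by nlinarith) (by positivity)]
          nlinarith
      _ ≤ _ := by gcongr
  have h3 : 1 / ((m : ℝ) * (n : ℝ)) ≤ 1 / (c * n * n) := by gcongr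
  have p1 : 0 ≤ 1 / ((n : ℝ) * ((n : ℝ) - 1)) := one_div_nonneg.2 (by nlinarith)
  have p2 : 0 ≤ 1 / ((m : ℝ) * ((m : ℝ) - 1)) := one_div_nonneg.2 (by nlinarith)
  have p3 : 0 ≤ 1 / ((m : ℝ) * (n : ℝ)) := by positivity
  rw [e]
  unfold mmdWeight
  split_ifs <;> simp only [abs_zero, abs_neg, abs_of_nonneg p1, abs_of_nonneg p2, abs_of_nonneg p3]
    <;> linarith

/-- The cross term is spread over both orders of a mixed pair, hence its weight `1/(mn)` in place of
`2/(mn)`. -/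
theorem mmdSqHat_eq_sum {d : ℕ} {ν : ℝ} (hν : 0 ≤ ν) (z : Fin (n + m) → EuclideanSpace ℝ (Fin d)) :
    mmdSqHat ν (fun i => z (Fin.castAdd m i)) (fun j => z (Fin.natAdd n j))
      = ∑ a, ∑ b, mmdWeight n m a b * gaussKernel ν (z a) (z b) := by
  have hs := (isUnitKernel_gaussKernel (d := d) hν).symm
  simp_rw [Fin.sum_univ_add, mmdWeight_castAdd_castAdd, mmdWeight_castAdd_natAdd,
    mmdWeight_natAdd_castAdd, mmdWeight_natAdd_natAdd, Finset.sum_add_distrib, ite_mul, zero_mul,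
    neg_mul, Finset.sum_neg_distrib, ← Finset.mul_sum]
  have e : ∑ i : Fin m, ∑ j : Fin n, gaussKernel ν (z (Fin.natAdd n i)) (z (Fin.castAdd m j))
      = ∑ i : Fin n, ∑ j : Fin m, gaussKernel ν (z (Fin.castAdd m i)) (z (Fin.natAdd n j)) := by
    rw [Finset.sum_comm]
    simp_rw [hs (z (Fin.natAdd n _))]
  rw [e]
  have e1 : ∀ (k : ℕ) (r : ℝ) (F : Fin k → Fin k → ℝ), ∑ i, ∑ j, (if i ≠ j then r * F i j else 0)
      = r * ∑ i, ∑ j, if i ≠ j then F i j else 0 := fun k r F => by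
    simp_rw [Finset.mul_sum, mul_ite, mul_zero]
  rw [e1, e1, mmdSqHat]
  ring

/-- Zero row and column sums annihilate every part of the kernel that depends on one variable only.
This is pure algebra, valid for any `μ`; the null hypothesis matters afterwards, when both samples
have the law `μ` for which the centred kernel is degenerate. -/
theorem mmdSqHat_eq_sum_centered {d : ℕ} {ν : ℝ} (hν : 0 ≤ ν)
    (μ : Measure (EuclideanSpace ℝ (Fin d))) (hn : 2 ≤ n) (hm : 2 ≤ m)
    (z : Fin (n + m) → EuclideanSpace ℝ (Fin d)) :
    mmdSqHat ν (fun i => z (Fin.castAdd m i)) (fun j => z (Fin.natAdd n j))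
      = ∑ a, ∑ b, mmdWeight n m a b * centered μ (gaussKernel ν) (z a) (z b) := by
  rw [mmdSqHat_eq_sum hν]
  set G := gaussKernel (d := d) ν
  set I := ∫ u, kernelMean μ G u ∂μ
  have e : ∀ a b, mmdWeight n m a b * G (z a) (z b)
      = mmdWeight n m a b * centered μ G (z a) (z b) + mmdWeight n m a b * kernelMean μ G (z b)
        + mmdWeight n m a b * (kernelMean μ G (z a) - I) := fun a b => by
    simp only [centered]
    ring
  simp_rw [e, Finset.sum_add_distrib, ← Finset.sum_mul, sum_mmdWeight hn hm]
  rw [Finset.sum_comm (f := fun a b => mmdWeight n m a b * kernelMean μ G (z b))]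
  have h0 : ∀ b, ∑ a, mmdWeight n m a b = 0 := fun b => by
    rw [← sum_mmdWeight hn hm b]
    exact Finset.sum_congr rfl fun a _ => mmdWeight_comm a b
  simp_rw [← Finset.sum_mul, h0]
  simp

end Weights

/-! ### Studentisation at fixed sample sizes. -/

/-- Supplies the free parameters of the quantitative bounds, which contain both `η` and `e / η`. The
summand `1/(n+1)` keeps the witness positive where `e` vanishes. -/
theorem exists_pos_tendsto_div {e : ℕ → ℝ} (he0 : ∀ n, 0 ≤ e n) (he : Tendsto e atTop (𝓝 0)) :
    ∃ η : ℕ → ℝ, (∀ n, 0 < η n) ∧ Tendsto η atTop (𝓝 0) ∧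
      Tendsto (fun n => e n / η n) atTop (𝓝 0) := by
  have h1 : Tendsto (fun n => √(e n)) atTop (𝓝 0) := by
    simpa using! (Real.continuous_sqrt.tendsto 0).comp he
  have h2 : Tendsto (fun n : ℕ => 1 / ((n : ℝ) + 1)) atTop (𝓝 0) :=
    tendsto_one_div_add_atTop_nhds_zero_nat
  refine ⟨fun n => √(e n) + 1 / ((n : ℝ) + 1), fun n => by positivity, by simpa using h1.add h2,
    squeeze_zero (fun n => div_nonneg (he0 n) (by positivity)) (fun n => ?_) h1⟩
  rw [div_le_iff₀ (by positivity)]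
  have h3 : √(e n) * √(e n) = e n := Real.mul_self_sqrt (he0 n)
  have h4 : 0 ≤ √(e n) * (1 / ((n : ℝ) + 1)) := by positivity
  rw [mul_add]
  linarith

theorem abs_inv_sqrt_sub_one_le {u δ : ℝ} (hδ : δ ≤ 1 / 2) (hu : |u - 1| ≤ δ) :
    |(√u)⁻¹ - 1| ≤ 2 * δ := by
  obtain ⟨h1, h2⟩ := abs_le.1 hu
  have hu0 : 1 / 2 ≤ u := by linarith
  have hs : √u * √u = u := Real.mul_self_sqrt (by linarith)
  have hs0 : 1 / 2 ≤ √u := Real.le_sqrt_of_sq_le (by linarith)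
  have hp : 0 < √u := by linarith
  have e : (√u)⁻¹ - 1 = (1 - u) / (√u * (1 + √u)) := by
    field_simp
    nlinarith
  rw [e, abs_div, abs_of_pos (by positivity : 0 < √u * (1 + √u)), div_le_iff₀ (by positivity),
    abs_sub_comm]
  have : 1 ≤ 2 * (√u * (1 + √u)) := by nlinarith
  have hδ0 : 0 ≤ δ := (abs_nonneg _).trans hu
  nlinarith

/-- Effect of a random rescaling close to one on the characteristic function. -/
theorem norm_cexp_mul_inv_sqrt_sub_le (t S u : ℝ) {δ : ℝ} (hδ0 : 0 < δ) (hδ : δ ≤ 1 / 2) :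
    ‖Complex.exp (t * (S * (√u)⁻¹ : ℝ) * Complex.I) - Complex.exp (t * S * Complex.I)‖
      ≤ 2 / δ * |u - 1| + 2 * |t| * δ * |S| := by
  have n1 : ∀ r : ℝ, ‖Complex.exp (t * r * Complex.I)‖ = 1 := fun r => by
    rw [← Complex.ofReal_mul, Complex.norm_exp_ofReal_mul_I]
  -- Near one the exponential is Lipschitz in the rescaling. Away from one the trivial bound 2 is at
  -- most `2 |u - 1| / δ`, a pointwise Markov inequality that keeps the estimate linear in `|u -
  -- 1|`.
  by_cases hu : |u - 1| ≤ δ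
  · have h1 := abs_inv_sqrt_sub_one_le hδ hu
    have e : Complex.exp (t * (S * (√u)⁻¹ : ℝ) * Complex.I)
        = Complex.exp (t * S * Complex.I)
          * Complex.exp (Complex.I * (t * S * ((√u)⁻¹ - 1) : ℝ)) := by
      rw [← Complex.exp_add]
      congr 1
      push_cast
      ring
    have e2 : Complex.exp (t * (S * (√u)⁻¹ : ℝ) * Complex.I) - Complex.exp (t * S * Complex.I)
        = Complex.exp (t * S * Complex.I)
          * (Complex.exp (Complex.I * (t * S * ((√u)⁻¹ - 1) : ℝ)) - 1) := by
      rw [e]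
      ring
    rw [e2, norm_mul, n1, one_mul]
    refine Real.norm_exp_I_mul_ofReal_sub_one_le.trans ?_
    rw [Real.norm_eq_abs, abs_mul, abs_mul]
    have h2 : |t| * |S| * |(√u)⁻¹ - 1| ≤ |t| * |S| * (2 * δ) := by gcongr
    have h3 : 0 ≤ 2 / δ * |u - 1| := by positivity
    linarith
  · push Not at hu
    have h1 : 2 ≤ 2 / δ * |u - 1| := by
      rw [div_mul_eq_mul_div, le_div_iff₀ hδ0]
      linarith
    have h2 : 0 ≤ 2 * |t| * δ * |S| := by positivity
    have h3 := norm_sub_le (Complex.exp (t * (S * (√u)⁻¹ : ℝ) * Complex.I))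
      (Complex.exp (t * S * Complex.I))
    rw [n1, n1] at h3
    linarith

section FixedSample

variable {d n m : ℕ} (μ : Measure (EuclideanSpace ℝ (Fin d))) [IsProbabilityMeasure μ]

/-- The coefficients of the normalized two-sample statistic as a quadratic form. -/
noncomputable def homCoeff (n m : ℕ) (σ : ℝ) (a b : Fin (n + m)) : ℝ :=
  √2 * ((n : ℝ) * m / ((n : ℝ) + m)) / √σ * mmdWeight n m a b

/-- The statistic `homStat` evaluated at a pooled sample. -/
noncomputable def pooledStat (ν : ℝ) (z : Fin (n + m) → EuclideanSpace ℝ (Fin d)) : ℝ :=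
  homStat ν (fun i => z (Fin.castAdd m i)) (fun j => z (Fin.natAdd n j))

theorem append_split (z : Fin (n + m) → EuclideanSpace ℝ (Fin d)) :
    Fin.append (fun i => z (Fin.castAdd m i)) (fun j => z (Fin.natAdd n j)) = z := by
  funext a
  induction a using Fin.addCases <;> simp

omit [IsProbabilityMeasure μ] in
-- Separates the deterministic normalisation by `σ` from the random ratio of variances. The factor
-- `√2` in `homCoeff`, against `1/√2` in `homStat`, offsets the `1 / 2` in `quadForm`.
theorem pooledStat_eq {ν : ℝ} (hν : 0 ≤ ν) (hn : 2 ≤ n) (hm : 2 ≤ m) {σ : ℝ} (hσ : 0 < σ)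
    (z : Fin (n + m) → EuclideanSpace ℝ (Fin d)) :
    pooledStat ν z = quadForm (homCoeff n m σ) (centered μ (gaussKernel ν)) z
      * (√(max (varTilde ν z) (1 / (n : ℝ) ^ 2) / σ))⁻¹ := by
  have h2 : √2 * √2 = (2 : ℝ) := Real.mul_self_sqrt (by norm_num)
  have hs : 0 < √σ := Real.sqrt_pos.2 hσ
  rw [pooledStat, homStat, varHat, append_split, mmdSqHat_eq_sum_centered hν μ hn hm, quadForm,
    Real.sqrt_div' _ hσ.le]
  set W := ∑ a, ∑ b, mmdWeight n m a b * centered μ (gaussKernel ν) (z a) (z b) with hW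
  have e : ∑ a, ∑ b, homCoeff n m σ a b * centered μ (gaussKernel ν) (z a) (z b)
      = √2 * ((n : ℝ) * m / ((n : ℝ) + m)) / √σ * W := by
    simp_rw [hW, Finset.mul_sum, homCoeff, mul_assoc]
  rw [e]
  have hV : 0 < √(max (varTilde ν z) (1 / (n : ℝ) ^ 2)) := by
    refine Real.sqrt_pos.2 (lt_max_of_lt_right ?_)
    have : (0 : ℝ) < n := by exact_mod_cast (by omega : 0 < n)
    positivity
  have hn0 : (0 : ℝ) < n := by exact_mod_cast (by omega : 0 < n)
  have hs2 : 0 < √(2 : ℝ) := Real.sqrt_pos.2 (by norm_num)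
  field_simp
  rw [Real.sq_sqrt (by norm_num)]
  ring

theorem homCoeff_comm (σ : ℝ) (a b : Fin (n + m)) : homCoeff n m σ a b = homCoeff n m σ b a := by
  rw [homCoeff, homCoeff, mmdWeight_comm]

theorem homCoeff_self (σ : ℝ) (a : Fin (n + m)) : homCoeff n m σ a a = 0 := by
  rw [homCoeff, mmdWeight_self, mul_zero]

theorem abs_homCoeff_le (hn : 2 ≤ n) (hm : 2 ≤ m) {c : ℝ} (hc : 0 < c) (hmn : c * n ≤ m) {σ : ℝ}
    (hσ : 0 < σ) (a b : Fin (n + m)) :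
    |homCoeff n m σ a b| ≤ √2 * (2 + 2 / c ^ 2 + 1 / c) / (√σ * n) := by
  have hn0 : (0 : ℝ) < n := by exact_mod_cast (by omega : 0 < n)
  have hm0 : (0 : ℝ) < m := by exact_mod_cast (by omega : 0 < m)
  have hs : 0 < √σ := Real.sqrt_pos.2 hσ
  have h1 : (n : ℝ) * m / ((n : ℝ) + m) ≤ n := by
    rw [div_le_iff₀ (by positivity)]
    nlinarith
  rw [homCoeff, abs_mul, abs_of_nonneg (by positivity :
    0 ≤ √2 * ((n : ℝ) * m / ((n : ℝ) + m)) / √σ)]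
  calc _ ≤ √2 * n / √σ * ((2 + 2 / c ^ 2 + 1 / c) / (n : ℝ) ^ 2) := by
        gcongr
        exact abs_mmdWeight_le hn hm hc hmn a b
    _ = _ := by field_simp

/-- With `n`, `m` in place of `n - 1`, `m - 1` the squared weights would sum to `(1/n + 1/m)²`,
which the prefactor `nm/(n+m)` cancels; the remaining terms record the difference. -/
theorem sum_homCoeff_sq (hn : 2 ≤ n) (hm : 2 ≤ m) {σ : ℝ} (hσ : 0 < σ) :
    (1 / 2) * ∑ a, ∑ b, homCoeff n m σ a b ^ 2
      = (1 + ((m : ℝ) ^ 2 / ((n : ℝ) + m) ^ 2 * (1 / ((n : ℝ) - 1))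
        + (n : ℝ) ^ 2 / ((n : ℝ) + m) ^ 2 * (1 / ((m : ℝ) - 1)))) / σ := by
  have hn' : (2 : ℝ) ≤ n := by exact_mod_cast hn
  have hm' : (2 : ℝ) ≤ m := by exact_mod_cast hm
  have hn1 : (n : ℝ) - 1 ≠ 0 := by linarith
  have hm1 : (m : ℝ) - 1 ≠ 0 := by linarith
  have hnm : (n : ℝ) + m ≠ 0 := by linarith
  simp_rw [homCoeff, mul_pow, ← Finset.mul_sum]
  rw [sum_mmdWeight_sq hn hm, div_pow, mul_pow, Real.sq_sqrt (by norm_num), Real.sq_sqrt hσ.le]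
  field_simp
  ring

theorem measurable_pooledStat {ν : ℝ} (hν : 0 ≤ ν) :
    Measurable fun z : Fin (n + m) → EuclideanSpace ℝ (Fin d) => pooledStat ν z := by
  have hG := (isUnitKernel_gaussKernel (d := d) hν).bddMeas
  have hmmd : Measurable fun z : Fin (n + m) → EuclideanSpace ℝ (Fin d) =>
      mmdSqHat ν (fun i => z (Fin.castAdd m i)) (fun j => z (Fin.natAdd n j)) := by
    simp_rw [mmdSqHat_eq_sum hν]
    exact (BddMeas.sum fun i _ => .sum fun j _ => (hG.eval₂ i j).const_mul _).1
  unfold pooledStat homStat varHat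
  simp_rw [append_split]
  exact (measurable_const.mul
    ((bddMeas_varTilde hν (n + m)).1.max measurable_const).sqrt.inv).mul hmmd

/-- Bound for the distance of the characteristic function of the studentized statistic to the one
of the normalized quadratic form. -/
theorem norm_charFun_pooledStat_sub_le {ν : ℝ} (hν : 0 ≤ ν) (hn : 2 ≤ n) (hm : 2 ≤ m) {σ : ℝ}
    (hσ : 0 < σ) (hσn : 1 / (n : ℝ) ^ 2 ≤ σ) {τ ρ : ℝ}
    (hτ : τ = (1 / 2) * (∑ a, ∑ b, homCoeff n m σ a b ^ 2)
      * ∫ x, ∫ y, centered μ (gaussKernel ν) x y ^ 2 ∂μ ∂μ)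
    (hρ : (∫ z : Fin (n + m) → EuclideanSpace ℝ (Fin d), |varTilde ν z - σ|
      ∂(Measure.pi fun _ => μ)) / σ ≤ ρ) {δ : ℝ} (hδ0 : 0 < δ) (hδ : δ ≤ 1 / 2) (t : ℝ) :
    ‖∫ z : Fin (n + m) → EuclideanSpace ℝ (Fin d), Complex.exp (t * pooledStat ν z * Complex.I)
        ∂(Measure.pi fun _ => μ)
      - ∫ z, Complex.exp (t * quadForm (homCoeff n m σ) (centered μ (gaussKernel ν)) z
        * Complex.I) ∂(Measure.pi fun _ => μ)‖ ≤ 2 * (ρ / δ) + |t| * δ * (1 + τ) := by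
  have hG := isUnitKernel_gaussKernel (d := d) hν
  have hD := hG.isDegenerate_centered μ
  set S : (Fin (n + m) → EuclideanSpace ℝ (Fin d)) → ℝ :=
    quadForm (homCoeff n m σ) (centered μ (gaussKernel ν)) with hS
  have bS : BddMeas S := hD.bddMeas.quadForm
  set u : (Fin (n + m) → EuclideanSpace ℝ (Fin d)) → ℝ := fun z =>
    max (varTilde ν z) (1 / (n : ℝ) ^ 2) / σ with hu
  have bV := bddMeas_varTilde (d := d) hν (n + m)
  have hS2 : ∫ z, S z ^ 2 ∂(Measure.pi fun _ => μ) = τ := by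
    simp only [hS, quadForm, mul_pow]
    rw [integral_const_mul, integral_quadratic_sq μ hD.bddMeas hD.symm hD.integral_eq_zero
      (homCoeff_comm σ) (homCoeff_self σ), hτ]
    ring
  have hS1 : ∫ z, |S z| ∂(Measure.pi fun _ => μ) ≤ (1 + τ) / 2 := by
    have := integral_abs_le_add_div (Measure.pi fun _ => μ) bS one_pos
    rwa [hS2, div_one] at this
  have hint : ∀ F : (Fin (n + m) → EuclideanSpace ℝ (Fin d)) → ℝ, Measurable F →
      Integrable (fun z => Complex.exp (t * F z * Complex.I)) (Measure.pi fun _ => μ) :=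
    fun F hF => by
      refine Integrable.of_bound (C := 1) ?_ (ae_of_all _ fun z => ?_)
      · exact (Complex.measurable_exp.comp (((Complex.measurable_ofReal.comp hF).const_mul
          (t : ℂ)).mul_const Complex.I)).aestronglyMeasurable
      · rw [← Complex.ofReal_mul, Complex.norm_exp_ofReal_mul_I]
  have pt : ∀ z, ‖Complex.exp (t * pooledStat ν z * Complex.I) - Complex.exp (t * S z * Complex.I)‖
      ≤ 2 / (δ * σ) * |varTilde ν z - σ| + 2 * |t| * δ * |S z| := fun z => by
    rw [pooledStat_eq μ hν hn hm hσ]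
    refine (norm_cexp_mul_inv_sqrt_sub_le t (S z) (u z) hδ0 hδ).trans (add_le_add ?_ le_rfl)
    have h1 : |u z - 1| ≤ |varTilde ν z - σ| / σ := by
      have e : u z - 1 = (max (varTilde ν z) (1 / (n : ℝ) ^ 2) - σ) / σ := by
        simp only [hu]
        field_simp
      rw [e, abs_div, abs_of_pos hσ]
      gcongr ?_ / σ
      -- As `1/n² ≤ σ`, the truncation can only bring the estimate closer to `σ`.
      rcases max_cases (varTilde ν z) (1 / (n : ℝ) ^ 2) with ⟨h, h'⟩ | ⟨h, h'⟩
      · rw [h]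
      · rw [h, abs_of_nonpos (by linarith), abs_of_nonpos (by linarith)]
        linarith
    calc 2 / δ * |u z - 1| ≤ 2 / δ * (|varTilde ν z - σ| / σ) := by gcongr
      _ = _ := by field_simp
  rw [← integral_sub (hint _ (measurable_pooledStat hν)) (hint _ bS.1)]
  have b1 := (bV.sub (.const σ)).abs.const_mul (2 / (δ * σ))
  have b2 := bS.abs.const_mul (2 * |t| * δ)
  refine (norm_integral_le_of_norm_le ((b1.add b2).integrable _) (ae_of_all _ pt)).trans ?_
  rw [b1.integral_add b2, integral_const_mul, integral_const_mul]
  refine add_le_add ?_ ?_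
  · calc _ = 2 / δ * ((∫ z : Fin (n + m) → EuclideanSpace ℝ (Fin d), |varTilde ν z - σ|
          ∂(Measure.pi fun _ => μ)) / σ) := by field_simp
      _ ≤ 2 / δ * ρ := by gcongr
      _ = _ := by ring
  · calc _ ≤ 2 * |t| * δ * ((1 + τ) / 2) := by gcongr
      _ = _ := by ring

end FixedSample

/-! ### The limit theorem under four conditions on the kernels. -/

/-- Convergence of the characteristic functions of the studentized statistic under conditions on
the second moment `σ`, the maximal mean `θ` and the squared operator norm `Λ` of the kernels. -/
theorem tendsto_charFun_pooledStat {d : ℕ} (μ : Measure (EuclideanSpace ℝ (Fin d)))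
    [IsProbabilityMeasure μ] (m : ℕ → ℕ) {c C : ℝ} (hc : 0 < c)
    (hm : ∀ n : ℕ, 1 ≤ n → c ≤ (m n : ℝ) / (n : ℝ) ∧ (m n : ℝ) / (n : ℝ) ≤ C)
    (ν : ℕ → ℝ) (hν : ∀ n, 0 < ν n) {σ θ Λ : ℕ → ℝ}
    (hσ : ∀ n, σ n = ∫ x, ∫ y, gaussKernel (ν n) x y ^ 2 ∂μ ∂μ) (hσ0 : ∀ n, 0 < σ n)
    (hθ : ∀ n x, kernelMean μ (gaussKernel (ν n)) x ≤ θ n) (hΛ0 : ∀ n, 0 ≤ Λ n)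
    (hΛ : ∀ n, ∀ f : EuclideanSpace ℝ (Fin d) → ℝ, BddMeas f →
      ∫ x, (∫ y, gaussKernel (ν n) x y * f y ∂μ) ^ 2 ∂μ ≤ Λ n * ∫ y, f y ^ 2 ∂μ)
    (h1 : Tendsto (fun n : ℕ => 1 / ((n : ℝ) ^ 2 * σ n)) atTop (𝓝 0))
    (h2 : Tendsto (fun n : ℕ => θ n / (n * σ n)) atTop (𝓝 0))
    (h3 : Tendsto (fun n => (∫ x, kernelMean μ (gaussKernel (ν n)) x ^ 2 ∂μ) / σ n) atTop (𝓝 0))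
    (h4 : Tendsto (fun n => Λ n / σ n) atTop (𝓝 0)) (t : ℝ) :
    Tendsto (fun n : ℕ => ∫ z : Fin (n + m n) → EuclideanSpace ℝ (Fin d),
      Complex.exp (t * pooledStat (ν n) z * Complex.I) ∂(Measure.pi fun _ => μ)) atTop
      (𝓝 (Complex.exp (-(t : ℂ) ^ 2 / 2))) := by
  have hG := fun n => isUnitKernel_gaussKernel (d := d) (hν n).le
  have hD := fun n => (hG n).isDegenerate_centered μ
  have hθ0 : ∀ n, 0 ≤ θ n := fun n => ((hG n).kernelMean_nonneg μ 0).trans (hθ n 0)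
  have hmc : ∀ n : ℕ, 1 ≤ n → c * n ≤ m n := fun n hn =>
    (le_div_iff₀ (by exact_mod_cast hn)).1 (hm n hn).1
  have hmC : ∀ n : ℕ, 1 ≤ n → (m n : ℝ) ≤ C * n := fun n hn =>
    (div_le_iff₀ (by exact_mod_cast hn)).1 (hm n hn).2
  have hC : 0 < C := hc.trans_le ((hm 1 le_rfl).1.trans (hm 1 le_rfl).2)
  have hm_top : Tendsto (fun n => (m n : ℝ)) atTop atTop :=
    tendsto_atTop_mono' _ (eventually_atTop.2 ⟨1, hmc⟩)
      (tendsto_natCast_atTop_atTop.const_mul_atTop hc)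
  have hm2 : ∀ᶠ n in atTop, 2 ≤ m n := by
    filter_upwards [hm_top.eventually_ge_atTop 2] with n hn
    exact_mod_cast hn
  set K : ℝ := √2 * (2 + 2 / c ^ 2 + 1 / c) with hK
  set L : ℝ := 1 + C with hL
  have hL0 : 0 < L := by positivity
  have hK0 : 0 < K := by positivity
  set g2 : ℕ → ℝ := fun n => ∫ x, kernelMean μ (gaussKernel (ν n)) x ^ 2 ∂μ with hg2
  have hg20 : ∀ n, 0 ≤ g2 n := fun n => integral_nonneg fun x => sq_nonneg _
  set τ : ℕ → ℝ := fun n => (1 / 2) * (∑ a, ∑ b, homCoeff n (m n) (σ n) a b ^ 2)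
      * ∫ x, ∫ y, centered μ (gaussKernel (ν n)) x y ^ 2 ∂μ ∂μ with hτ
  -- `τ` is the variance of the normalised form: it is squeezed using that centring costs at most `2
  -- g2 / σ` and that the weights contribute `1 + O(1/n + 1/m)`.
  have hτ1 : Tendsto τ atTop (𝓝 1) := by
    have l1 : Tendsto (fun n => 1 - 2 * (g2 n / σ n)) atTop (𝓝 1) := by
      simpa using (h3.const_mul 2).const_sub 1
    have a1 : Tendsto (fun n : ℕ => 1 / ((n : ℝ) - 1)) atTop (𝓝 0) := by
      simpa only [one_div] using! (tendsto_atTop_add_const_right atTop (-1)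
        tendsto_natCast_atTop_atTop).inv_tendsto_atTop
    have a2 : Tendsto (fun n : ℕ => 1 / ((m n : ℝ) - 1)) atTop (𝓝 0) := by
      simpa only [one_div] using! (tendsto_atTop_add_const_right atTop (-1)
        hm_top).inv_tendsto_atTop
    have l2 : Tendsto (fun n : ℕ => 1 + (1 / ((n : ℝ) - 1) + 1 / ((m n : ℝ) - 1))) atTop
        (𝓝 1) := by
      simpa using (a1.add a2).const_add 1
    have hev : ∀ᶠ n in atTop, 1 - 2 * (g2 n / σ n) ≤ τ n ∧
        τ n ≤ 1 + (1 / ((n : ℝ) - 1) + 1 / ((m n : ℝ) - 1)) := by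
      filter_upwards [eventually_ge_atTop 2, hm2] with n hn hmn
      have hn' : (2 : ℝ) ≤ n := by exact_mod_cast hn
      have hm' : (2 : ℝ) ≤ m n := by exact_mod_cast hmn
      have u1 := (hG n).integral_centered_sq_le_integral_sq μ
      have u2 := (hG n).le_integral_centered_sq μ
      rw [← hσ n] at u1 u2
      set q := ∫ x, ∫ y, centered μ (gaussKernel (ν n)) x y ^ 2 ∂μ ∂μ
      have q0 : 0 ≤ q := integral_nonneg fun x => integral_nonneg fun y => sq_nonneg _
      have q1 : q / σ n ≤ 1 := (div_le_one (hσ0 n)).2 u1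
      have q2 : 1 - 2 * (g2 n / σ n) ≤ q / σ n := by
        have e : 1 - 2 * (g2 n / σ n) = (σ n - 2 * g2 n) / σ n := by
          rw [sub_div, div_self (hσ0 n).ne', mul_div_assoc]
        rw [e]
        exact div_le_div_of_nonneg_right u2 (hσ0 n).le
      have q3 : 0 ≤ q / σ n := div_nonneg q0 (hσ0 n).le
      set ε := (m n : ℝ) ^ 2 / ((n : ℝ) + m n) ^ 2 * (1 / ((n : ℝ) - 1))
        + (n : ℝ) ^ 2 / ((n : ℝ) + m n) ^ 2 * (1 / ((m n : ℝ) - 1)) with hε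
      have p1 : 0 ≤ 1 / ((n : ℝ) - 1) := one_div_nonneg.2 (by linarith)
      have p2 : 0 ≤ 1 / ((m n : ℝ) - 1) := one_div_nonneg.2 (by linarith)
      have ε0 : 0 ≤ ε := by positivity
      have ε1 : ε ≤ 1 / ((n : ℝ) - 1) + 1 / ((m n : ℝ) - 1) := by
        refine add_le_add (mul_le_of_le_one_left p1 ?_) (mul_le_of_le_one_left p2 ?_)
        · exact div_le_one_of_le₀ (by gcongr; linarith) (sq_nonneg _)
        · exact div_le_one_of_le₀ (by gcongr; linarith) (sq_nonneg _)
      have e : τ n = (1 + ε) * (q / σ n) := by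
        simp only [hτ]
        rw [sum_homCoeff_sq hn hmn (hσ0 n)]
        ring
      rw [e]
      constructor <;> nlinarith
    exact tendsto_of_tendsto_of_tendsto_of_le_of_le' l1 l2 (hev.mono fun n h => h.1)
      (hev.mono fun n h => h.2)
  -- The pooled size is at most `L n` and the coefficients at most `K / (√σ n)`, so `κ⁴ = K⁴ / (σ²
  -- n⁴)`. Kernel moments bounded by multiples of `θσ`, `Λσ` and `σ` then become `θ/(nσ)`, `Λ/σ` and
  -- `1/(n²σ)`.
  set A : ℕ → ℝ := fun n => L ^ 3 * K ^ 4 * (θ n / (n * σ n)) + L ^ 4 * K ^ 4 * (Λ n / σ n) with hA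
  set B : ℕ → ℝ := fun n => 4 * L ^ 2 * K ^ 4 * (1 / ((n : ℝ) ^ 2 * σ n))
    + 6 * L ^ 3 * K ^ 4 * (θ n / (n * σ n)) with hB
  have n1 : ∀ n : ℕ, 0 ≤ 1 / ((n : ℝ) ^ 2 * σ n) := fun n => by have := hσ0 n; positivity
  have n2 : ∀ n : ℕ, 0 ≤ θ n / (n * σ n) := fun n => by
    have := hσ0 n; have := hθ0 n; positivity
  have n4 : ∀ n : ℕ, 0 ≤ Λ n / σ n := fun n => div_nonneg (hΛ0 n) (hσ0 n).le
  have hA0 : ∀ n, 0 ≤ A n := fun n => by have := n2 n; have := n4 n; positivity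
  have hB0 : ∀ n, 0 ≤ B n := fun n => by have := n1 n; have := n2 n; positivity
  have hAt : Tendsto A atTop (𝓝 0) := by
    simpa only [mul_zero, add_zero] using!
      (h2.const_mul (L ^ 3 * K ^ 4)).add (h4.const_mul (L ^ 4 * K ^ 4))
  have hBt : Tendsto B atTop (𝓝 0) := by
    simpa only [mul_zero, add_zero] using!
      (h1.const_mul (4 * L ^ 2 * K ^ 4)).add (h2.const_mul (6 * L ^ 3 * K ^ 4))
  set e : ℕ → ℝ := fun n => A n + B n with he
  obtain ⟨η, hη0, hηt, hηe⟩ := exists_pos_tendsto_div (e := e)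
    (fun n => add_nonneg (hA0 n) (hB0 n)) (by simpa using hAt.add hBt)
  have hquad : ∀ᶠ n : ℕ in atTop,
      ‖∫ z, Complex.exp (t * quadForm (homCoeff n (m n) (σ n)) (centered μ (gaussKernel (ν n))) z
          * Complex.I) ∂(Measure.pi fun _ => μ) - Complex.exp (-(t : ℂ) ^ 2 / 2)‖
        ≤ 2 * (|t| * (|t| * (|τ n - 1| + (η n + e n / η n) / 2)
          + t ^ 2 * (2 * τ n * η n + e n / η n))) := by
    filter_upwards [eventually_ge_atTop 2, hm2] with n hn hmn
    have hn0 : (0 : ℝ) < n := by exact_mod_cast (by omega : 0 < n)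
    have hN : ((Fintype.card (Fin (n + m n)) : ℕ) : ℝ) ≤ L * n := by
      rw [Fintype.card_fin]
      push_cast
      have := hmC n (by omega)
      rw [hL]
      linarith
    have hq := (hG n).integral_integral_centered_sq_sq_le μ (hθ n)
    have hr := (hG n).integral_kernelComp_centered_sq_le μ (hΛ0 n) (hΛ n)
    have hh := (hG n).integral_centered_pow_four_le μ
    rw [← hσ n] at hq hr hh
    have hs := hσ0 n
    have hκ4 : (K / (√(σ n) * n)) ^ 4 = K ^ 4 / (σ n ^ 2 * n ^ 4) := by
      rw [div_pow, mul_pow (√(σ n))]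
      have : √(σ n) ^ 4 = (√(σ n) ^ 2) ^ 2 := by ring
      rw [this, Real.sq_sqrt hs.le]
    have hθn := hθ0 n
    have hΛn := hΛ0 n
    have qn : 0 ≤ ∫ x, (∫ y, centered μ (gaussKernel (ν n)) x y ^ 2 ∂μ) ^ 2 ∂μ :=
      integral_nonneg fun x => sq_nonneg _
    have rn : 0 ≤ ∫ x, ∫ y, kernelComp μ (centered μ (gaussKernel (ν n))) x y ^ 2 ∂μ ∂μ :=
      integral_nonneg fun x => integral_nonneg fun y => sq_nonneg _
    have hn4 : 0 ≤ ∫ x, ∫ y, centered μ (gaussKernel (ν n)) x y ^ 4 ∂μ ∂μ :=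
      integral_nonneg fun x => integral_nonneg fun y => by positivity
    refine norm_charFun_quadForm_sub_le μ (homCoeff_comm _) (homCoeff_self _) (hD n)
      (κ := K / (√(σ n) * n)) (abs_homCoeff_le hn hmn hc (hmc n (by omega)) hs) rfl ?_ ?_ (hη0 n) t
    · rw [hκ4]
      calc _ ≤ 1 / 2 * (L * n) ^ 3 * (K ^ 4 / (σ n ^ 2 * n ^ 4)) * (2 * θ n * σ n)
            + (L * n) ^ 4 * (K ^ 4 / (σ n ^ 2 * n ^ 4)) * (Λ n * σ n) := by gcongr
        _ = A n := by
          simp only [hA]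
          field_simp
        _ ≤ e n := le_add_of_nonneg_right (hB0 n)
    · rw [hκ4]
      calc _ ≤ (L * n) ^ 2 * (K ^ 4 / (σ n ^ 2 * n ^ 4)) * (4 * σ n)
            + 3 * (L * n) ^ 3 * (K ^ 4 / (σ n ^ 2 * n ^ 4)) * (2 * θ n * σ n) := by gcongr
        _ = B n := by
          simp only [hB]
          field_simp
          ring
        _ ≤ e n := le_add_of_nonneg_left (hA0 n)
  set e' : ℕ → ℝ := fun n => 4 * (1 / ((n : ℝ) ^ 2 * σ n)) + 8 * (θ n / (n * σ n)) with he'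
  have he't : Tendsto e' atTop (𝓝 0) := by
    simpa only [mul_zero, add_zero] using! (h1.const_mul 4).add (h2.const_mul 8)
  obtain ⟨ξ, hξ0, hξt, hξe⟩ := exists_pos_tendsto_div (e := e')
    (fun n => by have := n1 n; have := n2 n; positivity) he't
  set ρ : ℕ → ℝ := fun n => (ξ n + e' n / ξ n) / 2 + 32 * (g2 n / σ n) with hρ
  have hρ0 : ∀ n, 0 ≤ ρ n := fun n => by
    have := n1 n
    have := n2 n
    have := hξ0 n
    have := hσ0 n
    have := hg20 n
    positivity
  have hρt : Tendsto ρ atTop (𝓝 0) := by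
    simpa only [mul_zero, add_zero, zero_div] using!
      ((hξt.add hξe).div_const 2).add (h3.const_mul 32)
  obtain ⟨δ, hδ0, hδt, hδρ⟩ := exists_pos_tendsto_div hρ0 hρt
  have hvar : ∀ᶠ n : ℕ in atTop,
      ‖∫ z : Fin (n + m n) → EuclideanSpace ℝ (Fin d),
          Complex.exp (t * pooledStat (ν n) z * Complex.I) ∂(Measure.pi fun _ => μ)
        - ∫ z, Complex.exp (t * quadForm (homCoeff n (m n) (σ n))
          (centered μ (gaussKernel (ν n))) z * Complex.I) ∂(Measure.pi fun _ => μ)‖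
        ≤ 2 * (ρ n / δ n) + |t| * δ n * (1 + τ n) := by
    filter_upwards [eventually_ge_atTop 2, hm2, hδt.eventually_le_const (by norm_num : (0 : ℝ) < 1 / 2),
      h1.eventually_le_const one_pos] with n hn hmn hδn h1n
    have hs := hσ0 n
    have hn0 : (0 : ℝ) < n := by exact_mod_cast (by omega : 0 < n)
    have hσn : 1 / (n : ℝ) ^ 2 ≤ σ n := by
      rw [div_le_iff₀ (by positivity)]
      rw [div_le_one (by positivity)] at h1n
      linarith
    refine norm_charFun_pooledStat_sub_le μ (hν n).le hn hmn hs hσn rfl ?_ (hδ0 n) hδn t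
    rw [div_le_iff₀ hs]
    have hξn := hξ0 n
    -- Scaling the free parameter by `σ n` makes the error bound relative to `σ n`.
    refine (integral_abs_varTilde_sub_le μ (hν n).le (N := n + m n) (by omega) (hθ n) (hσ n)
      (η := σ n * ξ n) (by positivity)).trans ?_
    have hθn := hθ0 n
    have c1 : (n : ℝ) ≤ ((n + m n : ℕ) : ℝ) := by exact_mod_cast Nat.le_add_right _ _
    have c2 : (n : ℝ) ≤ ((n + m n : ℕ) : ℝ) - 1 := by
      push_cast
      have : (2 : ℝ) ≤ m n := by exact_mod_cast hmn
      linarith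
    calc _ ≤ (σ n * ξ n + (4 / (n * n) * σ n + 8 / n * (θ n * σ n)) / (σ n * ξ n)) / 2
          + 32 * g2 n := by gcongr
      _ = ρ n * σ n := by
        simp only [hρ, he']
        field_simp
  have lim : Tendsto (fun n => (2 * (ρ n / δ n) + |t| * δ n * (1 + τ n))
      + 2 * (|t| * (|t| * (|τ n - 1| + (η n + e n / η n) / 2)
          + t ^ 2 * (2 * τ n * η n + e n / η n)))) atTop (𝓝 0) := by
    have l1 : Tendsto (fun n => |τ n - 1|) atTop (𝓝 0) := by
      simpa using (hτ1.sub_const 1).abs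
    have l2 := (hδρ.const_mul 2).add ((hδt.const_mul |t|).mul (hτ1.const_add 1))
    have l3 := ((((l1.add ((hηt.add hηe).div_const 2)).const_mul |t|).add
      ((((hτ1.const_mul 2).mul hηt).add hηe).const_mul (t ^ 2))).const_mul |t|).const_mul 2
    have := l2.add l3
    simpa only [mul_zero, zero_mul, add_zero, zero_div] using! this
  rw [tendsto_iff_norm_sub_tendsto_zero]
  refine squeeze_zero' (Eventually.of_forall fun n => norm_nonneg _) ?_ lim
  filter_upwards [hquad, hvar] with n a1 a2
  exact (norm_sub_le_norm_sub_add_norm_sub _ _ _).trans (add_le_add a2 a1)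

/-! ### Gaussian integral operators for a square integrable density. -/

/-- The Cauchy–Schwarz inequality for bounded measurable functions. -/
theorem sq_integral_mul_le {α : Type*} [MeasurableSpace α] (μ : Measure α) [IsProbabilityMeasure μ]
    {f g : α → ℝ} (hf : BddMeas f) (hg : BddMeas g) :
    (∫ x, f x * g x ∂μ) ^ 2 ≤ (∫ x, f x ^ 2 ∂μ) * ∫ x, g x ^ 2 ∂μ := by
  have h : ∀ t : ℝ, 0 ≤ (∫ x, f x ^ 2 ∂μ) * (t * t) + (2 * ∫ x, f x * g x ∂μ) * t
      + ∫ x, g x ^ 2 ∂μ := fun t => by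
    have b1 := (hf.pow 2).const_mul (t * t)
    have b2 := (hf.mul hg).const_mul (2 * t)
    have e : ∫ x, (t * f x + g x) ^ 2 ∂μ = (∫ x, f x ^ 2 ∂μ) * (t * t)
        + (2 * ∫ x, f x * g x ∂μ) * t + ∫ x, g x ^ 2 ∂μ := by
      have : ∀ x, (t * f x + g x) ^ 2 = t * t * f x ^ 2 + 2 * t * (f x * g x) + g x ^ 2 :=
        fun x => by ring
      simp_rw [this]
      rw [(b1.add b2).integral_add (hg.pow 2), b1.integral_add b2, integral_const_mul,
        integral_const_mul]
      ring
    rw [← e]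
    exact integral_nonneg fun x => sq_nonneg _
  have := discrim_le_zero h
  rw [discrim] at this
  nlinarith

/-- The weighted Cauchy–Schwarz inequality for bounded measurable functions. -/
theorem sq_integral_weight_mul_le {α : Type*} [MeasurableSpace α] (μ : Measure α)
    [IsProbabilityMeasure μ] {k f : α → ℝ} (hk : BddMeas k) (hk0 : ∀ x, 0 ≤ k x) (hf : BddMeas f) :
    (∫ x, k x * f x ∂μ) ^ 2 ≤ (∫ x, k x ∂μ) * ∫ x, k x * f x ^ 2 ∂μ := by
  have hs := hk.continuous_comp Real.continuous_sqrt
  have h := sq_integral_mul_le μ hs (hs.mul hf)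
  have e : ∀ x, √(k x) ^ 2 = k x := fun x => Real.sq_sqrt (hk0 x)
  simp_rw [mul_pow, ← mul_assoc, e, ← pow_two, e] at h
  exact h

section Gaussian

variable {d : ℕ}

/-- The total mass `(π / ν)^(d/2)` of the Gaussian `exp (-ν ‖x‖²)`. -/
noncomputable def gaussMass (d : ℕ) (ν : ℝ) : ℝ := (Real.pi / ν) ^ ((d : ℝ) / 2)

theorem gaussMass_pos {ν : ℝ} (hν : 0 < ν) : 0 < gaussMass d ν :=
  Real.rpow_pos_of_pos (div_pos Real.pi_pos hν) _

theorem integrable_gaussKernel {ν : ℝ} (hν : 0 < ν) (y : EuclideanSpace ℝ (Fin d)) :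
    Integrable (fun x => gaussKernel ν x y) := by
  have h : Integrable fun v : EuclideanSpace ℝ (Fin d) => Real.exp (-ν * ‖v‖ ^ 2) := by
    -- A non-integrable function has integral 0 by convention, whereas the known value is positive.
    by_contra hn
    have := GaussianFourier.integral_rexp_neg_mul_sq_norm (V := EuclideanSpace ℝ (Fin d)) hν
    rw [integral_undef hn] at this
    exact (Real.rpow_pos_of_pos (div_pos Real.pi_pos hν) _).ne this
  exact h.comp_sub_right y

theorem integral_gaussKernel {ν : ℝ} (hν : 0 < ν) (y : EuclideanSpace ℝ (Fin d)) :
    ∫ x, gaussKernel ν x y = gaussMass d ν := by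
  unfold gaussKernel
  rw [integral_sub_right_eq_self (fun v : EuclideanSpace ℝ (Fin d) => Real.exp (-ν * ‖v‖ ^ 2)) y,
    GaussianFourier.integral_rexp_neg_mul_sq_norm hν]
  simp [gaussMass]

theorem integrable_gaussKernel_right {ν : ℝ} (hν : 0 < ν) (x : EuclideanSpace ℝ (Fin d)) :
    Integrable (fun y => gaussKernel ν x y) := by
  simpa only [(isUnitKernel_gaussKernel hν.le).symm x] using integrable_gaussKernel hν x

theorem integral_gaussKernel_right {ν : ℝ} (hν : 0 < ν) (x : EuclideanSpace ℝ (Fin d)) :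
    ∫ y, gaussKernel ν x y = gaussMass d ν := by
  simpa only [(isUnitKernel_gaussKernel hν.le).symm x] using integral_gaussKernel hν x

theorem integrable_gaussKernel_mul {ν : ℝ} (hν : 0 ≤ ν) {u : EuclideanSpace ℝ (Fin d) → ℝ}
    (hu : Integrable u) (x : EuclideanSpace ℝ (Fin d)) :
    Integrable fun y => gaussKernel ν x y * u y := by
  have hG := isUnitKernel_gaussKernel (d := d) hν
  refine hu.mono ((hG.bddMeas.curry x).1.aestronglyMeasurable.mul hu.1) (ae_of_all _ fun y => ?_)
  rw [norm_mul, Real.norm_eq_abs, abs_of_nonneg (hG.nonneg x y)]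
  exact mul_le_of_le_one_left (norm_nonneg _) (hG.le_one x y)

theorem integrable_prod_gaussKernel_mul {ν : ℝ} (hν : 0 < ν) {w : EuclideanSpace ℝ (Fin d) → ℝ}
    (hw : Measurable w) (hi : Integrable w) :
    Integrable (Function.uncurry fun x y => gaussKernel ν x y * w y)
      ((volume : Measure (EuclideanSpace ℝ (Fin d))).prod volume) := by
  have hG := isUnitKernel_gaussKernel (d := d) hν.le
  refine (integrable_prod_iff' ((hG.measurable.mul
    (hw.comp measurable_snd)).aestronglyMeasurable)).2 ⟨ae_of_all _ fun y => ?_, ?_⟩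
  · exact (integrable_gaussKernel hν y).mul_const (w y)
  · have e : ∀ y, ∫ x, ‖Function.uncurry (fun x y => gaussKernel ν x y * w y) (x, y)‖
        = gaussMass d ν * |w y| := fun y => by
      have e' : ∀ x, ‖Function.uncurry (fun x y => gaussKernel ν x y * w y) (x, y)‖
          = gaussKernel ν x y * |w y| := fun x => by
        rw [Function.uncurry_apply_pair, norm_mul, Real.norm_eq_abs, Real.norm_eq_abs,
          abs_of_nonneg (hG.nonneg x y)]
      simp_rw [e']
      rw [integral_mul_const, integral_gaussKernel hν]
    exact (hi.abs.const_mul _).congr (ae_of_all _ fun y => (e y).symm)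

/-- Schur-type bound for the Gaussian bilinear form on square integrable functions. -/
theorem integral_mul_integral_gaussKernel_mul_le {ν : ℝ} (hν : 0 < ν)
    {u v : EuclideanSpace ℝ (Fin d) → ℝ} (hu0 : ∀ x, 0 ≤ u x)
    (hu2 : Integrable fun x => u x ^ 2) (hv : Measurable v) (hv0 : ∀ x, 0 ≤ v x)
    (hvi : Integrable v) (hv2 : Integrable fun x => v x ^ 2) {η : ℝ} (hη : 0 < η) :
    ∫ x, u x * ∫ y, gaussKernel ν x y * v y
      ≤ gaussMass d ν * ((η * (∫ x, u x ^ 2) + (∫ x, v x ^ 2) / η) / 2) := by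
  have hG := isUnitKernel_gaussKernel (d := d) hν.le
  have hP := integrable_prod_gaussKernel_mul hν (hv.pow_const 2) hv2
  have hsw : ∫ x, ∫ y, gaussKernel ν x y * v y ^ 2 = gaussMass d ν * ∫ y, v y ^ 2 := by
    rw [integral_integral_swap hP, ← integral_const_mul]
    exact integral_congr_ae (ae_of_all _ fun y => by
      dsimp only
      rw [integral_mul_const, integral_gaussKernel hν])
  have hPi : Integrable fun x => ∫ y, gaussKernel ν x y * v y ^ 2 := hP.integral_prod_left
  have pt : ∀ x, u x * ∫ y, gaussKernel ν x y * v y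
      ≤ gaussMass d ν * η / 2 * u x ^ 2 + 1 / (2 * η) * ∫ y, gaussKernel ν x y * v y ^ 2 := by
    intro x
    rw [← integral_const_mul, ← integral_const_mul (1 / (2 * η))]
    have i1 : Integrable fun y => gaussKernel ν x y * (η / 2 * u x ^ 2) :=
      (integrable_gaussKernel_right hν x).mul_const _
    have i2 : Integrable fun y => 1 / (2 * η) * (gaussKernel ν x y * v y ^ 2) :=
      (integrable_gaussKernel_mul hν.le hv2 x).const_mul _
    have e : gaussMass d ν * η / 2 * u x ^ 2 = ∫ y, gaussKernel ν x y * (η / 2 * u x ^ 2) := by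
      rw [integral_mul_const, integral_gaussKernel_right hν]
      ring
    rw [e, ← integral_add i1 i2]
    refine integral_mono ((integrable_gaussKernel_mul hν.le hvi x).const_mul (u x)) (i1.add i2)
      fun y => ?_
    have h1 : u x * v y ≤ η / 2 * u x ^ 2 + 1 / (2 * η) * v y ^ 2 := by
      have : η / 2 * u x ^ 2 + 1 / (2 * η) * v y ^ 2 - u x * v y
          = 1 / (2 * η) * (η * u x - v y) ^ 2 := by
        field_simp
        ring
      have : 0 ≤ 1 / (2 * η) * (η * u x - v y) ^ 2 := by positivity
      linarith
    have := mul_le_mul_of_nonneg_left h1 (hG.nonneg x y)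
    dsimp only
    linarith
  have j1 := hu2.const_mul (gaussMass d ν * η / 2)
  have j2 := hPi.const_mul (1 / (2 * η))
  refine (integral_mono_of_nonneg (ae_of_all _ fun x => mul_nonneg (hu0 x)
    (integral_nonneg fun y => mul_nonneg (hG.nonneg x y) (hv0 y))) (j1.add j2)
    (ae_of_all _ pt)).trans (le_of_eq ?_)
  simp only [Pi.add_apply]
  rw [integral_add j1 j2, integral_const_mul, integral_const_mul, hsw]
  field_simp

/-- A measurable, everywhere nonnegative density. -/
structure IsNiceDensity (r : EuclideanSpace ℝ (Fin d) → ℝ) : Prop where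
  measurable : Measurable r
  nonneg : ∀ x, 0 ≤ r x
  integrable : Integrable r
  integral_eq_one : ∫ x, r x = 1

/-- Almost everywhere continuity is not preserved under changes on null sets. Hence `p` is kept next
to its version `r`: the former for continuity, the latter for pointwise sign and measurability. -/
theorem IsProbDensity.exists_isNiceDensity {p : EuclideanSpace ℝ (Fin d) → ℝ}
    (hp : IsProbDensity p) :
    ∃ r, IsNiceDensity r ∧ r =ᵐ[volume] p ∧ densityMeasure p = densityMeasure r := by
  set q := hp.integrable.1.mk p
  have hq : p =ᵐ[volume] q := hp.integrable.1.ae_eq_mk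
  have hr : (fun x => max (q x) 0) =ᵐ[volume] p := by
    filter_upwards [hq, hp.nonneg] with x h1 h2
    rw [← h1, max_eq_left h2]
  refine ⟨fun x => max (q x) 0, ⟨?_, fun x => le_max_right _ _, hp.integrable.congr hr.symm, ?_⟩,
    hr, ?_⟩
  · exact hp.integrable.1.stronglyMeasurable_mk.measurable.max measurable_const
  · rw [integral_congr_ae hr, hp.integral_eq_one]
  · exact withDensity_congr_ae (hr.mono fun x h => by simp only; rw [← h])

variable {r : EuclideanSpace ℝ (Fin d) → ℝ} (hr : IsNiceDensity r)

include hr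

theorem IsNiceDensity.isProbabilityMeasure : IsProbabilityMeasure (densityMeasure r) := by
  refine ⟨?_⟩
  rw [densityMeasure, withDensity_apply _ MeasurableSet.univ, Measure.restrict_univ,
    ← ofReal_integral_eq_lintegral_ofReal hr.integrable (ae_of_all _ hr.nonneg),
    hr.integral_eq_one, ENNReal.ofReal_one]

theorem IsNiceDensity.integral_densityMeasure (f : EuclideanSpace ℝ (Fin d) → ℝ) :
    ∫ x, f x ∂(densityMeasure r) = ∫ x, r x * f x := by
  rw [densityMeasure, integral_withDensity_eq_integral_toReal_smul hr.measurable.ennreal_ofReal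
    (ae_of_all _ fun x => ENNReal.ofReal_lt_top)]
  simp only [ENNReal.toReal_ofReal (hr.nonneg _), smul_eq_mul]

variable (hr2 : Integrable fun x => r x ^ 2)

include hr2

/-- Cauchy–Schwarz in `L²` of Lebesgue measure, written additively with weight `√k`: the square of
the kernel is `G_{2ν}`, of mass `k`. This gives order `ν^(-d/4)` without any boundedness of the
density. -/
theorem IsNiceDensity.kernelMean_gaussKernel_le {ν : ℝ} (hν : 0 < ν)
    (x : EuclideanSpace ℝ (Fin d)) :
    kernelMean (densityMeasure r) (gaussKernel ν) x
      ≤ √(gaussMass d (2 * ν)) * ((1 + ∫ x, r x ^ 2) / 2) := by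
  have hG := isUnitKernel_gaussKernel (d := d) hν.le
  have hν2 : 0 < 2 * ν := by positivity
  set k := gaussMass d (2 * ν) with hk
  have hk0 : 0 < k := gaussMass_pos hν2
  have hs : 0 < √k := Real.sqrt_pos.2 hk0
  have hss : √k * √k = k := Real.mul_self_sqrt hk0.le
  rw [kernelMean, hr.integral_densityMeasure]
  have i1 : Integrable fun y => 1 / (2 * √k) * gaussKernel (2 * ν) x y :=
    (integrable_gaussKernel_right hν2 x).const_mul _
  have i2 : Integrable fun y => √k / 2 * r y ^ 2 := hr2.const_mul _
  have pt : ∀ y, r y * gaussKernel ν x y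
      ≤ 1 / (2 * √k) * gaussKernel (2 * ν) x y + √k / 2 * r y ^ 2 := fun y => by
    rw [gaussKernel_two_mul]
    have : 1 / (2 * √k) * gaussKernel ν x y ^ 2 + √k / 2 * r y ^ 2 - r y * gaussKernel ν x y
        = 1 / (2 * √k) * (gaussKernel ν x y - √k * r y) ^ 2 := by
      field_simp
      ring
    have : 0 ≤ 1 / (2 * √k) * (gaussKernel ν x y - √k * r y) ^ 2 := by positivity
    linarith
  refine (integral_mono_of_nonneg (ae_of_all _ fun y => mul_nonneg (hr.nonneg y) (hG.nonneg x y))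
    (i1.add i2) (ae_of_all _ pt)).trans (le_of_eq ?_)
  simp only [Pi.add_apply]
  rw [integral_add i1 i2, integral_const_mul, integral_const_mul, integral_gaussKernel_right hν2,
    ← hk]
  field_simp
  nlinarith

theorem IsNiceDensity.integral_kernelMean_gaussKernel_le {ν : ℝ} (hν : 0 < ν) :
    ∫ x, kernelMean (densityMeasure r) (gaussKernel ν) x ∂(densityMeasure r)
      ≤ gaussMass d ν * ∫ x, r x ^ 2 := by
  rw [hr.integral_densityMeasure]
  simp_rw [kernelMean, hr.integral_densityMeasure, mul_comm (r _) (gaussKernel ν _ _)]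
  refine (integral_mul_integral_gaussKernel_mul_le hν hr.nonneg hr2 hr.measurable hr.nonneg
    hr.integrable hr2 one_pos).trans (le_of_eq ?_)
  ring

/-- Bound for the squared norm of the Gaussian integral operator on `L²` of a density, in terms of
the part of the density above a level `B`. -/
theorem IsNiceDensity.integral_sq_integral_gaussKernel_le {ν : ℝ} (hν : 0 < ν) {B : ℝ} (hB : 0 ≤ B)
    {η : ℝ} (hη : 0 < η) {f : EuclideanSpace ℝ (Fin d) → ℝ} (hf : BddMeas f) :
    ∫ x, (∫ y, gaussKernel ν x y * f y ∂(densityMeasure r)) ^ 2 ∂(densityMeasure r)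
      ≤ (2 * (B * gaussMass d ν) ^ 2 + 2 * (gaussMass d (2 * ν) * (η * (∫ x, r x ^ 2)
          + (∫ x, {x | B < r x}.indicator (fun x => r x ^ 2) x) / η)))
        * ∫ y, f y ^ 2 ∂(densityMeasure r) := by
  have := hr.isProbabilityMeasure
  have hG := isUnitKernel_gaussKernel (d := d) hν.le
  have hν2 : 0 < 2 * ν := by positivity
  have hG2 := isUnitKernel_gaussKernel (d := d) hν2.le
  set μ := densityMeasure r with hμ
  set s : Set (EuclideanSpace ℝ (Fin d)) := {x | B < r x} with hs
  have hsm : MeasurableSet s := measurableSet_lt measurable_const hr.measurable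
  set χ : EuclideanSpace ℝ (Fin d) → ℝ := s.indicator 1 with hχ
  have hχb : BddMeas χ := ⟨measurable_one.indicator hsm, 1, fun x => by
    by_cases hx : x ∈ s <;> simp [hχ, hx]⟩
  have hχ0 : ∀ x, 0 ≤ χ x := fun x => Set.indicator_nonneg (fun _ _ => zero_le_one) x
  have hχ1 : ∀ x, χ x ≤ 1 := fun x => by by_cases hx : x ∈ s <;> simp [hχ, hx]
  -- `G1` keeps the pairs with both points in `{r ≤ B}` and is handled by Schur's test, its row
  -- integrals being at most `B` times the Gaussian mass. `G2` has a point in `{r > B}` and is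
  -- handled by its Hilbert–Schmidt norm, where `∫ r²` over that set makes the bound small.
  set G1 : EuclideanSpace ℝ (Fin d) → EuclideanSpace ℝ (Fin d) → ℝ :=
    fun x y => gaussKernel ν x y * ((1 - χ x) * (1 - χ y)) with hG1
  set G2 : EuclideanSpace ℝ (Fin d) → EuclideanSpace ℝ (Fin d) → ℝ :=
    fun x y => gaussKernel ν x y * (1 - (1 - χ x) * (1 - χ y)) with hG2'
  have bχ : BddMeas (Function.uncurry fun x y => (1 - χ x) * (1 - χ y)) :=
    ((BddMeas.const 1).sub (hχb.comp measurable_fst)).mul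
      ((BddMeas.const 1).sub (hχb.comp measurable_snd))
  have b1 : BddMeas (Function.uncurry G1) := hG.bddMeas.mul bχ
  have b2 : BddMeas (Function.uncurry G2) := hG.bddMeas.mul ((BddMeas.const 1).sub bχ)
  have hG10 : ∀ x y, 0 ≤ G1 x y := fun x y => mul_nonneg (hG.nonneg x y)
    (mul_nonneg (sub_nonneg.2 (hχ1 x)) (sub_nonneg.2 (hχ1 y)))
  have hG1s : ∀ x y, G1 x y = G1 y x := fun x y => by
    simp only [hG1, hG.symm x y]
    ring
  have hG1m : ∀ x, ∫ y, G1 x y ∂μ ≤ B * gaussMass d ν := fun x => by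
    rw [hμ, hr.integral_densityMeasure, ← integral_gaussKernel_right hν x, ← integral_const_mul]
    refine integral_mono_of_nonneg (ae_of_all _ fun y => mul_nonneg (hr.nonneg y) (hG10 x y))
      ((integrable_gaussKernel_right hν x).const_mul B) (ae_of_all _ fun y => ?_)
    have g0 := hG.nonneg x y
    by_cases hy : y ∈ s
    · simp only [hG1, hχ, Set.indicator_of_mem hy, Pi.one_apply, sub_self, mul_zero]
      positivity
    · have hy' : r y ≤ B := not_lt.1 hy
      have : G1 x y ≤ gaussKernel ν x y := by
        refine mul_le_of_le_one_right g0 ?_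
        nlinarith [hχ0 x, hχ0 y, hχ1 x, hχ1 y]
      exact mul_le_mul hy' this (hG10 x y) hB
  set W := ∫ y, f y ^ 2 ∂μ with hW
  have hW0 : 0 ≤ W := integral_nonneg fun y => sq_nonneg _
  have m1 : ∫ x, (∫ y, G1 x y * f y ∂μ) ^ 2 ∂μ ≤ (B * gaussMass d ν) ^ 2 * W := by
    have hm := gaussMass_pos (d := d) hν
    have bF : BddMeas (Function.uncurry fun x y => G1 x y * f y ^ 2) :=
      b1.mul ((hf.pow 2).comp measurable_snd)
    have e1 : ∫ x, ∫ y, G1 x y * f y ^ 2 ∂μ ∂μ ≤ B * gaussMass d ν * W := by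
      rw [integral_integral_swap (bF.integrable _), hW, ← integral_const_mul]
      refine BddMeas.integral_mono (bF.swap.integral_right μ) ((hf.pow 2).const_mul _)
        fun y => ?_
      rw [integral_mul_const]
      refine mul_le_mul_of_nonneg_right ?_ (sq_nonneg _)
      simp_rw [hG1s _ y]
      exact hG1m y
    calc ∫ x, (∫ y, G1 x y * f y ∂μ) ^ 2 ∂μ
        ≤ ∫ x, B * gaussMass d ν * ∫ y, G1 x y * f y ^ 2 ∂μ ∂μ := by
          refine BddMeas.integral_mono ((BddMeas.integral_right (F := fun x y => G1 x y * f y)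
            (b1.mul (hf.comp measurable_snd)) μ).pow 2)
            ((bF.integral_right μ).const_mul _)
            fun x => ?_
          refine (sq_integral_weight_mul_le μ (b1.curry x) (hG10 x) hf).trans ?_
          exact mul_le_mul_of_nonneg_right (hG1m x)
            (integral_nonneg fun y => mul_nonneg (hG10 x y) (sq_nonneg _))
      _ ≤ _ := by
          rw [integral_const_mul, pow_two, mul_assoc (B * gaussMass d ν)]
          exact mul_le_mul_of_nonneg_left e1 (by positivity)
  set v : EuclideanSpace ℝ (Fin d) → ℝ := fun x => r x * χ x with hv
  have hvm : Measurable v := hr.measurable.mul hχb.1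
  have hv0 : ∀ x, 0 ≤ v x := fun x => mul_nonneg (hr.nonneg x) (hχ0 x)
  have hvr : ∀ x, v x ≤ r x := fun x => mul_le_of_le_one_right (hr.nonneg x) (hχ1 x)
  have hvi : Integrable v := hr.integrable.mono hvm.aestronglyMeasurable (ae_of_all _ fun x => by
    rw [Real.norm_eq_abs, Real.norm_eq_abs, abs_of_nonneg (hv0 x), abs_of_nonneg (hr.nonneg x)]
    exact hvr x)
  have hv2 : Integrable fun x => v x ^ 2 :=
    hr2.mono (hvm.pow_const 2).aestronglyMeasurable (ae_of_all _ fun x => by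
      rw [Real.norm_eq_abs, Real.norm_eq_abs, abs_of_nonneg (sq_nonneg _),
        abs_of_nonneg (sq_nonneg _)]
      exact pow_le_pow_left₀ (hv0 x) (hvr x) 2)
  have hve : ∫ x, v x ^ 2 = ∫ x, s.indicator (fun x => r x ^ 2) x := by
    refine integral_congr_ae (ae_of_all _ fun x => ?_)
    by_cases hx : x ∈ s <;> simp [hv, hχ, hx]
  have e2 : ∫ x, ∫ y, G2 x y ^ 2 ∂μ ∂μ ≤ gaussMass d (2 * ν) * (η * (∫ x, r x ^ 2)
      + (∫ x, s.indicator (fun x => r x ^ 2) x) / η) := by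
    have bL : BddMeas (Function.uncurry fun x y => χ x * gaussKernel (2 * ν) x y) :=
      (hχb.comp measurable_fst).mul hG2.bddMeas
    have bR : BddMeas (Function.uncurry fun x y => gaussKernel (2 * ν) x y * χ y) :=
      hG2.bddMeas.mul (hχb.comp measurable_snd)
    -- The indicator that at least one point lies in `s` is at most `χ x + χ y`.
    have step : ∫ x, ∫ y, G2 x y ^ 2 ∂μ ∂μ
        ≤ ∫ x, ∫ y, χ x * gaussKernel (2 * ν) x y ∂μ ∂μ
          + ∫ x, ∫ y, gaussKernel (2 * ν) x y * χ y ∂μ ∂μ := by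
      rw [← (bL.integral_right μ).integral_add (bR.integral_right μ)]
      refine BddMeas.integral_mono (BddMeas.integral_right (F := fun x y => G2 x y ^ 2)
        (b2.pow 2) μ) ((bL.integral_right μ).add (bR.integral_right μ)) fun x => ?_
      rw [← (bL.curry x).integral_add (bR.curry x)]
      refine BddMeas.integral_mono ((b2.curry x).pow 2) ((bL.curry x).add (bR.curry x)) fun y => ?_
      rw [gaussKernel_two_mul]
      have g0 := sq_nonneg (gaussKernel ν x y)
      simp only [hG2', mul_pow]
      by_cases hx : x ∈ s <;> by_cases hy : y ∈ s <;>
        simp [hχ, hx, hy, g0]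
    have l1 : ∫ x, ∫ y, χ x * gaussKernel (2 * ν) x y ∂μ ∂μ
        = ∫ x, ∫ y, gaussKernel (2 * ν) x y * χ y ∂μ ∂μ := by
      rw [integral_integral_swap (bL.integrable _)]
      refine integral_congr_ae (ae_of_all _ fun x => integral_congr_ae (ae_of_all _ fun y => ?_))
      dsimp only
      rw [mul_comm, hG2.symm]
    have l2 : ∫ x, ∫ y, gaussKernel (2 * ν) x y * χ y ∂μ ∂μ
        = ∫ x, r x * ∫ y, gaussKernel (2 * ν) x y * v y := by
      rw [hμ, hr.integral_densityMeasure]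
      refine integral_congr_ae (ae_of_all _ fun x => ?_)
      dsimp only
      rw [hr.integral_densityMeasure]
      congr 1
      refine integral_congr_ae (ae_of_all _ fun y => ?_)
      simp only [hv]
      ring
    have l3 := integral_mul_integral_gaussKernel_mul_le hν2 hr.nonneg hr2 hvm hv0 hvi hv2 hη
    rw [hve] at l3
    rw [l1, l2] at step
    linarith
  have m2 : ∫ x, (∫ y, G2 x y * f y ∂μ) ^ 2 ∂μ ≤ (∫ x, ∫ y, G2 x y ^ 2 ∂μ ∂μ) * W := by
    rw [← integral_mul_const]
    exact BddMeas.integral_mono ((BddMeas.integral_right (F := fun x y => G2 x y * f y)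
      (b2.mul (hf.comp measurable_snd)) μ).pow 2)
      ((BddMeas.integral_right (F := fun x y => G2 x y ^ 2) (b2.pow 2) μ).mul (.const W))
      fun x => sq_integral_mul_le μ (b2.curry x) hf
  have c1 : BddMeas fun x => ∫ y, G1 x y * f y ∂μ :=
    BddMeas.integral_right (F := fun x y => G1 x y * f y) (b1.mul (hf.comp measurable_snd)) μ
  have c2 : BddMeas fun x => ∫ y, G2 x y * f y ∂μ :=
    BddMeas.integral_right (F := fun x y => G2 x y * f y) (b2.mul (hf.comp measurable_snd)) μ
  have e3 : ∀ x, ∫ y, gaussKernel ν x y * f y ∂μ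
      = ∫ y, G1 x y * f y ∂μ + ∫ y, G2 x y * f y ∂μ := fun x => by
    rw [← ((b1.curry x).mul hf).integral_add ((b2.curry x).mul hf)]
    refine integral_congr_ae (ae_of_all _ fun y => ?_)
    simp only [hG1, hG2']
    ring
  simp_rw [e3]
  refine (((c1.add c2).pow 2).integral_mono (((c1.pow 2).const_mul 2).add ((c2.pow 2).const_mul 2))
    fun x => add_sq_le.trans_eq (mul_add _ _ _)).trans ?_
  rw [((c1.pow 2).const_mul 2).integral_add ((c2.pow 2).const_mul 2), integral_const_mul,
    integral_const_mul]
  have m3 := m2.trans (mul_le_mul_of_nonneg_right e2 hW0)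
  nlinarith

end Gaussian

/-! ### Fourier representation of the Gaussian energy and square integrability of the density. -/

/-- Identifies the approximate identity of `Real.tendsto_integral_gaussian_smul'` at parameter
`ν/π²` with the normalised Gaussian kernel. -/
theorem gaussian_smul_integrand {d : ℕ} {ν : ℝ} (hν : 0 < ν) (x w : EuclideanSpace ℝ (Fin d)) :
    (Real.pi * ((ν / Real.pi ^ 2 : ℝ) : ℂ)) ^ (Module.finrank ℝ (EuclideanSpace ℝ (Fin d)) / 2 : ℂ)
      * Complex.exp (-(Real.pi : ℂ) ^ 2 * ((ν / Real.pi ^ 2 : ℝ) : ℂ) * (‖x - w‖ : ℂ) ^ 2)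
      = (((gaussMass d ν)⁻¹ * gaussKernel ν x w : ℝ) : ℂ) := by
  have hπ := Real.pi_pos
  have e1 : (gaussMass d ν)⁻¹ = (ν / Real.pi) ^ ((d : ℝ) / 2) := by
    rw [gaussMass, ← Real.inv_rpow (by positivity), inv_div]
  rw [Complex.ofReal_mul, e1, Complex.ofReal_cpow (by positivity), gaussKernel,
    Complex.ofReal_exp, finrank_euclideanSpace_fin]
  congr 2
  · push_cast
    field_simp
  · push_cast
    rfl
  · push_cast
    field_simp

section Fourier

variable {d : ℕ} {p r : EuclideanSpace ℝ (Fin d) → ℝ} (hr : IsNiceDensity r)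
  (hpr : r =ᵐ[volume] p)

include hr

theorem IsNiceDensity.integral_densityMeasure_complex (f : EuclideanSpace ℝ (Fin d) → ℂ) :
    ∫ x, f x ∂(densityMeasure r) = ∫ x, (r x : ℂ) * f x := by
  rw [densityMeasure, integral_withDensity_eq_integral_toReal_smul hr.measurable.ennreal_ofReal
    (ae_of_all _ fun x => ENNReal.ofReal_lt_top)]
  simp only [ENNReal.toReal_ofReal (hr.nonneg _), Complex.real_smul]

include hpr in
theorem IsNiceDensity.norm_fourierTransform_sq (ω : EuclideanSpace ℝ (Fin d)) :
    ‖fourierTransform p ω‖ ^ 2 = ((2 * Real.pi) ^ (-(d : ℝ) / 2)) ^ 2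
      * ‖∫ x, Complex.exp (-(Complex.I * ((inner ℝ x ω : ℝ) : ℂ))) ∂(densityMeasure r)‖ ^ 2 := by
  have h0 : 0 ≤ (2 * Real.pi) ^ (-(d : ℝ) / 2) := Real.rpow_nonneg (by positivity) _
  rw [fourierTransform, hr.integral_densityMeasure_complex, norm_mul, Complex.norm_real,
    Real.norm_eq_abs, abs_of_nonneg h0, mul_pow]
  congr 3
  exact integral_congr_ae (hpr.mono fun x hx => by simp only [hx])

/-- Plancherel-type identity for the Gaussian energy of a density. -/
theorem IsNiceDensity.integral_gaussian_mul_norm_sq {ε ν : ℝ} (hε : 0 < ε)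
    (hεν : ν = 1 / (4 * ε)) :
    ∫ ω : EuclideanSpace ℝ (Fin d), Real.exp (-ε * ‖ω‖ ^ 2)
        * ‖∫ x, Complex.exp (-(Complex.I * ((inner ℝ x ω : ℝ) : ℂ))) ∂(densityMeasure r)‖ ^ 2
      = gaussMass d ε
        * ∫ x, kernelMean (densityMeasure r) (gaussKernel ν) x ∂(densityMeasure r) := by
  have := hr.isProbabilityMeasure
  have hν : 0 < ν := by rw [hεν]; positivity
  have hG := isUnitKernel_gaussKernel (d := d) hν.le
  set μ := densityMeasure r with hμ
  -- Fubini for `exp(-ε‖ω‖² - i⟨x - y, ω⟩)`: integrating over `(x, y)` first gives the squared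
  -- modulus of the transform, integrating over `ω` first gives the Gaussian kernel with `ν =
  -- 1/(4ε)`.
  set F : EuclideanSpace ℝ (Fin d) → EuclideanSpace ℝ (Fin d) × EuclideanSpace ℝ (Fin d) → ℂ :=
    fun ω z => Complex.exp (-(ε : ℂ) * (‖ω‖ : ℂ) ^ 2
      + -Complex.I * ((inner ℝ (z.1 - z.2) ω : ℝ) : ℂ)) with hF
  have hFn : ∀ ω z, ‖F ω z‖ = Real.exp (-ε * ‖ω‖ ^ 2) := fun ω z => by
    rw [hF, Complex.norm_exp]
    congr 1
    simp [← Complex.ofReal_pow]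
  have hgi : Integrable fun ω : EuclideanSpace ℝ (Fin d) => Real.exp (-ε * ‖ω‖ ^ 2) := by
    simpa [gaussKernel] using integrable_gaussKernel hε (0 : EuclideanSpace ℝ (Fin d))
  have hFi : Integrable (Function.uncurry F) (volume.prod (μ.prod μ)) := by
    refine (hgi.comp_fst (μ.prod μ)).mono' ?_ (ae_of_all _ fun q => (hFn q.1 q.2).le)
    have : Continuous (Function.uncurry F) := by
      simp only [hF, Function.uncurry_def]
      fun_prop
    exact this.aestronglyMeasurable
  have e1 : ∀ ω, ∫ z, F ω z ∂(μ.prod μ) = ((Real.exp (-ε * ‖ω‖ ^ 2)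
      * ‖∫ x, Complex.exp (-(Complex.I * ((inner ℝ x ω : ℝ) : ℂ))) ∂μ‖ ^ 2 : ℝ) : ℂ) := fun ω => by
    have e : ∀ z : EuclideanSpace ℝ (Fin d) × EuclideanSpace ℝ (Fin d),
        F ω z = (Real.exp (-ε * ‖ω‖ ^ 2) : ℂ)
          * (Complex.exp (-(Complex.I * ((inner ℝ z.1 ω : ℝ) : ℂ)))
            * (starRingEnd ℂ) (Complex.exp (-(Complex.I * ((inner ℝ z.2 ω : ℝ) : ℂ))))) :=
      fun z => by
        rw [← Complex.exp_conj, ← Complex.exp_add, Complex.ofReal_exp, ← Complex.exp_add, hF]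
        dsimp only
        congr 1
        rw [inner_sub_left]
        simp only [map_neg, map_mul, Complex.conj_I, Complex.conj_ofReal]
        push_cast
        ring
    simp_rw [e]
    rw [integral_const_mul, integral_prod_mul
      (fun x => Complex.exp (-(Complex.I * ((inner ℝ x ω : ℝ) : ℂ))))
      (fun y => (starRingEnd ℂ) (Complex.exp (-(Complex.I * ((inner ℝ y ω : ℝ) : ℂ))))),
      integral_conj, Complex.mul_conj, Complex.normSq_eq_norm_sq]
    push_cast
    rfl
  have e2 : ∀ z : EuclideanSpace ℝ (Fin d) × EuclideanSpace ℝ (Fin d),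
      ∫ ω, F ω z = ((gaussMass d ε * gaussKernel ν z.1 z.2 : ℝ) : ℂ) := fun z => by
    rw [hF, GaussianFourier.integral_cexp_neg_mul_sq_norm_add
      (show 0 < (ε : ℂ).re by simpa using hε), gaussMass, gaussKernel, Complex.ofReal_mul,
      Complex.ofReal_exp, Complex.ofReal_cpow (by positivity)]
    congr 2
    · push_cast
      rfl
    · simp
    · rw [neg_sq, Complex.I_sq, hεν]
      push_cast
      field_simp
  have e3 := integral_integral_swap hFi
  simp_rw [e1, e2] at e3
  rw [integral_complex_ofReal, integral_complex_ofReal, Complex.ofReal_inj] at e3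
  have e4 : ∫ a, gaussKernel ν a.1 a.2 ∂(μ.prod μ)
      = ∫ x, kernelMean μ (gaussKernel ν) x ∂μ :=
    integral_prod (fun a => gaussKernel ν a.1 a.2) (hG.bddMeas.integrable (μ.prod μ))
  rw [e3, integral_const_mul, e4]

include hpr in
/-- The Gaussian energy of a density in the Sobolev class is of the order of the Gaussian mass. -/
theorem IsNiceDensity.exists_integral_kernelMean_le {s : ℝ} (hs : 0 ≤ s)
    (hp : Integrable (sobolevIntegrand s p) volume) :
    ∃ K, ∀ ν, 0 < ν →
      ∫ x, kernelMean (densityMeasure r) (gaussKernel ν) x ∂(densityMeasure r)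
        ≤ K * gaussMass d ν := by
  set κ : ℝ := ((2 * Real.pi) ^ (-(d : ℝ) / 2)) ^ 2 with hκ
  have hκ0 : 0 < κ := by positivity
  set I := ∫ ω, sobolevIntegrand s p ω with hI
  refine ⟨I / κ / (4 * Real.pi ^ 2) ^ ((d : ℝ) / 2), fun ν hν => ?_⟩
  have hε : 0 < 1 / (4 * ν) := by positivity
  have h1 := hr.integral_gaussian_mul_norm_sq hε (ν := ν) (by field_simp)
  have hb : ∀ ω : EuclideanSpace ℝ (Fin d), Real.exp (-(1 / (4 * ν)) * ‖ω‖ ^ 2)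
        * ‖∫ x, Complex.exp (-(Complex.I * ((inner ℝ x ω : ℝ) : ℂ))) ∂(densityMeasure r)‖ ^ 2
      ≤ 1 / κ * sobolevIntegrand s p ω := fun ω => by
    have h2 := hr.norm_fourierTransform_sq hpr ω
    set P := ‖∫ x, Complex.exp (-(Complex.I * ((inner ℝ x ω : ℝ) : ℂ))) ∂(densityMeasure r)‖ ^ 2
      with hP
    have hP0 : 0 ≤ P := sq_nonneg _
    have h3 : Real.exp (-(1 / (4 * ν)) * ‖ω‖ ^ 2) ≤ 1 :=
      Real.exp_le_one_iff.2 (by nlinarith [mul_nonneg hε.le (sq_nonneg ‖ω‖)])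
    have h4 : 1 ≤ (1 + ‖ω‖ ^ 2) ^ s := Real.one_le_rpow (by nlinarith [sq_nonneg ‖ω‖]) hs
    rw [sobolevIntegrand, h2, ← hκ]
    calc Real.exp (-(1 / (4 * ν)) * ‖ω‖ ^ 2) * P ≤ 1 * P := by gcongr
      _ ≤ (1 + ‖ω‖ ^ 2) ^ s * P := by gcongr
      _ = 1 / κ * ((1 + ‖ω‖ ^ 2) ^ s * (κ * P)) := by field_simp
  have h5 := integral_mono_of_nonneg (ae_of_all _ fun ω => by positivity) (hp.const_mul (1 / κ))
    (ae_of_all _ hb)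
  rw [h1, integral_const_mul, ← hI] at h5
  -- The two masses have a product independent of `ν`, so dividing by the first is multiplying by
  -- the second up to a constant.
  have hm : gaussMass d (1 / (4 * ν)) * gaussMass d ν = (4 * Real.pi ^ 2) ^ ((d : ℝ) / 2) := by
    rw [gaussMass, gaussMass, ← Real.mul_rpow (by positivity) (by positivity)]
    congr 1
    field_simp
  have hm0 := gaussMass_pos (d := d) hν
  have hm1 := gaussMass_pos (d := d) hε
  rw [← hm, div_mul_eq_mul_div, le_div_iff₀ (by positivity)]
  have := mul_le_mul_of_nonneg_right h5 hm0.le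
  calc _ = _ := by ring
    _ ≤ _ := this
    _ = _ := by ring

include hpr in
theorem IsNiceDensity.tendsto_kernelMean (hc : ∀ᵐ x, ContinuousAt p x) {ν : ℕ → ℝ}
    (hν : ∀ k, 0 < ν k) (hν_top : Tendsto ν atTop atTop) :
    ∀ᵐ x, Tendsto (fun k => (gaussMass d (ν k))⁻¹
      * kernelMean (densityMeasure r) (gaussKernel (ν k)) x) atTop (𝓝 (r x)) := by
  have hpi : Integrable p := hr.integrable.congr hpr
  filter_upwards [hc, hpr] with x hx hxr
  have h := (Real.tendsto_integral_gaussian_smul' (hpi.ofReal (𝕜 := ℂ)) (v := x)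
    (Complex.continuous_ofReal.continuousAt.comp hx)).comp
    (hν_top.atTop_div_const (by positivity : (0 : ℝ) < Real.pi ^ 2))
  have h' := (Complex.continuous_re.tendsto _).comp h
  rw [hxr]
  refine h'.congr fun k => ?_
  rw [Function.comp_apply, Function.comp_apply]
  have e : (∫ w, ((Real.pi * ((ν k / Real.pi ^ 2 : ℝ) : ℂ)) ^ (Module.finrank ℝ
      (EuclideanSpace ℝ (Fin d)) / 2 : ℂ) * Complex.exp (-(Real.pi : ℂ) ^ 2
      * ((ν k / Real.pi ^ 2 : ℝ) : ℂ) * (‖x - w‖ : ℂ) ^ 2)) • ((p w : ℝ) : ℂ))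
      = (((gaussMass d (ν k))⁻¹ * kernelMean (densityMeasure r) (gaussKernel (ν k)) x : ℝ) : ℂ) := by
    rw [kernelMean, hr.integral_densityMeasure, ← integral_const_mul, ← integral_complex_ofReal]
    refine integral_congr_ae (hpr.mono fun w hw => ?_)
    dsimp only
    rw [gaussian_smul_integrand (hν k), smul_eq_mul, ← Complex.ofReal_mul, hw]
    congr 1
    ring
  exact (congrArg Complex.re e).trans (Complex.ofReal_re _)

include hpr in
-- Fatou's lemma for `r` times its Gaussian mollification. It serves twice: against the Sobolev
-- upper bound it proves `r ∈ L²`, and then it bounds `σ` from below.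
theorem IsNiceDensity.lintegral_sq_le_liminf (hc : ∀ᵐ x, ContinuousAt p x) {ν : ℕ → ℝ}
    (hν : ∀ k, 0 < ν k) (hν_top : Tendsto ν atTop atTop) :
    ∫⁻ x, ENNReal.ofReal (r x ^ 2) ≤ liminf (fun k => ENNReal.ofReal ((gaussMass d (ν k))⁻¹
      * ∫ x, kernelMean (densityMeasure r) (gaussKernel (ν k)) x ∂(densityMeasure r))) atTop := by
  have := hr.isProbabilityMeasure
  have hG := fun k => isUnitKernel_gaussKernel (d := d) (hν k).le
  have hm := fun k => gaussMass_pos (d := d) (hν k)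
  have bg := fun k => (hG k).bddMeas.kernelMean (densityMeasure r)
  set f : ℕ → EuclideanSpace ℝ (Fin d) → ℝ := fun k x => r x * ((gaussMass d (ν k))⁻¹
    * kernelMean (densityMeasure r) (gaussKernel (ν k)) x) with hf
  have hf0 : ∀ k x, 0 ≤ f k x := fun k x => mul_nonneg (hr.nonneg x)
    (mul_nonneg (inv_nonneg.2 (hm k).le) ((hG k).kernelMean_nonneg _ x))
  have hfm : ∀ k, Measurable (f k) := fun k => hr.measurable.mul ((bg k).1.const_mul _)
  have e1 : ∀ k, ∫⁻ x, ENNReal.ofReal (f k x) = ENNReal.ofReal ((gaussMass d (ν k))⁻¹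
      * ∫ x, kernelMean (densityMeasure r) (gaussKernel (ν k)) x ∂(densityMeasure r)) := fun k => by
    rw [← integral_const_mul, hr.integral_densityMeasure]
    refine (ofReal_integral_eq_lintegral_ofReal ?_ (ae_of_all _ (hf0 k))).symm
    refine (hr.integrable.const_mul (gaussMass d (ν k))⁻¹).mono' (hfm k).aestronglyMeasurable
      (ae_of_all _ fun x => ?_)
    rw [Real.norm_eq_abs, abs_of_nonneg (hf0 k x)]
    have h1 := (hG k).kernelMean_le_one (densityMeasure r) x
    have h2 := hr.nonneg x
    have h3 := hm k
    calc f k x ≤ r x * ((gaussMass d (ν k))⁻¹ * 1) := by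
          simp only [hf]
          gcongr
      _ = _ := by ring
  have e2 : ∫⁻ x, ENNReal.ofReal (r x ^ 2)
      ≤ ∫⁻ x, liminf (fun k => ENNReal.ofReal (f k x)) atTop := by
    refine lintegral_mono_ae ?_
    filter_upwards [hr.tendsto_kernelMean hpr hc hν hν_top] with x hx
    rw [(ENNReal.tendsto_ofReal (hx.const_mul (r x))).liminf_eq, pow_two]
  refine e2.trans ((lintegral_liminf_le fun k => (hfm k).ennreal_ofReal).trans (le_of_eq ?_))
  simp_rw [e1]

include hpr in
theorem IsNiceDensity.integrable_sq {s : ℝ} (hs : 0 ≤ s)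
    (hp : Integrable (sobolevIntegrand s p) volume) (hc : ∀ᵐ x, ContinuousAt p x) :
    Integrable fun x => r x ^ 2 := by
  obtain ⟨K, hK⟩ := hr.exists_integral_kernelMean_le hpr hs hp
  have h := hr.lintegral_sq_le_liminf hpr hc (ν := fun k => (k : ℝ) + 1) (fun k => by positivity)
    (tendsto_atTop_add_const_right _ _ tendsto_natCast_atTop_atTop)
  have h2 : liminf (fun k : ℕ => ENNReal.ofReal ((gaussMass d ((k : ℝ) + 1))⁻¹
      * ∫ x, kernelMean (densityMeasure r) (gaussKernel ((k : ℝ) + 1)) x ∂(densityMeasure r)))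
      atTop ≤ ENNReal.ofReal K := by
    refine (liminf_le_liminf (v := fun _ => ENNReal.ofReal K)
      (Eventually.of_forall fun k => ENNReal.ofReal_le_ofReal ?_)).trans (by simp)
    have hk : (0 : ℝ) < (k : ℝ) + 1 := by positivity
    rw [inv_mul_le_iff₀ (gaussMass_pos hk), mul_comm]
    exact hK _ hk
  refine ⟨(hr.measurable.pow_const 2).aestronglyMeasurable, ?_⟩
  rw [hasFiniteIntegral_iff_ofReal (ae_of_all _ fun x => sq_nonneg _)]
  exact (h.trans h2).trans_lt ENNReal.ofReal_lt_top

theorem IsNiceDensity.integral_sq_pos (hr2 : Integrable fun x => r x ^ 2) :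
    0 < ∫ x, r x ^ 2 := by
  rw [integral_pos_iff_support_of_nonneg (fun x => sq_nonneg _) hr2]
  have h : 0 < ∫ x, r x := by rw [hr.integral_eq_one]; exact one_pos
  rw [integral_pos_iff_support_of_nonneg hr.nonneg hr.integrable] at h
  convert! h using 2
  ext x
  simp

include hpr in
-- Halving `∫ r²` makes the comparison with the lower limit strict, so it holds eventually. Applied
-- with `2ν`, this is the lower bound for `σ`.
theorem IsNiceDensity.eventually_le_integral_kernelMean (hr2 : Integrable fun x => r x ^ 2)
    (hc : ∀ᵐ x, ContinuousAt p x) {ν : ℕ → ℝ} (hν : ∀ k, 0 < ν k)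
    (hν_top : Tendsto ν atTop atTop) :
    ∀ᶠ k in atTop, gaussMass d (ν k) * ((∫ x, r x ^ 2) / 2)
      ≤ ∫ x, kernelMean (densityMeasure r) (gaussKernel (ν k)) x ∂(densityMeasure r) := by
  have hA := hr.integral_sq_pos hr2
  have h := hr.lintegral_sq_le_liminf hpr hc hν hν_top
  rw [← ofReal_integral_eq_lintegral_ofReal hr2 (ae_of_all _ fun x => sq_nonneg _)] at h
  have h2 : ENNReal.ofReal ((∫ x, r x ^ 2) / 2) < ENNReal.ofReal (∫ x, r x ^ 2) :=
    (ENNReal.ofReal_lt_ofReal_iff hA).2 (half_lt_self hA)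
  filter_upwards [eventually_lt_of_lt_liminf (h2.trans_le h)] with k hk
  have hk' := (ENNReal.ofReal_lt_ofReal_iff_of_nonneg (by positivity)).1 hk
  rw [← div_eq_inv_mul, lt_div_iff₀ (gaussMass_pos (hν k))] at hk'
  linarith

end Fourier

/-! ### Asymptotics of the Gaussian mass and auxiliary limits. -/

theorem gaussMass_two_mul (d : ℕ) {ν : ℝ} (hν : 0 < ν) :
    gaussMass d ν = 2 ^ ((d : ℝ) / 2) * gaussMass d (2 * ν) := by
  have := Real.pi_pos
  rw [gaussMass, gaussMass, ← Real.mul_rpow (by positivity) (by positivity)]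
  congr 1
  field_simp

theorem tendsto_gaussMass {d : ℕ} (hd : 0 < d) {ν : ℕ → ℝ} (hν_top : Tendsto ν atTop atTop) :
    Tendsto (fun n => gaussMass d (ν n)) atTop (𝓝 0) := by
  have hd' : (0 : ℝ) < (d : ℝ) / 2 := by positivity
  have h := (hν_top.const_div_atTop Real.pi).rpow_const (p := (d : ℝ) / 2) (Or.inr hd'.le)
  rwa [Real.zero_rpow hd'.ne'] at h

/-- The place where the growth condition acts: the power `d/2` of `ν / n^(4/d)` is `ν^(d/2) / n²`.
-/
theorem tendsto_inv_sq_mul_gaussMass {d : ℕ} (hd : 0 < d) {ν : ℕ → ℝ} (hν : ∀ n, 0 < ν n)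
    (hν_o : ν =o[atTop] fun n : ℕ => (n : ℝ) ^ ((4 : ℝ) / (d : ℝ))) :
    Tendsto (fun n : ℕ => 1 / ((n : ℝ) ^ 2 * gaussMass d (2 * ν n))) atTop (𝓝 0) := by
  have hπ := Real.pi_pos
  have hd' : (0 : ℝ) < (d : ℝ) / 2 := by positivity
  have h := (hν_o.tendsto_div_nhds_zero.const_mul (2 / Real.pi)).rpow_const
    (p := (d : ℝ) / 2) (Or.inr hd'.le)
  rw [mul_zero, Real.zero_rpow hd'.ne'] at h
  refine h.congr fun n => ?_
  have hn := hν n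
  have hn0 : (0 : ℝ) ≤ (n : ℝ) := n.cast_nonneg
  have e : ((n : ℝ) ^ ((4 : ℝ) / (d : ℝ))) ^ ((d : ℝ) / 2) = (n : ℝ) ^ 2 := by
    rw [← Real.rpow_mul hn0, ← Real.rpow_natCast]
    congr 1
    field_simp
    norm_num
  have e2 : 1 / gaussMass d (2 * ν n) = (2 / Real.pi * ν n) ^ ((d : ℝ) / 2) := by
    rw [gaussMass, one_div, ← Real.inv_rpow (by positivity), inv_div, mul_div_right_comm]
  rw [← mul_div_assoc, Real.div_rpow (by positivity) (by positivity), e, ← e2, div_div, mul_comm]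

theorem integral_pos_of_forall_pos {α : Type*} [MeasurableSpace α] {μ : Measure α}
    [IsProbabilityMeasure μ] {f : α → ℝ} (hf : ∀ x, 0 < f x) (hfi : Integrable f μ) :
    0 < ∫ x, f x ∂μ := by
  have h : Function.support f = Set.univ := Set.eq_univ_of_forall fun x => (hf x).ne'
  rw [integral_pos_iff_support_of_nonneg (fun x => (hf x).le) hfi, h]
  simp

/-- Common shape of the four conditions: a numerator that is `o(g)`, with `σ` eventually at least a
multiple of the Gaussian mass `g`. -/
theorem tendsto_div_zero_of_le_mul {f u g σ : ℕ → ℝ} {a : ℝ} (ha : 0 < a) (hf0 : ∀ n, 0 ≤ f n)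
    (hg : ∀ n, 0 < g n) (hf : ∀ n, f n ≤ u n * g n) (hu : Tendsto u atTop (𝓝 0))
    (hσ : ∀ᶠ n in atTop, g n * a ≤ σ n) : Tendsto (fun n => f n / σ n) atTop (𝓝 0) := by
  have h := hu.div_const a
  rw [zero_div] at h
  have hpos : ∀ᶠ n in atTop, 0 < σ n := hσ.mono fun n hn => (mul_pos (hg n) ha).trans_le hn
  refine squeeze_zero' (hpos.mono fun n hn => div_nonneg (hf0 n) hn.le) ?_ h
  filter_upwards [hσ, hpos] with n hn hn'
  have h1 := hg n
  have h2 : 0 ≤ u n := le_of_mul_le_mul_right (by simpa using (hf0 n).trans (hf n)) h1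
  rw [div_le_div_iff₀ hn' ha]
  calc f n * a ≤ u n * g n * a := by gcongr; exact hf n
    _ = u n * (g n * a) := by ring
    _ ≤ u n * σ n := by gcongr

theorem tendsto_integral_indicator_lt {α : Type*} [MeasurableSpace α] {μ : Measure α}
    {r f : α → ℝ} (hr : Measurable r) (hf : Integrable f μ) {B : ℕ → ℝ}
    (hB : Tendsto B atTop atTop) :
    Tendsto (fun n => ∫ x, {x | B n < r x}.indicator f x ∂μ) atTop (𝓝 0) := by
  have h := tendsto_integral_of_dominated_convergence (μ := μ)
    (F := fun n x => {x | B n < r x}.indicator f x) (f := fun _ => 0) (fun x => ‖f x‖)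
    (fun n => (hf.indicator (measurableSet_lt measurable_const hr)).aestronglyMeasurable)
    hf.norm (fun n => ae_of_all _ fun x => norm_indicator_le_norm_self _ _)
    (ae_of_all _ fun x => tendsto_const_nhds.congr' ?_)
  · simpa using h
  · filter_upwards [hB.eventually_ge_atTop (r x)] with n hn
    simp [hn]

theorem homStat_eq_pooledStat {d n m : ℕ} {Ω : Type*} (X : Fin n → Ω → EuclideanSpace ℝ (Fin d))
    (Y : Fin m → Ω → EuclideanSpace ℝ (Fin d)) (ν : ℝ) :
    (fun ω => homStat ν (fun i => X i ω) (fun j => Y j ω))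
      = fun ω => pooledStat ν fun a => Fin.append X Y a ω := by
  ext ω
  simp only [pooledStat, Fin.append_left, Fin.append_right]

/-! ### Transfer from the samples to the product measure. -/

section Law

variable {d n m : ℕ} {Ω : Type*} [MeasurableSpace Ω] {P : Measure Ω}
  {μ : Measure (EuclideanSpace ℝ (Fin d))}
  {X : Fin n → Ω → EuclideanSpace ℝ (Fin d)} {Y : Fin m → Ω → EuclideanSpace ℝ (Fin d)}
  (hX : ∀ i, HasLaw (X i) μ P) (hY : ∀ j, HasLaw (Y j) μ P)

include hX hY

theorem hasLaw_append (a : Fin (n + m)) : HasLaw (Fin.append X Y a) μ P := by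
  refine Fin.addCases (fun i => ?_) (fun j => ?_) a
  · simpa using hX i
  · simpa using hY j

theorem hasLaw_pi_append [IsProbabilityMeasure P] (h : iIndepFun (Fin.append X Y) P) :
    HasLaw (fun ω a => Fin.append X Y a ω) (Measure.pi fun _ => μ) P where
  aemeasurable := aemeasurable_pi_lambda _ fun a => (hasLaw_append hX hY a).aemeasurable
  map_eq := by
    rw [h.map_fun_eq_pi_map fun a => (hasLaw_append hX hY a).aemeasurable]
    simp_rw [(hasLaw_append hX hY _).map_eq]

theorem aemeasurable_homStat [IsProbabilityMeasure P] (h : iIndepFun (Fin.append X Y) P) {ν : ℝ} (hν : 0 ≤ ν) :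
    AEMeasurable (fun ω => homStat ν (fun i => X i ω) (fun j => Y j ω)) P := by
  rw [homStat_eq_pooledStat]
  have hmeas := measurable_pooledStat (d := d) (n := n) (m := m) hν
  exact Measurable.comp_aemeasurable (f := fun ω a => Fin.append X Y a ω) hmeas
    (hasLaw_pi_append hX hY h).aemeasurable

theorem charFun_map_homStat [IsProbabilityMeasure P] (h : iIndepFun (Fin.append X Y) P) {ν : ℝ} (hν : 0 ≤ ν) (t : ℝ) :
    charFun (P.map fun ω => homStat ν (fun i => X i ω) (fun j => Y j ω)) t
      = ∫ z : Fin (n + m) → EuclideanSpace ℝ (Fin d),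
        Complex.exp (t * pooledStat ν z * Complex.I) ∂(Measure.pi fun _ => μ) := by
  have hmeas := measurable_pooledStat (d := d) (n := n) (m := m) hν
  have hc : Continuous fun x : ℝ => Complex.exp (t * x * Complex.I) := by fun_prop
  have e := integral_map (hasLaw_pi_append hX hY h).aemeasurable
    (f := fun z => Complex.exp (t * pooledStat ν z * Complex.I))
    (hc.measurable.comp hmeas).aestronglyMeasurable
  rw [(hasLaw_pi_append hX hY h).map_eq] at e
  rw [e, charFun_apply_real, integral_map (aemeasurable_homStat hX hY h hν)
    hc.aestronglyMeasurable]
  exact integral_congr_ae (ae_of_all _ fun ω => by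
    simp only [congrFun (homStat_eq_pooledStat X Y ν) ω])

end Law

/-! ### Verification of the four conditions. -/

section Limit

variable {d : ℕ} {p r : EuclideanSpace ℝ (Fin d) → ℝ} (hr : IsNiceDensity r)
  (hpr : r =ᵐ[volume] p)

include hr hpr

theorem IsNiceDensity.tendsto_charFun_pooledStat (hd : 0 < d)
    (hr2 : Integrable fun x => r x ^ 2) (hc : ∀ᵐ x, ContinuousAt p x)
    (m : ℕ → ℕ) {c C : ℝ} (hc0 : 0 < c)
    (hm : ∀ n : ℕ, 1 ≤ n → c ≤ (m n : ℝ) / (n : ℝ) ∧ (m n : ℝ) / (n : ℝ) ≤ C)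
    (ν : ℕ → ℝ) (hν : ∀ n, 0 < ν n) (hν_top : Tendsto ν atTop atTop)
    (hν_o : ν =o[atTop] fun n : ℕ => (n : ℝ) ^ ((4 : ℝ) / (d : ℝ))) (t : ℝ) :
    Tendsto (fun n => ∫ z : Fin (n + m n) → EuclideanSpace ℝ (Fin d),
      Complex.exp (t * pooledStat (ν n) z * Complex.I)
        ∂(Measure.pi fun _ => densityMeasure r)) atTop (𝓝 (Complex.exp (-(t : ℂ) ^ 2 / 2))) := by
  have := hr.isProbabilityMeasure
  have hA := hr.integral_sq_pos hr2
  set A := ∫ x, r x ^ 2 with hA_def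
  set μ := densityMeasure r with hμ
  have h2ν : ∀ n, 0 < 2 * ν n := fun n => by have := hν n; positivity
  set g : ℕ → ℝ := fun n => gaussMass d (2 * ν n) with hg_def
  have hg : ∀ n, 0 < g n := fun n => gaussMass_pos (h2ν n)
  have h2ν_top : Tendsto (fun n => 2 * ν n) atTop atTop := hν_top.const_mul_atTop two_pos
  have hg_lim : Tendsto g atTop (𝓝 0) := tendsto_gaussMass hd h2ν_top
  have hgs_lim : Tendsto (fun n => √(g n)) atTop (𝓝 0) := by simpa using hg_lim.sqrt
  set κ : ℝ := 2 ^ ((d : ℝ) / 2) with hκ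
  have hκ0 : 0 < κ := by positivity
  have hgκ : ∀ n, gaussMass d (ν n) = κ * g n := fun n => gaussMass_two_mul d (hν n)
  have hG := fun n => isUnitKernel_gaussKernel (d := d) (hν n).le
  set σ : ℕ → ℝ := fun n => ∫ x, ∫ y, gaussKernel (ν n) x y ^ 2 ∂μ ∂μ with hσ_def
  have hσe : ∀ n, σ n = ∫ x, kernelMean μ (gaussKernel (2 * ν n)) x ∂μ := fun n => by
    simp only [hσ_def, kernelMean, gaussKernel_two_mul]
  have hσ_ge : ∀ᶠ n in atTop, g n * (A / 2) ≤ σ n := by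
    simp only [hσe]
    exact hr.eventually_le_integral_kernelMean hpr hr2 hc h2ν h2ν_top
  have hσ0 : ∀ n, 0 < σ n := fun n => by
    have hG2 := isUnitKernel_gaussKernel (d := d) (h2ν n).le
    have hb := hG2.bddMeas.kernelMean μ
    rw [hσe]
    exact integral_pos_of_forall_pos (fun x => integral_pos_of_forall_pos
      (fun y => Real.exp_pos _) ((hG2.bddMeas.curry x).integrable μ)) (hb.integrable μ)
  set b := (1 + A) / 2 with hb_def
  have hb0 : 0 < b := by positivity
  set θ : ℕ → ℝ := fun n => √(g n) * b with hθ_def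
  have hθ : ∀ n x, kernelMean μ (gaussKernel (ν n)) x ≤ θ n := fun n x =>
    hr.kernelMean_gaussKernel_le hr2 (hν n) x
  have hθ0 : ∀ n, 0 ≤ θ n := fun n => by positivity
  -- The level `g^(-1/4)` tends to infinity, so the upper part of `r²` vanishes, while `B² g = √g`
  -- still tends to zero; both parts of `Λ` are then `o(g)`.
  set B : ℕ → ℝ := fun n => (√(√(g n)))⁻¹ with hB_def
  have hB0 : ∀ n, 0 ≤ B n := fun n => by positivity
  have hB_top : Tendsto B atTop atTop := by
    refine tendsto_inv_nhdsGT_zero.comp (tendsto_nhdsWithin_iff.2 ⟨?_, Eventually.of_forall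
      fun n => ?_⟩)
    · simpa using hgs_lim.sqrt
    · exact Real.sqrt_pos.2 (Real.sqrt_pos.2 (hg n))
  set e : ℕ → ℝ := fun n => ∫ x, {x | B n < r x}.indicator (fun x => r x ^ 2) x with he_def
  have he0 : ∀ n, 0 ≤ e n := fun n =>
    integral_nonneg fun x => Set.indicator_nonneg (fun _ _ => sq_nonneg _) _
  have he : Tendsto e atTop (𝓝 0) := tendsto_integral_indicator_lt hr.measurable hr2 hB_top
  obtain ⟨η, hη0, hη, heη⟩ := exists_pos_tendsto_div he0 he
  set Λ : ℕ → ℝ := fun n => 2 * (B n * gaussMass d (ν n)) ^ 2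
    + 2 * (g n * (η n * A + e n / η n)) with hΛ_def
  have hΛ0 : ∀ n, 0 ≤ Λ n := fun n => by
    have h1 := he0 n
    have h2 := hη0 n
    have h3 := hg n
    positivity
  have hn := tendsto_inv_sq_mul_gaussMass hd hν hν_o
  refine GaussianMMD.tendsto_charFun_pooledStat (σ := σ) (θ := θ) (Λ := Λ) μ m hc0 hm ν
    hν (fun n => rfl) hσ0 hθ hΛ0 (fun n f hf => ?_) ?_ ?_ ?_ ?_ t
  · exact hr.integral_sq_integral_gaussKernel_le hr2 (hν n) (hB0 n) (hη0 n) hf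
  · have h := tendsto_div_zero_of_le_mul (f := fun n : ℕ => 1 / (n : ℝ) ^ 2) (half_pos hA)
      (fun n => by positivity) hg (fun n => ?_) hn hσ_ge
    · exact h.congr fun n => div_div _ _ _
    · have := (hg n).ne'
      rw [one_div_mul_eq_div, div_mul_cancel_right₀ this, one_div]
  -- `θ/(nσ)` is of order at most `1/(n √g)`, the square root of the quantity in the first
  -- condition.
  · have hu := hn.sqrt.const_mul b
    rw [Real.sqrt_zero, mul_zero] at hu
    have h := tendsto_div_zero_of_le_mul (f := fun n : ℕ => θ n / (n : ℝ)) (half_pos hA)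
      (fun n => div_nonneg (hθ0 n) n.cast_nonneg) hg (fun n => ?_) hu hσ_ge
    · exact h.congr fun n => div_div _ _ _
    · refine le_of_eq ?_
      have h1 : 0 < √(g n) := Real.sqrt_pos.2 (hg n)
      rw [Real.sqrt_div zero_le_one, Real.sqrt_one, Real.sqrt_mul (sq_nonneg _),
        Real.sqrt_sq n.cast_nonneg]
      change √(g n) * b / n = b * (1 / (n * √(g n))) * g n
      conv_rhs => rw [← Real.mul_self_sqrt (hg n).le]
      field_simp
      rw [Real.sqrt_sq h1.le]
  · have hu := hgs_lim.mul_const (b * (κ * A))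
    rw [zero_mul] at hu
    refine tendsto_div_zero_of_le_mul (half_pos hA) (fun n => integral_nonneg fun x => sq_nonneg _)
      hg (fun n => ?_) hu hσ_ge
    refine ((hG n).integral_kernelMean_sq_le μ (hθ n)).trans ?_
    have h1 := hr.integral_kernelMean_gaussKernel_le hr2 (hν n)
    rw [hgκ] at h1
    calc _ ≤ θ n * (κ * g n * A) := mul_le_mul_of_nonneg_left h1 (hθ0 n)
      _ = _ := by simp only [hθ_def]; ring
  · have hu := (hgs_lim.const_mul (2 * κ ^ 2)).add (((hη.mul_const A).add heη).const_mul 2)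
    simp only [mul_zero, zero_mul, add_zero] at hu
    refine tendsto_div_zero_of_le_mul (half_pos hA) hΛ0 hg (fun n => le_of_eq ?_) hu hσ_ge
    have h1 : 0 < √(g n) := Real.sqrt_pos.2 (hg n)
    have h2 : B n ^ 2 * g n = √(g n) := by
      simp only [hB_def]
      rw [inv_pow, Real.sq_sqrt h1.le, inv_mul_eq_iff_eq_mul₀ h1.ne', Real.mul_self_sqrt (hg n).le]
    simp only [hΛ_def]
    rw [hgκ, ← h2]
    ring

end Limit

end GaussianMMD

/-! ### Convergence in distribution by Lévy's continuity theorem. -/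

theorem theorem4 {d : ℕ} (hd : 0 < d) {s M : ℝ} (hs : 0 ≤ s)
    -- sample sizes `n` and `m n` of the same order
    (m : ℕ → ℕ) {c C : ℝ} (hc : 0 < c)
    (hm : ∀ n : ℕ, 1 ≤ n → c ≤ (m n : ℝ) / (n : ℝ) ∧ (m n : ℝ) / (n : ℝ) ≤ C)
    -- scaling parameters
    (ν : ℕ → ℝ) (hν_pos : ∀ n, 0 < ν n) (hν_top : Tendsto ν atTop atTop)
    (hν_o : ν =o[atTop] fun n : ℕ => (n : ℝ) ^ ((4 : ℝ) / (d : ℝ)))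
    -- the densities, under the null hypothesis
    (p q : EuclideanSpace ℝ (Fin d) → ℝ)
    (hp : GaussianMMD.IsProbDensity p) (hq : GaussianMMD.IsProbDensity q)
    (hpq : p = q) (hpW : p ∈ GaussianMMD.sobolevBall d s M)
    -- for every `n`, two independent i.i.d. samples of sizes `n` and `m n`
    {Ω : ℕ → Type*} [∀ n, MeasurableSpace (Ω n)]
    (P : (n : ℕ) → Measure (Ω n)) [∀ n, IsProbabilityMeasure (P n)]
    (X : (n : ℕ) → Fin n → Ω n → EuclideanSpace ℝ (Fin d))
    (Y : (n : ℕ) → Fin (m n) → Ω n → EuclideanSpace ℝ (Fin d))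
    (hX : ∀ n i, HasLaw (X n i) (GaussianMMD.densityMeasure p) (P n))
    (hY : ∀ n j, HasLaw (Y n j) (GaussianMMD.densityMeasure q) (P n))
    (hindep : ∀ n, iIndepFun (Fin.append (X n) (Y n)) (P n)) :
    TendstoInDistribution
      (fun (n : ℕ) (ω : Ω n) =>
        GaussianMMD.homStat (ν n) (fun i => X n i ω) (fun j => Y n j ω))
      atTop (id : ℝ → ℝ) P (gaussianReal 0 1) := by
  subst hpq
  obtain ⟨r, hr, hrp, hμ⟩ := hp.exists_isNiceDensity
  rw [hμ] at hX hY
  have := hr.isProbabilityMeasure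
  have hr2 := hr.integrable_sq hrp hs hpW.1.2.2 hpW.1.2.1
  refine ⟨fun n => GaussianMMD.aemeasurable_homStat (hX n) (hY n) (hindep n) (hν_pos n).le,
    aemeasurable_id, ?_⟩
  refine ProbabilityMeasure.tendsto_of_tendsto_charFun fun t => ?_
  simp only [ProbabilityMeasure.coe_mk, Measure.map_id]
  have h := hr.tendsto_charFun_pooledStat hrp hd hr2 hpW.1.2.1 m hc hm ν hν_pos hν_top hν_o t
  have e : charFun (gaussianReal 0 1) t = Complex.exp (-(t : ℂ) ^ 2 / 2) := by
    rw [charFun_gaussianReal]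
    congr 1
    push_cast
    ring
  rw [e]
  exact h.congr fun n =>
    (GaussianMMD.charFun_map_homStat (hX n) (hY n) (hindep n) (hν_pos n).le t).symm
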